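/- Let $\mu$ be a symmetric probability measure on $\mathbb R$ with variance $1$ satisfying a Poincaré inequality: there is $C>0$ such that $\int|f-\int f\,d\mu|^2d\mu\le C\int|f'|^2d\mu$ for every $C^1$ function $f:\mathbb R\to\mathbb C$ with $f,f'\in L^2(\mu)$. A *Wigner matrix with distribution $\mu$* of size $n$ is a random Hermitian $n\times n$ matrix $X$ for which the $n^2$ real random variables $X_{ii}$ ($1\le i\le n$), $\sqrt2\,\mathrm{Re}\,X_{ij}$ and $\sqrt2\,\mathrm{Im}\,X_{ij}$ ($i<j$) are independent, each with the law of $\xi/\sqrt n$, where $\xi$ has law $\mu$. Let $m,r\ge 0$ be integers, let $a_0,\dots,a_r\in M_m(\mathbb C)$ be self-adjoint, and let $a\in M_m(\mathbb C)$. All norms on $M_m(\mathbb C)$ are operator norms. There exist a constant $K>0$ and a real polynomial $P_{10}$ of degree $10$ with positive coefficients, depending only on $\mu,m,r,a_0,\dots,a_r,a$, such that the following holds. Let $n\ge1$ and let $X^{(1)}_n,\dots,X^{(r)}_n$ be independent Wigner matrices of size $n$ with distribution $\mu$, on any probability space. Let $(\mathcal B,\tau)$ be a unital $C^*$-algebra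 with a faithful state and let $x_1,\dots,x_r\in\mathcal B$ be self-adjoint, free with respect to $\tau$, and each semicircular with mean $0$ and variance $1$ (density $\frac1{2\pi}\sqrt{4-t^2}$ on $[-2,2]$). Put $$S_n=a_0\otimes 1_n+\sum_{p=1}^r a_p\otimes X^{(p)}_n,\qquad s=a_0\otimes 1_{\mathcal B}+\sum_{p=1}^r a_p\otimes x_p .$$ Then, for every $\lambda\in M_m(\mathbb C)$ whose imaginary part $\mathrm{Im}(\lambda)=(\lambda-\lambda^*)/(2i)$ is positive definite, $\lambda\otimes 1_n-S_n$ and $\lambda\otimes1_{\mathcal B}-s$ are invertible, and with $$G^{(n)}=(\lambda\otimes1_n-S_n)^{-1},\qquad G(\lambda)=(\mathrm{id}_m\otimes\tau)\big[(\lambda\otimes 1_{\mathcal B}-s)^{-1}\big],$$ and with $G^{(n)}_{kk}\in M_m(\mathbb C)$ denoting the $(k,k)$ block of $G^{(n)}\in M_m(\mathbb C)\otimes M_n(\mathbb C)$, i.e. $(A\otimes B)_{kk}=B_{kk}A$, the random matrix $\frac1n\sum_kG^{(n)}_{kk}\,a\,G^{(n)}_{kk}$ is integrable and $$\Big\|\,\mathbb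 E\Big[\frac1n\sum_{k=1}^nG^{(n)}_{kk}\,a\,G^{(n)}_{kk}\Big]-G(\lambda)\,a\,G(\lambda)\Big\|\le\frac{(\|\lambda\|+K)\,P_{10}\big(\|\mathrm{Im}(\lambda)^{-1}\|\big)}{n}.$$ -/

import Mathlib

open MeasureTheory ProbabilityTheory
open scoped Matrix Kronecker ComplexOrder ComplexStarModule Matrix.Norms.L2Operator

universe u v

noncomputable section

/-! ### The law `μ` of the entries -/

/-- Poincaré inequality for a measure on the real line: for some `C > 0`, every `C¹` function
`f : ℝ → ℂ` with `f, f' ∈ L²(μ)` satisfies `∫ |f - ∫ f dμ|² dμ ≤ C ∫ |f'|² dμ`. -/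
def SatisfiesPoincare (μ : Measure ℝ) : Prop :=
  ∃ C : ℝ, 0 < C ∧ ∀ f : ℝ → ℂ, ContDiff ℝ 1 f → MemLp f 2 μ → MemLp (deriv f) 2 μ →
    ∫ x, ‖f x - ∫ y, f y ∂μ‖ ^ 2 ∂μ ≤ C * ∫ x, ‖deriv f x‖ ^ 2 ∂μ

/-- Invariance of a measure on the real line under `x ↦ -x`. -/
def IsSymmetricLaw (μ : Measure ℝ) : Prop := μ.map (fun x : ℝ => -x) = μ

/-! ### Wigner matrices -/

/-- The `n²` real coordinates of a Hermitian matrix `M`: `M i i` on the diagonal,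
`√2 Re (M i j)` at the positions `i < j`, and `√2 Im (M j i)` at the positions `j < i`. -/
def hermitianCoord {n : ℕ} (M : Matrix (Fin n) (Fin n) ℂ) (q : Fin n × Fin n) : ℝ :=
  if q.1 = q.2 then (M q.1 q.1).re
  else if q.1 < q.2 then √2 * (M q.1 q.2).re
  else √2 * (M q.2 q.1).im

variable {Ω : Type u} [MeasurableSpace Ω]

/-- A random Hermitian matrix of size `n` whose `n²` real coordinates are independent and
all distributed as `ξ / √n`, where `ξ` has law `μ`. -/
structure IsWignerMatrix (ρ : Measure Ω) (μ : Measure ℝ) {n : ℕ}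
    (X : Ω → Matrix (Fin n) (Fin n) ℂ) : Prop where
  measurable : ∀ i j, Measurable fun ω => X ω i j
  isHermitian : ∀ ω, (X ω).IsHermitian
  indep : iIndepFun (fun (q : Fin n × Fin n) ω => hermitianCoord (X ω) q) ρ
  law : ∀ q : Fin n × Fin n,
    ρ.map (fun ω => hermitianCoord (X ω) q) = μ.map (fun x : ℝ => x / √(n : ℝ))

/-- `X 0, …, X (r-1)` are independent Wigner matrices of size `n` with distribution `μ`.
Independence is that of the arrays of entries. -/
structure IsWignerFamily (ρ : Measure Ω) (μ : Measure ℝ) {n r : ℕ}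
    (X : Fin r → Ω → Matrix (Fin n) (Fin n) ℂ) : Prop where
  wigner : ∀ p, IsWignerMatrix ρ μ (X p)
  indep : iIndepFun (β := fun _ : Fin r => Fin n → Fin n → ℂ)
    (fun p ω i j => X p ω i j) ρ

/-- Entrywise expectation of a random matrix. -/
def expMatrix (ρ : Measure Ω) {m : ℕ} (Z : Ω → Matrix (Fin m) (Fin m) ℂ) :
    Matrix (Fin m) (Fin m) ℂ :=
  Matrix.of fun i j => ∫ ω, Z ω i j ∂ρ

/-! ### The matrix model

`M_m(ℂ) ⊗ M_n(ℂ)` is the algebra of matrices indexed by `Fin m × Fin n`. -/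

/-- The set `𝒪` of the matrices with positive definite imaginary part `(l - l*) / 2i`. -/
def upperHalfMatrices (m : ℕ) : Set (Matrix (Fin m) (Fin m) ℂ) :=
  {l | ((ℑ l : selfAdjoint (Matrix (Fin m) (Fin m) ℂ)) : Matrix (Fin m) (Fin m) ℂ).PosDef}

/-- `‖(Im l)⁻¹‖`, in the operator norm. -/
def invImNorm {m : ℕ} (l : Matrix (Fin m) (Fin m) ℂ) : ℝ :=
  ‖((ℑ l : selfAdjoint (Matrix (Fin m) (Fin m) ℂ)) : Matrix (Fin m) (Fin m) ℂ)⁻¹‖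

/-- `l ⊗ 1_n - S_n`, where `S_n = a₀ ⊗ 1_n + ∑ p, a p ⊗ Y p`. -/
def matrixPencil {m n r : ℕ} (a₀ : Matrix (Fin m) (Fin m) ℂ)
    (a : Fin r → Matrix (Fin m) (Fin m) ℂ) (Y : Fin r → Matrix (Fin n) (Fin n) ℂ)
    (l : Matrix (Fin m) (Fin m) ℂ) : Matrix (Fin m × Fin n) (Fin m × Fin n) ℂ :=
  l ⊗ₖ (1 : Matrix (Fin n) (Fin n) ℂ) -
    (a₀ ⊗ₖ (1 : Matrix (Fin n) (Fin n) ℂ) + ∑ p, a p ⊗ₖ Y p)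

/-- The block `M_{kl} ∈ M_m(ℂ)` of `M ∈ M_m(ℂ) ⊗ M_n(ℂ)`, so that `(A ⊗ B)_{kl} = B_{kl} A`. -/
def matrixBlock {m n : ℕ} (M : Matrix (Fin m × Fin n) (Fin m × Fin n) ℂ) (k l : Fin n) :
    Matrix (Fin m) (Fin m) ℂ :=
  Matrix.of fun α β => M (α, k) (β, l)

/-- `(1/n) ∑ k, G_{kk} b G_{kk}`, where `G = (l ⊗ 1_n - S_n)⁻¹`. -/
def diagResolventMean {m n r : ℕ} (a₀ : Matrix (Fin m) (Fin m) ℂ)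
    (a : Fin r → Matrix (Fin m) (Fin m) ℂ) (Y : Fin r → Matrix (Fin n) (Fin n) ℂ)
    (b l : Matrix (Fin m) (Fin m) ℂ) : Matrix (Fin m) (Fin m) ℂ :=
  (1 / (n : ℂ)) • ∑ k : Fin n,
    matrixBlock (matrixPencil a₀ a Y l)⁻¹ k k * b * matrixBlock (matrixPencil a₀ a Y l)⁻¹ k k

/-! ### The free limit

`M_m(ℂ) ⊗ ℬ` is the algebra of `m × m` matrices with entries in `ℬ`. -/

variable {B : Type v} [CStarAlgebra B]

/-- A faithful state on a unital C*-algebra. -/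
structure IsFaithfulState (τ : B →ₗ[ℂ] ℂ) : Prop where
  map_one : τ 1 = 1
  nonneg : ∀ b : B, 0 ≤ τ (star b * b)
  faithful : ∀ b : B, τ (star b * b) = 0 → b = 0

/-- Freeness of a family of self-adjoint elements: an alternating product of centred elements
of the algebras they generate is centred. -/
def IsFreeFamily (τ : B →ₗ[ℂ] ℂ) {r : ℕ} (x : Fin r → B) : Prop :=
  ∀ L : List (Fin r × Polynomial ℂ), L ≠ [] →
    L.IsChain (fun q q' => q.1 ≠ q'.1) →
    (∀ q ∈ L, τ (Polynomial.aeval (x q.1) q.2) = 0) →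
    τ (L.map fun q => Polynomial.aeval (x q.1) q.2).prod = 0

/-- `y` has the semicircular distribution of mean `0` and variance `1`, that is the
distribution with density `√(4 - t²) / 2π` on `[-2, 2]`. -/
def IsSemicircular (τ : B →ₗ[ℂ] ℂ) (y : B) : Prop :=
  ∀ k : ℕ, τ (y ^ k) =
    ((∫ t in (-2 : ℝ)..2, t ^ k * (√(4 - t ^ 2) / (2 * Real.pi)) : ℝ) : ℂ)

/-- A semicircular system: free self-adjoint elements, each with the standard semicircular
distribution. -/
structure IsSemicircularSystem (τ : B →ₗ[ℂ] ℂ) {r : ℕ} (x : Fin r → B) : Prop where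
  isSelfAdjoint : ∀ p, IsSelfAdjoint (x p)
  free : IsFreeFamily τ x
  semicircular : ∀ p, IsSemicircular τ (x p)

/-- The elementary tensor `A ⊗ b ∈ M_m(ℂ) ⊗ ℬ`. -/
def matrixTensor {m : ℕ} (A : Matrix (Fin m) (Fin m) ℂ) (b : B) : Matrix (Fin m) (Fin m) B :=
  A.map fun z => z • b

/-- `l ⊗ 1 - s`, where `s = a₀ ⊗ 1 + ∑ p, a p ⊗ x p`. -/
def freePencil {m r : ℕ} (a₀ : Matrix (Fin m) (Fin m) ℂ)
    (a : Fin r → Matrix (Fin m) (Fin m) ℂ) (x : Fin r → B)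
    (l : Matrix (Fin m) (Fin m) ℂ) : Matrix (Fin m) (Fin m) B :=
  matrixTensor l 1 - (matrixTensor a₀ 1 + ∑ p, matrixTensor (a p) (x p))

/-- `G(l) = (id_m ⊗ τ)[(l ⊗ 1 - s)⁻¹]`. -/
def freeStieltjes (τ : B →ₗ[ℂ] ℂ) {m r : ℕ} (a₀ : Matrix (Fin m) (Fin m) ℂ)
    (a : Fin r → Matrix (Fin m) (Fin m) ℂ) (x : Fin r → B)
    (l : Matrix (Fin m) (Fin m) ℂ) : Matrix (Fin m) (Fin m) ℂ :=
  (Ring.inverse (freePencil a₀ a x l)).map τ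

end

/-! For `m > 0`, put `L = λ - a₀` and `c = 1/‖Im(λ)⁻¹‖`, so that `Im L ≥ c`. Subtracting
self-adjoint elements leaves the imaginary part unchanged, so the resolvents of both models exist
and have norm at most `1/c`. In the standardized coordinates `z_i`, independent with law `μ`, the
random resolvent is `R = (L ⊗ 1 - ∑ z_i B_i)⁻¹` with `B_i = a_p ⊗ e_q / √n`. Both models are
governed by the Dyson equation `(L - η(g)) g = 1`, where `η(g) = ∑ a_p g a_p`: exactly for the free
model, up to `O(1/n)` for the random one.

Random side. The Poincaré inequality, tested on a truncated square, gives a finite fourth moment;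
symmetry kills the first and third moments. Expanding `R` in one coordinate then yields `E[z_i R] =
E[R B_i R]` up to `O(‖B_i‖³ c⁻⁴)`. Since `∑ B_i M B_i = η(tr M) ⊗ 1`, with `tr` the normalized
partial trace, the identity `(L ⊗ 1 - ∑ z_i B_i) R = 1` becomes, in expectation and block by block,
`L E[R_kk] - E[η(tr R) R_kk] = 1 + O(1/n)`. The tensorized Poincaré inequality and a dimension-free
bound on the gradient of an entry of `R` show that the blocks have variance `O(1/n)`
(`integral_norm_resolventBlock_sub_sq_le`). Hence expectations of products factor up to `O(1/n)`,
and `norm_dyson_sub_one_le` follows. The same variance bound replaces `E[R_kk b R_kk]` by `E[R_kk] b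
E[R_kk]`.

Free side. The recursion of the semicircle moments is the one-variable Schwinger–Dyson equation, and
freeness extends it to all noncommutative polynomials (`schwingerDyson`). Applied to the powers in
the Neumann series of the resolvent, it gives the Dyson equation far from the spectrum; analytic
continuation in `L + z` brings it to every `L` with `Im L ≥ c` (`IsFaithfulState.dyson`).

Comparison. The Dyson equation has at most one solution with nonpositive imaginary part
(`dyson_unique`). The inverse of `L - η(E[tr R])` solves the equation exactly at a point `L'` within
`O(1/n)` of `L`, so it equals `G(L')`, and `G` is Lipschitz by the resolvent identity
(`IsDysonSolution.norm_sub_le_of_approx`). If `n` is too small for `Im L' ≥ c/2`, the trivial bound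
on the resolvents already suffices. Only the powers 4, 6 and 8 of `1/c` arise, so a polynomial of
degree 10 with equal positive coefficients dominates them. -/

noncomputable section

set_option linter.unusedSectionVars false

/-! ### Elements of a C*-algebra with imaginary part bounded below -/

section Dissipative

variable {A : Type*} [CStarAlgebra A] [PartialOrder A] [StarOrderedRing A]

lemma two_I_smul_imaginaryPart {A : Type*} [AddCommGroup A] [Module ℂ A] [StarAddMonoid A]
    [StarModule ℂ A] (a : A) : (2 * Complex.I) • (ℑ a : A) = a - star a := by
  rw [imaginaryPart_apply_coe, ← Complex.coe_smul, smul_smul, smul_smul]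
  have : (2 * Complex.I) * (-Complex.I * ((2⁻¹ : ℝ) : ℂ)) = 1 := by
    push_cast
    linear_combination (-1 : ℂ) * Complex.I_mul_I
  rw [← mul_assoc] at this
  rw [this, one_smul]

lemma imaginaryPart_eq_of_sub_star {A : Type*} [AddCommGroup A] [Module ℂ A] [StarAddMonoid A]
    [StarModule ℂ A] {a k : A} (h : a - star a = (2 * Complex.I) • k) : (ℑ a : A) = k := by
  rw [← two_I_smul_imaginaryPart] at h
  exact smul_right_injective A (by simp : (2 * Complex.I) ≠ 0) h

lemma imaginaryPart_ringInverse {A : Type*} [Ring A] [Algebra ℂ A] [StarRing A]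
    [StarModule ℂ A] {a : A} (ha : IsUnit a) :
    (ℑ (Ring.inverse a) : A) = -(star (Ring.inverse a) * (ℑ a : A) * Ring.inverse a) := by
  apply imaginaryPart_eq_of_sub_star
  have h1 : a * Ring.inverse a = 1 := Ring.mul_inverse_cancel _ ha
  have h2 : star (Ring.inverse a) * star a = 1 := by rw [← star_mul, h1, star_one]
  rw [smul_neg, ← smul_mul_assoc, ← mul_smul_comm, two_I_smul_imaginaryPart, mul_sub, sub_mul, h2,
    mul_assoc, h1]
  simp

lemma imaginaryPart_ringInverse' {A : Type*} [Ring A] [Algebra ℂ A] [StarRing A]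
    [StarModule ℂ A] {a : A} (ha : IsUnit a) :
    (ℑ (Ring.inverse a) : A) = -(Ring.inverse a * (ℑ a : A) * star (Ring.inverse a)) := by
  apply imaginaryPart_eq_of_sub_star
  have h1 : Ring.inverse a * a = 1 := Ring.inverse_mul_cancel _ ha
  have h2 : star a * star (Ring.inverse a) = 1 := by rw [← star_mul, h1, star_one]
  rw [smul_neg, ← smul_mul_assoc, ← mul_smul_comm, two_I_smul_imaginaryPart, mul_sub, sub_mul, h1,
    mul_assoc, h2]
  simp

/-- Conjugating `c ≤ ℑ a` by the inverse `w` gives `c w*w ≤ -ℑ w`. Taking norms, `c ‖w‖² ≤ ‖w‖`. -/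
lemma norm_ringInverse_le_of_isUnit {a : A} {c : ℝ} (hc : 0 < c) (hu : IsUnit a)
    (h : algebraMap ℝ A c ≤ (ℑ a : A)) : ‖Ring.inverse a‖ ≤ c⁻¹ := by
  set w := Ring.inverse a
  have h1 : star w * algebraMap ℝ A c * w ≤ -(ℑ w : A) := by
    rw [imaginaryPart_ringInverse hu, neg_neg]
    exact star_left_conjugate_le_conjugate h w
  have h2 : star w * algebraMap ℝ A c * w = c • (star w * w) := by
    rw [Algebra.algebraMap_eq_smul_one]; simp
  rw [h2] at h1
  have h3 := CStarAlgebra.norm_le_norm_of_nonneg_of_le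
    (smul_nonneg hc.le (star_mul_self_nonneg w)) h1
  rw [norm_smul, CStarRing.norm_star_mul_self, norm_neg, Real.norm_of_nonneg hc.le] at h3
  have h4 := h3.trans (imaginaryPart.norm_le w)
  by_cases hw : ‖w‖ = 0
  · rw [hw]; positivity
  · have : 0 < ‖w‖ := lt_of_le_of_ne (norm_nonneg _) (Ne.symm hw)
    rw [← mul_assoc] at h4
    rw [le_inv_comm₀ this hc, ← one_div, le_div_iff₀ this]
    by_contra hcon
    push Not at hcon
    nlinarith

/-- Perturbation from a constant imaginary part: with `t = max ‖ℑ a‖ c`, the element `u = ℜ a + it`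
is invertible because the spectrum of `ℜ a` is real, and `‖u⁻¹‖ ≤ 1/t`. Since `c ≤ ℑ a ≤ t`, the
difference has norm at most `t - c < t`, and a Neumann series applies. -/
lemma isUnit_of_le_imaginaryPart {a : A} {c : ℝ} (hc : 0 < c)
    (h : algebraMap ℝ A c ≤ (ℑ a : A)) : IsUnit a := by
  rcases subsingleton_or_nontrivial A with hA | hA
  · exact isUnit_of_subsingleton a
  set k : A := (ℑ a : A) with hk
  set t : ℝ := max ‖k‖ c
  have ht : 0 < t := lt_of_lt_of_le hc (le_max_right _ _)
  have hks : IsSelfAdjoint k := (ℑ a).2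
  have hkt : k ≤ algebraMap ℝ A t :=
    hks.le_algebraMap_norm_self.trans (algebraMap_mono A (le_max_left _ _))
  have hn : ‖algebraMap ℝ A t - k‖ ≤ t - c := by
    have h1 : algebraMap ℝ A t - k ≤ algebraMap ℝ A (t - c) := by
      rw [map_sub]; exact sub_le_sub_left h _
    refine (CStarAlgebra.norm_le_norm_of_nonneg_of_le (sub_nonneg.2 hkt) h1).trans ?_
    rw [norm_algebraMap']
    exact (Real.norm_of_nonneg (sub_nonneg.2 (le_max_right _ _))).le
  set u : A := (ℜ a : A) + Complex.I • algebraMap ℝ A t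
  have hsa : IsSelfAdjoint (ℜ a : A) := (ℜ a).2
  have hu : IsUnit u := by
    have h1 : (-(Complex.I * t)) ∉ spectrum ℂ (ℜ a : A) := by
      intro hmem
      have := hsa.im_eq_zero_of_mem_spectrum hmem
      simp at this
      exact ht.ne' this
    rw [spectrum.notMem_iff] at h1
    have h2 : u = -(algebraMap ℂ A (-(Complex.I * t)) - (ℜ a : A)) := by
      simp only [u, map_neg, map_mul, Algebra.algebraMap_eq_smul_one]
      simp only [neg_sub, sub_neg_eq_add, smul_mul_smul, mul_one]
      rw [← Complex.coe_smul t, smul_smul]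
    rw [h2]
    exact h1.neg
  have him : (ℑ u : A) = algebraMap ℝ A t := by
    apply imaginaryPart_eq_of_sub_star
    simp only [u, star_add, star_smul, hsa.star_eq]
    rw [(IsSelfAdjoint.algebraMap A (IsSelfAdjoint.all t)).star_eq]
    simp only [Complex.star_def, Complex.conj_I, neg_smul, two_mul, add_smul]
    abel
  have hnorm : ‖Ring.inverse u‖ ≤ t⁻¹ := norm_ringInverse_le_of_isUnit ht hu him.ge
  have hdec : a = u * (1 - Ring.inverse u * (Complex.I • (algebraMap ℝ A t - k))) := by
    rw [mul_sub, ← mul_assoc, Ring.mul_inverse_cancel _ hu, one_mul, mul_one]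
    simp only [u, smul_sub]
    conv_lhs => rw [← realPart_add_I_smul_imaginaryPart a]
    rw [hk]; abel
  rw [hdec]
  refine hu.mul (isUnit_one_sub_of_norm_lt_one ?_)
  calc _ ≤ ‖Ring.inverse u‖ * ‖Complex.I • (algebraMap ℝ A t - k)‖ := norm_mul_le _ _
    _ ≤ t⁻¹ * (t - c) := by
        rw [norm_smul, Complex.norm_I, one_mul]; gcongr
    _ < 1 := by
        rw [inv_mul_lt_iff₀ ht]; linarith

lemma norm_ringInverse_le {a : A} {c : ℝ} (hc : 0 < c)
    (h : algebraMap ℝ A c ≤ (ℑ a : A)) : ‖Ring.inverse a‖ ≤ c⁻¹ :=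
  norm_ringInverse_le_of_isUnit hc (isUnit_of_le_imaginaryPart hc h) h

lemma imaginaryPart_ringInverse_nonpos {a : A} (hu : IsUnit a) (h : 0 ≤ (ℑ a : A)) :
    (ℑ (Ring.inverse a) : A) ≤ 0 := by
  rw [imaginaryPart_ringInverse hu, neg_nonpos]
  exact star_left_conjugate_nonneg h _

/-- Inversion reverses the order on strictly positive elements, so `k⁻¹ ≤ ‖k⁻¹‖` turns into the
required lower bound. This turns the quantity `‖Im(λ)⁻¹‖` of the theorem into a scalar minorant of
`Im λ`. -/
lemma algebraMap_inv_norm_le {k : A} (hk : IsStrictlyPositive k)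
    (hpos : 0 < ‖Ring.inverse k‖) : algebraMap ℝ A ‖Ring.inverse k‖⁻¹ ≤ k := by
  have h1 : IsStrictlyPositive (Ring.inverse k) := hk.ringInverse
  have h2 : Ring.inverse k ≤ algebraMap ℝ A ‖Ring.inverse k‖ :=
    h1.isSelfAdjoint.le_algebraMap_norm_self
  have h3 := CStarAlgebra.ringInverse_le_ringInverse h2 h1
  rw [Ring.inverse_inverse hk.isUnit] at h3
  convert h3 using 1
  have h4 : IsUnit (algebraMap ℝ A ‖Ring.inverse k‖) := (isUnit_iff_ne_zero.2 hpos.ne').map _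
  have h5 : algebraMap ℝ A ‖Ring.inverse k‖⁻¹ = 1 * Ring.inverse (algebraMap ℝ A ‖Ring.inverse k‖) := by
    rw [Ring.eq_mul_inverse_iff_mul_eq _ _ _ h4, ← map_mul, inv_mul_cancel₀ hpos.ne', map_one]
  rw [h5, one_mul]

end Dissipative

/-! ### The matrix Dyson equation: uniqueness of the dissipative solution -/

section MatrixDyson

open scoped MatrixOrder

variable {m r : ℕ}

/-- The completely positive map `g ↦ ∑ p, a p * g * a p`. -/
def covarianceMap (a : Fin r → Matrix (Fin m) (Fin m) ℂ) :
    Matrix (Fin m) (Fin m) ℂ →ₗ[ℂ] Matrix (Fin m) (Fin m) ℂ where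
  toFun g := ∑ p, a p * g * a p
  map_add' g h := by simp [mul_add, add_mul, Finset.sum_add_distrib]
  map_smul' z g := by simp [Finset.smul_sum]

lemma covarianceMap_apply (a : Fin r → Matrix (Fin m) (Fin m) ℂ) (g : Matrix (Fin m) (Fin m) ℂ) :
    covarianceMap a g = ∑ p, a p * g * a p := rfl

lemma star_covarianceMap {a : Fin r → Matrix (Fin m) (Fin m) ℂ} (ha : ∀ p, (a p).IsHermitian)
    (g : Matrix (Fin m) (Fin m) ℂ) : star (covarianceMap a g) = covarianceMap a (star g) := by
  simp only [covarianceMap_apply, star_sum, star_mul, mul_assoc]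
  refine Finset.sum_congr rfl fun p _ => ?_
  rw [Matrix.star_eq_conjTranspose (a p), (ha p).eq]

lemma imaginaryPart_covarianceMap {a : Fin r → Matrix (Fin m) (Fin m) ℂ}
    (ha : ∀ p, (a p).IsHermitian) (g : Matrix (Fin m) (Fin m) ℂ) :
    (ℑ (covarianceMap a g) : Matrix (Fin m) (Fin m) ℂ) =
      covarianceMap a (ℑ g : Matrix (Fin m) (Fin m) ℂ) := by
  apply imaginaryPart_eq_of_sub_star
  rw [star_covarianceMap ha, ← map_sub, ← two_I_smul_imaginaryPart, map_smul]

lemma covarianceMap_nonneg {a : Fin r → Matrix (Fin m) (Fin m) ℂ}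
    (ha : ∀ p, (a p).IsHermitian) {g : Matrix (Fin m) (Fin m) ℂ} (hg : 0 ≤ g) :
    0 ≤ covarianceMap a g := by
  rw [covarianceMap_apply]
  refine Finset.sum_nonneg fun p _ => ?_
  have h : star (a p) = a p := (ha p).eq
  have := star_left_conjugate_nonneg hg (a p)
  rwa [h] at this

lemma norm_covarianceMap_le (a : Fin r → Matrix (Fin m) (Fin m) ℂ)
    (g : Matrix (Fin m) (Fin m) ℂ) : ‖covarianceMap a g‖ ≤ (∑ p, ‖a p‖ ^ 2) * ‖g‖ := by
  rw [covarianceMap_apply, Finset.sum_mul]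
  refine (norm_sum_le _ _).trans (Finset.sum_le_sum fun p _ => ?_)
  calc ‖a p * g * a p‖ ≤ ‖a p‖ * ‖g‖ * ‖a p‖ := norm_mul₃_le
    _ = _ := by ring

/-- The real quadratic form of a complex matrix. -/
def quadForm (M : Matrix (Fin m) (Fin m) ℂ) (u : Fin m → ℂ) : ℝ := (star u ⬝ᵥ M *ᵥ u).re

lemma quadForm_add (M N : Matrix (Fin m) (Fin m) ℂ) (u : Fin m → ℂ) :
    quadForm (M + N) u = quadForm M u + quadForm N u := by
  simp [quadForm, Matrix.add_mulVec]

lemma quadForm_sum {ι : Type*} (s : Finset ι) (M : ι → Matrix (Fin m) (Fin m) ℂ)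
    (u : Fin m → ℂ) : quadForm (∑ i ∈ s, M i) u = ∑ i ∈ s, quadForm (M i) u := by
  simp [quadForm, Matrix.sum_mulVec, dotProduct_sum]

lemma quadForm_mono {M N : Matrix (Fin m) (Fin m) ℂ} (h : M ≤ N) (u : Fin m → ℂ) :
    quadForm M u ≤ quadForm N u := by
  have := (Complex.le_def.1 ((Matrix.le_iff.1 h).dotProduct_mulVec_nonneg u)).1
  simp only [Matrix.sub_mulVec, dotProduct_sub, Complex.sub_re, Complex.zero_re] at this
  simp only [quadForm]; linarith

lemma quadForm_conj (g M : Matrix (Fin m) (Fin m) ℂ) (u : Fin m → ℂ) :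
    quadForm (star g * M * g) u = quadForm M (g *ᵥ u) := by
  simp only [quadForm, Matrix.star_eq_conjTranspose, ← Matrix.mulVec_mulVec, Matrix.star_mulVec,
    Matrix.dotProduct_mulVec, Matrix.vecMul_vecMul]

lemma quadForm_smul_one (c : ℝ) (u : Fin m → ℂ) :
    quadForm (algebraMap ℝ _ c) u = c * ∑ i, ‖u i‖ ^ 2 := by
  have : (algebraMap ℝ (Matrix (Fin m) (Fin m) ℂ) c) *ᵥ u = (c : ℂ) • u := by
    rw [Algebra.algebraMap_eq_smul_one, Matrix.smul_mulVec, Matrix.one_mulVec]; rfl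
  rw [quadForm, this, dotProduct_smul, dotProduct]
  simp only [Pi.star_apply, Complex.star_def, ← Complex.normSq_eq_conj_mul_self]
  simp [Complex.normSq_eq_norm_sq]
  left; norm_cast

lemma exists_algebraMap_le {k : Matrix (Fin m) (Fin m) ℂ} (hk : k.PosDef) :
    ∃ c : ℝ, 0 < c ∧ algebraMap ℝ _ c ≤ k := by
  rcases subsingleton_or_nontrivial (Matrix (Fin m) (Fin m) ℂ) with h | h
  · exact ⟨1, one_pos, (Subsingleton.elim _ _).le⟩
  · have hk' := Matrix.isStrictlyPositive_iff_posDef.2 hk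
    have hpos : 0 < ‖Ring.inverse k‖ := norm_pos_iff.2 hk'.isUnit.ringInverse.ne_zero
    exact ⟨_, inv_pos.2 hpos, algebraMap_inv_norm_le hk' hpos⟩

lemma norm_star_dotProduct_mulVec_le (D : Matrix (Fin m) (Fin m) ℂ) (u w : Fin m → ℂ) :
    ‖star u ⬝ᵥ D *ᵥ w‖ ≤ ‖D‖ * (∑ i, ‖u i‖ ^ 2 + ∑ i, ‖w i‖ ^ 2) := by
  have h1 : star u ⬝ᵥ D *ᵥ w = inner ℂ (WithLp.toLp 2 u) (WithLp.toLp 2 (D *ᵥ w)) := by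
    rw [EuclideanSpace.inner_eq_star_dotProduct]
    simp [dotProduct_comm]
  rw [h1]
  have h2 := Matrix.l2_opNorm_mulVec D (WithLp.toLp 2 w)
  have h3 := norm_inner_le_norm (𝕜 := ℂ) (WithLp.toLp 2 u) (WithLp.toLp 2 (D *ᵥ w))
  have h4 : ∀ v : Fin m → ℂ, ∑ i, ‖v i‖ ^ 2 = ‖WithLp.toLp 2 v‖ ^ 2 := fun v => by
    rw [EuclideanSpace.norm_sq_eq]
  rw [h4, h4]
  refine h3.trans ?_
  calc _ ≤ ‖WithLp.toLp 2 u‖ * (‖D‖ * ‖WithLp.toLp 2 w‖) := by gcongr; exact h2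
    _ = ‖D‖ * (‖WithLp.toLp 2 u‖ * ‖WithLp.toLp 2 w‖) := by ring
    _ ≤ _ := by
        gcongr
        nlinarith [sq_nonneg (‖WithLp.toLp 2 u‖ - ‖WithLp.toLp 2 w‖),
          sq_nonneg (‖WithLp.toLp 2 u‖), sq_nonneg (‖WithLp.toLp 2 w‖)]

/-- A solution of the Dyson equation with nonpositive imaginary part: its imaginary part is
controlled by the covariance map. -/
lemma dyson_imaginaryPart {a : Fin r → Matrix (Fin m) (Fin m) ℂ} (ha : ∀ p, (a p).IsHermitian)
    {L g : Matrix (Fin m) (Fin m) ℂ} (hg : (L - covarianceMap a g) * g = 1) :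
    let v := -(ℑ g : Matrix (Fin m) (Fin m) ℂ)
    v = star g * ((ℑ L : Matrix (Fin m) (Fin m) ℂ) + covarianceMap a v) * g ∧
    v = g * ((ℑ L : Matrix (Fin m) (Fin m) ℂ) + covarianceMap a v) * star g := by
  intro v
  have hg' := mul_eq_one_comm.1 hg
  have hu : IsUnit (L - covarianceMap a g) := ⟨⟨_, g, hg, hg'⟩, rfl⟩
  have hinv : Ring.inverse (L - covarianceMap a g) = g := by
    have h := Ring.inverse_unit ⟨L - covarianceMap a g, g, hg, hg'⟩
    simpa using h
  have him : (ℑ (L - covarianceMap a g) : Matrix (Fin m) (Fin m) ℂ) =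
      (ℑ L : Matrix (Fin m) (Fin m) ℂ) + covarianceMap a v := by
    rw [map_sub, AddSubgroupClass.coe_sub, imaginaryPart_covarianceMap ha, map_neg, sub_eq_add_neg]
  constructor
  · have := imaginaryPart_ringInverse hu
    rw [hinv, him] at this
    rw [← neg_eq_iff_eq_neg] at this
    exact this
  · have := imaginaryPart_ringInverse' hu
    rw [hinv, him] at this
    rw [← neg_eq_iff_eq_neg] at this
    exact this

/-- The identity for `v` gives `v ≥ g* k g`, which is positive definite because `g` is invertible.
The second conclusion says that the loss `k(g u)` is a fixed proportion of `v(u)`; it is the strict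
contraction rate in the uniqueness proof. -/
lemma posDef_of_dyson {a : Fin r → Matrix (Fin m) (Fin m) ℂ} (ha : ∀ p, (a p).IsHermitian)
    {k v h g : Matrix (Fin m) (Fin m) ℂ} (hk : k.PosDef) (hv : 0 ≤ v) (hhg : h * g = 1)
    (hv' : v = star g * (k + covarianceMap a v) * g) :
    ∃ δ ε : ℝ, 0 < δ ∧ 0 < ε ∧ ε ≤ 1 ∧ algebraMap ℝ _ δ ≤ v ∧
      ∀ u, ε * quadForm v u ≤ quadForm k (g *ᵥ u) := by
  have hu : IsUnit g := ⟨⟨g, h, mul_eq_one_comm.1 hhg, hhg⟩, rfl⟩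
  have hP : (star g * k * g).PosDef := (Matrix.IsUnit.posDef_star_left_conjugate_iff hu).2 hk
  obtain ⟨δ, hδ, hle⟩ := exists_algebraMap_le hP
  have hPv : star g * k * g ≤ v := by
    rw [hv', mul_add, add_mul]
    exact le_add_of_nonneg_right (star_left_conjugate_nonneg (covarianceMap_nonneg ha hv) g)
  -- `k(g u) ≥ δ |u|²` while `v(u) ≤ ‖v‖ |u|²`. The `+ 1` avoids dividing by zero and the minimum
  -- with 1 keeps the rate `1 - ε` nonnegative.
  refine ⟨δ, min 1 (δ / (‖v‖ + 1)), hδ, by positivity, min_le_left _ _, hle.trans hPv,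
    fun u => ?_⟩
  have h1 := quadForm_mono hle u
  have h2 := quadForm_mono (IsSelfAdjoint.of_nonneg hv).le_algebraMap_norm_self u
  have h3 := quadForm_mono hv u
  rw [quadForm_smul_one, quadForm_conj] at h1
  rw [quadForm_smul_one] at h2
  have h0 : (0 : ℝ) ≤ ∑ i, ‖u i‖ ^ 2 := by positivity
  simp only [quadForm, Matrix.zero_mulVec, dotProduct_zero, Complex.zero_re] at h3
  calc min 1 (δ / (‖v‖ + 1)) * quadForm v u ≤ δ / (‖v‖ + 1) * (‖v‖ * ∑ i, ‖u i‖ ^ 2) := by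
        gcongr
        exact min_le_right _ _
    _ = δ * (∑ i, ‖u i‖ ^ 2) * (‖v‖ / (‖v‖ + 1)) := by ring
    _ ≤ δ * (∑ i, ‖u i‖ ^ 2) * 1 := by
        gcongr
        rw [div_le_one (by positivity)]; linarith
    _ ≤ _ := by rw [mul_one]; exact h1

/-- The difference `D` satisfies `D = g₁ η(D) g₂`. The forms `v₁, v₂` given by the negated imaginary
parts are adapted to this map: `v = g*(k + η(v))g` says that `∑ v(a_p g u) = v(u) - k(g u)`, which
is at most `(1 - ε) v(u)`. Thus a bound `|u* D w| ≤ t (v₁(u) + v₂(w))` improves itself by the factor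
`1 - ε`, and iteration forces `D = 0`. -/
theorem dyson_unique {a : Fin r → Matrix (Fin m) (Fin m) ℂ} (ha : ∀ p, (a p).IsHermitian)
    {L g₁ g₂ : Matrix (Fin m) (Fin m) ℂ} (hL : (ℑ L : Matrix (Fin m) (Fin m) ℂ).PosDef)
    (h₁ : (L - covarianceMap a g₁) * g₁ = 1) (h₂ : (L - covarianceMap a g₂) * g₂ = 1)
    (hi₁ : (ℑ g₁ : Matrix (Fin m) (Fin m) ℂ) ≤ 0) (hi₂ : (ℑ g₂ : Matrix (Fin m) (Fin m) ℂ) ≤ 0) :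
    g₁ = g₂ := by
  set k : Matrix (Fin m) (Fin m) ℂ := (ℑ L : Matrix (Fin m) (Fin m) ℂ) with hk
  obtain ⟨-, e1⟩ := dyson_imaginaryPart ha h₁
  obtain ⟨e2, -⟩ := dyson_imaginaryPart ha h₂
  set v₁ : Matrix (Fin m) (Fin m) ℂ := -(ℑ g₁ : Matrix (Fin m) (Fin m) ℂ) with hv1
  set v₂ : Matrix (Fin m) (Fin m) ℂ := -(ℑ g₂ : Matrix (Fin m) (Fin m) ℂ) with hv2
  have n1 : 0 ≤ v₁ := neg_nonneg.2 hi₁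
  have n2 : 0 ≤ v₂ := neg_nonneg.2 hi₂
  -- `g₁` stands on the left of `η(D)`, so its adjoint acts on `u`; the identity for `v₁` is
  -- therefore needed with `star g₁` in the role of `g`.
  have e1' : v₁ = star (star g₁) * (k + covarianceMap a v₁) * star g₁ := by rwa [star_star]
  have h₁' : star (L - covarianceMap a g₁) * star g₁ = 1 := by
    rw [← star_mul, mul_eq_one_comm.1 h₁, star_one]
  obtain ⟨δ₁, ε₁, hδ₁, hε₁, hε₁', hd1, hq1⟩ := posDef_of_dyson ha hL n1 h₁' e1'
  obtain ⟨δ₂, ε₂, hδ₂, hε₂, hε₂', hd2, hq2⟩ := posDef_of_dyson ha hL n2 h₂ e2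
  set D := g₁ - g₂ with hD
  have hDeq : D = g₁ * covarianceMap a D * g₂ := by
    have : covarianceMap a D = (L - covarianceMap a g₂) - (L - covarianceMap a g₁) := by
      rw [hD, map_sub]; abel
    rw [this, mul_sub, sub_mul, mul_assoc, h₂, mul_eq_one_comm.1 h₁]; simp [hD]
  have key : ∀ (h v : Matrix (Fin m) (Fin m) ℂ) (ε : ℝ),
      v = star h * (k + covarianceMap a v) * h →
      (∀ u, ε * quadForm v u ≤ quadForm k (h *ᵥ u)) → ∀ u,
      ∑ p, quadForm v (a p *ᵥ (h *ᵥ u)) ≤ (1 - ε) * quadForm v u := by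
    intro h v ε hv hq u
    have : quadForm v u = quadForm k (h *ᵥ u) + ∑ p, quadForm v (a p *ᵥ (h *ᵥ u)) := by
      conv_lhs => rw [hv]
      rw [quadForm_conj, quadForm_add, covarianceMap_apply, quadForm_sum]
      congr 1
      refine Finset.sum_congr rfl fun p _ => ?_
      rw [← quadForm_conj (a p), Matrix.star_eq_conjTranspose, (ha p).eq]
    have := hq u
    linarith
  set ε := min ε₁ ε₂
  have hε : 0 < ε := lt_min hε₁ hε₂
  have p1 : ∀ u, 0 ≤ quadForm v₁ u := fun u => by
    have := quadForm_mono n1 u; simpa [quadForm] using this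
  have p2 : ∀ u, 0 ≤ quadForm v₂ u := fun u => by
    have := quadForm_mono n2 u; simpa [quadForm] using this
  have step : ∀ t : ℝ, 0 ≤ t →
      (∀ u w, ‖star u ⬝ᵥ D *ᵥ w‖ ≤ t * (quadForm v₁ u + quadForm v₂ w)) →
      ∀ u w, ‖star u ⬝ᵥ D *ᵥ w‖ ≤ (t * (1 - ε)) * (quadForm v₁ u + quadForm v₂ w) := by
    intro t ht hyp u w
    have hsum : star u ⬝ᵥ D *ᵥ w =
        ∑ p, star (a p *ᵥ (star g₁ *ᵥ u)) ⬝ᵥ D *ᵥ (a p *ᵥ (g₂ *ᵥ w)) := by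
      conv_lhs => rw [hDeq]
      rw [covarianceMap_apply, Finset.mul_sum, Finset.sum_mul, Matrix.sum_mulVec, dotProduct_sum]
      refine Finset.sum_congr rfl fun p _ => ?_
      simp only [Matrix.star_mulVec, Matrix.dotProduct_mulVec, Matrix.vecMul_vecMul,
        Matrix.mulVec_mulVec, Matrix.star_eq_conjTranspose, Matrix.conjTranspose_mul, (ha p).eq,
        Matrix.conjTranspose_conjTranspose, mul_assoc]
    rw [hsum]
    refine (norm_sum_le _ _).trans ?_
    calc _ ≤ ∑ p, t * (quadForm v₁ (a p *ᵥ (star g₁ *ᵥ u)) + quadForm v₂ (a p *ᵥ (g₂ *ᵥ w))) :=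
          Finset.sum_le_sum fun p _ => hyp _ _
      _ = t * (∑ p, quadForm v₁ (a p *ᵥ (star g₁ *ᵥ u)) +
            ∑ p, quadForm v₂ (a p *ᵥ (g₂ *ᵥ w))) := by
          rw [← Finset.mul_sum, Finset.sum_add_distrib]
      _ ≤ t * ((1 - ε) * quadForm v₁ u + (1 - ε) * quadForm v₂ w) := by
          gcongr
          · refine (key _ _ _ e1' hq1 u).trans ?_
            gcongr
            · exact p1 u
            · exact min_le_left _ _
          · refine (key _ _ _ e2 hq2 w).trans ?_
            gcongr
            · exact p2 w
            · exact min_le_right _ _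
      _ = _ := by ring
  set δ := min δ₁ δ₂
  have hδ : 0 < δ := lt_min hδ₁ hδ₂
  have init : ∀ u w, ‖star u ⬝ᵥ D *ᵥ w‖ ≤ (‖D‖ / δ) * (quadForm v₁ u + quadForm v₂ w) := by
    intro u w
    refine (norm_star_dotProduct_mulVec_le D u w).trans ?_
    have q1 := quadForm_mono hd1 u
    have q2 := quadForm_mono hd2 w
    rw [quadForm_smul_one] at q1 q2
    rw [div_mul_eq_mul_div, mul_div_assoc]
    gcongr
    rw [le_div_iff₀ hδ, add_mul]
    refine add_le_add (le_trans ?_ q1) (le_trans ?_ q2)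
    · rw [mul_comm]; gcongr; exact min_le_left _ _
    · rw [mul_comm]; gcongr; exact min_le_right _ _
  have hε1 : 0 ≤ 1 - ε := sub_nonneg.2 ((min_le_left _ _).trans hε₁')
  have iter : ∀ n : ℕ, ∀ u w, ‖star u ⬝ᵥ D *ᵥ w‖ ≤
      (‖D‖ / δ * (1 - ε) ^ n) * (quadForm v₁ u + quadForm v₂ w) := by
    intro n
    induction n with
    | zero => simpa using init
    | succ n ih =>
      intro u w
      have := step _ (by positivity) ih u w
      rwa [pow_succ, ← mul_assoc]
  have hzero : ∀ u w, star u ⬝ᵥ D *ᵥ w = 0 := by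
    intro u w
    have hlim : Filter.Tendsto (fun n : ℕ => (‖D‖ / δ * (1 - ε) ^ n) *
        (quadForm v₁ u + quadForm v₂ w)) Filter.atTop (nhds 0) := by
      have := (tendsto_pow_atTop_nhds_zero_of_lt_one hε1 (by linarith)).const_mul (‖D‖ / δ)
      simpa using this.mul_const (quadForm v₁ u + quadForm v₂ w)
    exact norm_le_zero_iff.1 (ge_of_tendsto' hlim fun n => iter n u w)
  have : D = 0 := by
    ext i j
    have := hzero (Pi.single i 1) (Pi.single j 1)
    simpa [← Pi.single_star] using this
  exact sub_eq_zero.1 this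

end MatrixDyson

/-! ### Efron–Stein inequality on product spaces -/

section EfronStein

variable {ι α : Type*} [Fintype ι] [DecidableEq ι] [MeasurableSpace α]

lemma measurable_update_uncurry (i : ι) :
    Measurable fun p : (ι → α) × α => Function.update p.1 i p.2 := by
  refine measurable_pi_lambda _ fun j => ?_
  by_cases h : j = i
  · subst h; simpa using measurable_snd
  · simp only [Function.update_of_ne h]
    exact (measurable_pi_apply j).comp measurable_fst

/-- Replacing one coordinate by an independent copy does not change a product law; it is enough to
compare boxes. -/
lemma measurePreserving_update (μ : Measure α) [IsProbabilityMeasure μ] (i : ι) :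
    MeasurePreserving (fun p : (ι → α) × α => Function.update p.1 i p.2)
      ((Measure.pi fun _ : ι => μ).prod μ) (Measure.pi fun _ : ι => μ) := by
  refine ⟨measurable_update_uncurry i, (Measure.pi_eq fun s hs => ?_).symm⟩
  rw [Measure.map_apply (measurable_update_uncurry i) (MeasurableSet.univ_pi hs)]
  have : (fun p : (ι → α) × α => Function.update p.1 i p.2) ⁻¹' Set.univ.pi s =
      (Set.univ.pi (Function.update s i Set.univ)) ×ˢ s i := by
    ext ⟨z, t⟩
    simp only [Set.mem_preimage, Set.mem_pi, Set.mem_univ, true_implies, Set.mem_prod]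
    constructor
    · intro h
      refine ⟨fun j => ?_, by simpa using h i⟩
      by_cases hj : j = i
      · subst hj; simp
      · simpa [Function.update_of_ne hj] using h j
    · rintro ⟨h1, h2⟩ j
      by_cases hj : j = i
      · subst hj; simpa using h2
      · simpa [Function.update_of_ne hj] using h1 j
  rw [this, Measure.prod_prod, Measure.pi_pi, ← Finset.mul_prod_erase _ _ (Finset.mem_univ i),
    ← Finset.mul_prod_erase Finset.univ (fun j => μ (s j)) (Finset.mem_univ i)]
  simp only [Function.update_self, measure_univ, one_mul]
  rw [mul_comm]
  congr 1
  refine Finset.prod_congr rfl fun j hj => ?_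
  rw [Function.update_of_ne (Finset.ne_of_mem_erase hj)]

variable {E : Type*} [NormedAddCommGroup E] [NormedSpace ℝ E]

/-- Average of `f` over the `i`-th coordinate. -/
def coordAverage (μ : Measure α) (i : ι) (f : (ι → α) → E) (z : ι → α) : E :=
  ∫ t, f (Function.update z i t) ∂μ

lemma integrable_of_bounded {β : Type*} [MeasurableSpace β] {ν : Measure β} [IsFiniteMeasure ν]
    {f : β → E} (hf : StronglyMeasurable f) {c : ℝ} (hc : ∀ z, ‖f z‖ ≤ c) : Integrable f ν :=
  Integrable.of_bound hf.aestronglyMeasurable c (Filter.Eventually.of_forall hc)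

lemma stronglyMeasurable_update {f : (ι → α) → E} (hf : StronglyMeasurable f) (i : ι) :
    StronglyMeasurable fun p : (ι → α) × α => f (Function.update p.1 i p.2) :=
  hf.comp_measurable (measurable_update_uncurry i)

lemma stronglyMeasurable_coordAverage (μ : Measure α) [SFinite μ] {f : (ι → α) → E}
    (hf : StronglyMeasurable f) (i : ι) : StronglyMeasurable (coordAverage μ i f) :=
  (stronglyMeasurable_update hf i).integral_prod_right

variable (μ : Measure α) [IsProbabilityMeasure μ]

lemma norm_coordAverage_le {f : (ι → α) → E} {c : ℝ} (hc : ∀ z, ‖f z‖ ≤ c) (i : ι) (z : ι → α) :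
    ‖coordAverage μ i f z‖ ≤ c := by
  have := norm_integral_le_of_norm_le_const (μ := μ) (f := fun t => f (Function.update z i t))
    (Filter.Eventually.of_forall fun t => hc _)
  simpa [coordAverage] using this

lemma coordAverage_update (f : (ι → α) → E) (i : ι) (z : ι → α) (t : α) :
    coordAverage μ i f (Function.update z i t) = coordAverage μ i f z := by
  simp [coordAverage]

lemma coordAverage_update_of_update {f : (ι → α) → E} {j : ι}
    (h : ∀ z t, f (Function.update z j t) = f z) (i : ι) (z : ι → α) (t : α) :
    coordAverage μ i f (Function.update z j t) = coordAverage μ i f z := by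
  by_cases hij : i = j
  · subst hij; exact coordAverage_update μ f i z t
  · simp only [coordAverage]
    refine integral_congr_ae (Filter.Eventually.of_forall fun s => ?_)
    simp only
    rw [Function.update_comm (Ne.symm hij), h]

lemma integral_pi_eq_integral_update {f : (ι → α) → E}
    (hf : Integrable f (Measure.pi fun _ => μ)) (i : ι) :
    ∫ z, f z ∂(Measure.pi fun _ => μ) =
      ∫ z, ∫ t, f (Function.update z i t) ∂μ ∂(Measure.pi fun _ => μ) := by
  have hp := measurePreserving_update μ (ι := ι) i
  have hi : Integrable (fun p : (ι → α) × α => f (Function.update p.1 i p.2))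
      ((Measure.pi fun _ : ι => μ).prod μ) := hp.integrable_comp_of_integrable hf
  rw [← integral_prod _ hi]
  conv_lhs => rw [← hp.map_eq]
  refine integral_map hp.measurable.aemeasurable ?_
  rw [hp.map_eq]
  exact hf.aestronglyMeasurable

variable {E : Type*} [NormedAddCommGroup E] [InnerProductSpace ℝ E] [CompleteSpace E]

/-- With the other coordinates frozen, `g` is constant and `f` minus its average integrates to zero.
This orthogonality is what makes the variances add up. -/
lemma integral_inner_sub_coordAverage {f g : (ι → α) → E} (hf : StronglyMeasurable f)
    (hg : StronglyMeasurable g) {c d : ℝ} (hc : ∀ z, ‖f z‖ ≤ c) (hd : ∀ z, ‖g z‖ ≤ d) (i : ι)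
    (hgi : ∀ z t, g (Function.update z i t) = g z) :
    ∫ z, inner ℝ (g z) (f z - coordAverage μ i f z) ∂(Measure.pi fun _ => μ) = 0 := by
  have hA := stronglyMeasurable_coordAverage μ hf i
  rw [integral_pi_eq_integral_update μ (i := i)]
  · refine integral_eq_zero_of_ae (Filter.Eventually.of_forall fun z => ?_)
    simp only [hgi, coordAverage_update, Pi.zero_apply]
    have hint : Integrable (fun t => f (Function.update z i t)) μ :=
      integrable_of_bounded ((stronglyMeasurable_update hf i).comp_measurable
        measurable_prodMk_left) fun t => hc _
    have h0 := integral_inner (𝕜 := ℝ) (hint.sub (integrable_const (coordAverage μ i f z))) (g z)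
    simp only [Pi.sub_apply] at h0
    rw [h0, integral_sub hint (integrable_const _)]
    simp [coordAverage]
  · refine integrable_of_bounded (c := d * (c + c)) (hg.inner (hf.sub hA)) fun z => ?_
    refine (norm_inner_le_norm _ _).trans ?_
    have h1 := hd z
    have h2 : ‖f z - coordAverage μ i f z‖ ≤ c + c :=
      (norm_sub_le _ _).trans (add_le_add (hc z) (norm_coordAverage_le μ hc i z))
    gcongr
    exact (norm_nonneg _).trans h1

lemma integrable_norm_sq_of_bounded {β F : Type*} [MeasurableSpace β] [NormedAddCommGroup F]
    {ν : Measure β} [IsFiniteMeasure ν]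
    {f : β → F} (hf : StronglyMeasurable f) {c : ℝ} (hc : ∀ z, ‖f z‖ ≤ c) :
    Integrable (fun z => ‖f z‖ ^ 2) ν := by
  refine integrable_of_bounded (c := c ^ 2) (hf.norm.pow 2) fun z => ?_
  rw [norm_pow, norm_norm]
  gcongr
  exact hc z

lemma integral_norm_add_sq {f g : (ι → α) → E} (hf : StronglyMeasurable f)
    (hg : StronglyMeasurable g) {c d : ℝ} (hc : ∀ z, ‖f z‖ ≤ c) (hd : ∀ z, ‖g z‖ ≤ d) (i : ι)
    (hgi : ∀ z t, g (Function.update z i t) = g z) :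
    ∫ z, ‖(f z - coordAverage μ i f z) + g z‖ ^ 2 ∂(Measure.pi fun _ => μ) =
      ∫ z, ‖f z - coordAverage μ i f z‖ ^ 2 ∂(Measure.pi fun _ => μ) +
        ∫ z, ‖g z‖ ^ 2 ∂(Measure.pi fun _ => μ) := by
  have hA := stronglyMeasurable_coordAverage μ hf i
  have hd1 : ∀ z, ‖f z - coordAverage μ i f z‖ ≤ c + c := fun z =>
      (norm_sub_le _ _).trans (add_le_add (hc z) (norm_coordAverage_le μ hc i z))
  have i1 : Integrable (fun z => ‖f z - coordAverage μ i f z‖ ^ 2) (Measure.pi fun _ : ι => μ) :=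
    integrable_norm_sq_of_bounded (hf.sub hA) hd1
  have i2 : Integrable (fun z => ‖g z‖ ^ 2) (Measure.pi fun _ : ι => μ) :=
    integrable_norm_sq_of_bounded hg hd
  have i3 : Integrable (fun z => inner ℝ (g z) (f z - coordAverage μ i f z))
      (Measure.pi fun _ : ι => μ) := by
    refine integrable_of_bounded (c := d * (c + c)) (hg.inner (hf.sub hA)) fun z => ?_
    refine (norm_inner_le_norm _ _).trans ?_
    have h1 := hd z
    have h2 := hd1 z
    gcongr
    exact (norm_nonneg _).trans h1
  have : ∀ z, ‖(f z - coordAverage μ i f z) + g z‖ ^ 2 =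
      (‖f z - coordAverage μ i f z‖ ^ 2 + ‖g z‖ ^ 2) +
        2 * inner ℝ (g z) (f z - coordAverage μ i f z) := fun z => by
    rw [@norm_add_sq_real, real_inner_comm]; ring
  simp_rw [this]
  rw [integral_add (by exact i1.add i2) (i3.const_mul 2), integral_const_mul,
    integral_inner_sub_coordAverage μ hf hg hc hd i hgi, integral_add i1 i2]
  simp

lemma integral_norm_sq_coordAverage_le {f : (ι → α) → E} (hf : StronglyMeasurable f)
    {c : ℝ} (hc : ∀ z, ‖f z‖ ≤ c) (i : ι) :
    ∫ z, ‖coordAverage μ i f z‖ ^ 2 ∂(Measure.pi fun _ => μ) ≤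
      ∫ z, ‖f z‖ ^ 2 ∂(Measure.pi fun _ => μ) := by
  have := integral_norm_add_sq μ hf (stronglyMeasurable_coordAverage μ hf i) hc
    (norm_coordAverage_le μ hc i) i (coordAverage_update μ f i)
  simp only [sub_add_cancel] at this
  rw [this]
  exact le_add_of_nonneg_left (integral_nonneg fun z => by positivity)

/-- Average of `f` over the coordinates in a list. -/
def listAverage {E : Type*} [NormedAddCommGroup E] [NormedSpace ℝ E] (μ : Measure α)
    (l : List ι) (f : (ι → α) → E) : (ι → α) → E :=
  l.foldr (coordAverage μ) f

lemma stronglyMeasurable_listAverage {f : (ι → α) → E}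
    (hf : StronglyMeasurable f) (l : List ι) : StronglyMeasurable (listAverage μ l f) := by
  induction l with
  | nil => exact hf
  | cons i l ih => exact stronglyMeasurable_coordAverage μ ih i

lemma norm_listAverage_le {f : (ι → α) → E} {c : ℝ} (hc : ∀ z, ‖f z‖ ≤ c)
    (l : List ι) (z : ι → α) : ‖listAverage μ l f z‖ ≤ c := by
  induction l generalizing z with
  | nil => exact hc z
  | cons i l ih =>
    have := norm_integral_le_of_norm_le_const (μ := μ)
      (f := fun t => listAverage μ l f (Function.update z i t))
      (Filter.Eventually.of_forall fun t => ih _)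
    rw [probReal_univ, mul_one] at this
    exact this

lemma listAverage_update (f : (ι → α) → E) (l : List ι) (j : ι) (hj : j ∈ l)
    (z : ι → α) (t : α) :
    listAverage μ l f (Function.update z j t) = listAverage μ l f z := by
  induction l generalizing z t with
  | nil => simp at hj
  | cons i l ih =>
    rcases List.mem_cons.1 hj with rfl | hj
    · exact coordAverage_update μ _ _ _ _
    · exact coordAverage_update_of_update μ (ih hj) _ _ _

lemma integral_listAverage {f : (ι → α) → E} (hf : StronglyMeasurable f)
    {c : ℝ} (hc : ∀ z, ‖f z‖ ≤ c) (l : List ι) :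
    ∫ z, listAverage μ l f z ∂(Measure.pi fun _ => μ) = ∫ z, f z ∂(Measure.pi fun _ => μ) := by
  induction l with
  | nil => rfl
  | cons i l ih =>
    rw [← ih, integral_pi_eq_integral_update μ (f := listAverage μ l f) _ i]
    · rfl
    · exact integrable_of_bounded (stronglyMeasurable_listAverage μ hf l)
        (norm_listAverage_le μ hc l)

/-- Coordinates are averaged out one at a time. Each new step is orthogonal to what does not depend
on that coordinate, and averaging is a contraction in `L²`, so each coordinate costs only its own
variance. -/
lemma integral_norm_sub_listAverage_sq_le {f : (ι → α) → E} (hf : StronglyMeasurable f)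
    {c : ℝ} (hc : ∀ z, ‖f z‖ ≤ c) (l : List ι) :
    ∫ z, ‖f z - listAverage μ l f z‖ ^ 2 ∂(Measure.pi fun _ => μ) ≤
      (l.map fun i => ∫ z, ‖f z - coordAverage μ i f z‖ ^ 2 ∂(Measure.pi fun _ => μ)).sum := by
  induction l with
  | nil => simp [listAverage]
  | cons i l ih =>
    have hL := stronglyMeasurable_listAverage μ hf l
    have hLb := norm_listAverage_le μ hc l
    have hs : StronglyMeasurable fun z => f z - listAverage μ l f z := hf.sub hL
    have hsb : ∀ z, ‖f z - listAverage μ l f z‖ ≤ c + c := fun z =>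
      (norm_sub_le _ _).trans (add_le_add (hc z) (hLb z))
    -- With `A_i` the average over coordinate `i`: `f - A_i A_l f = (f - A_i f) + A_i (f - A_l f)`,
    -- and the two summands are orthogonal.
    have key : ∀ z, f z - listAverage μ (i :: l) f z = (f z - coordAverage μ i f z) +
        coordAverage μ i (fun z => f z - listAverage μ l f z) z := by
      intro z
      have h1 : Integrable (fun t => f (Function.update z i t)) μ :=
        integrable_of_bounded ((stronglyMeasurable_update hf i).comp_measurable
          measurable_prodMk_left) fun t => hc _
      have h2 : Integrable (fun t => listAverage μ l f (Function.update z i t)) μ :=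
        integrable_of_bounded ((stronglyMeasurable_update hL i).comp_measurable
          measurable_prodMk_left) fun t => hLb _
      simp only [coordAverage]
      rw [integral_sub h1 h2]
      simp [listAverage, coordAverage]
    simp_rw [key]
    rw [integral_norm_add_sq μ hf (stronglyMeasurable_coordAverage μ hs i) hc
      (norm_coordAverage_le μ hsb i) i (coordAverage_update μ _ i), List.map_cons, List.sum_cons]
    exact add_le_add le_rfl ((integral_norm_sq_coordAverage_le μ hs hsb i).trans ih)

/-- The Efron-Stein inequality for bounded functions. -/
theorem efronStein {f : (ι → α) → E} (hf : StronglyMeasurable f) {c : ℝ} (hc : ∀ z, ‖f z‖ ≤ c) :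
    ∫ z, ‖f z - ∫ w, f w ∂(Measure.pi fun _ => μ)‖ ^ 2 ∂(Measure.pi fun _ => μ) ≤
      ∑ i, ∫ z, ∫ t, ‖f (Function.update z i t) - ∫ s, f (Function.update z i s) ∂μ‖ ^ 2 ∂μ
        ∂(Measure.pi fun _ => μ) := by
  set l := (Finset.univ : Finset ι).toList
  have hconst : ∀ z w, listAverage μ l f z = listAverage μ l f w := by
    intro z w
    -- Passing from `w` to `z` one coordinate at a time, no step changes the full average.
    have : ∀ s : Finset ι, listAverage μ l f (fun j => if j ∈ s then z j else w j) =
        listAverage μ l f w := by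
      intro s
      induction s using Finset.induction_on with
      | empty => simp
      | insert i s his ih =>
        rw [← ih, ← listAverage_update μ f l i (by simp [l]) (fun j => if j ∈ s then z j else w j)
          (z i)]
        congr 1
        ext j
        by_cases hj : j = i
        · subst hj; simp
        · simp [hj]
    simpa using this Finset.univ
  have hmean : ∀ z, listAverage μ l f z = ∫ w, f w ∂(Measure.pi fun _ => μ) := by
    intro z
    rw [← integral_listAverage μ hf hc l, integral_congr_ae
      (Filter.Eventually.of_forall fun w => hconst w z)]
    simp
  have := integral_norm_sub_listAverage_sq_le μ hf hc l
  simp_rw [hmean] at this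
  refine this.trans (le_of_eq ?_)
  rw [Finset.sum_map_toList]
  refine Finset.sum_congr rfl fun i _ => ?_
  rw [integral_pi_eq_integral_update μ _ i]
  · simp only [coordAverage_update]
    rfl
  · refine integrable_norm_sq_of_bounded (c := c + c)
      (hf.sub (stronglyMeasurable_coordAverage μ hf i)) fun z => ?_
    exact (norm_sub_le _ _).trans (add_le_add (hc z) (norm_coordAverage_le μ hc i z))

end EfronStein

/-! ### Moments of the entry law; finite fourth moment from Poincaré -/

section Moments

variable {μ : Measure ℝ} [IsProbabilityMeasure μ]

/-- Outside `L²` the real `variance` is 0 by convention, so the value 1 forces square integrability.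
-/
lemma memLp_id_two_of_variance_eq_one (hvar : variance id μ = 1) : MemLp id 2 μ := by
  by_contra h
  rw [variance_of_not_memLp aestronglyMeasurable_id h] at hvar
  exact zero_ne_one hvar

omit [IsProbabilityMeasure μ] in
lemma integral_odd_eq_zero (hsymm : IsSymmetricLaw μ) {f : ℝ → ℝ} (hf : Measurable f)
    (hodd : ∀ x, f (-x) = -f x) : ∫ x, f x ∂μ = 0 := by
  have h1 : ∫ x, f x ∂μ = ∫ x, f (-x) ∂μ := by
    conv_lhs => rw [← hsymm]
    exact integral_map measurable_neg.aemeasurable hf.aestronglyMeasurable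
  simp_rw [hodd, integral_neg] at h1
  linarith

lemma integral_sq_eq_one (hsymm : IsSymmetricLaw μ) (hvar : variance id μ = 1) :
    ∫ x, x ^ 2 ∂μ = 1 := by
  have h := variance_eq_sub (memLp_id_two_of_variance_eq_one hvar)
  have h0 : ∫ x, id x ∂μ = 0 := integral_odd_eq_zero hsymm measurable_id (by simp)
  rw [h0, hvar] at h
  simpa using h.symm

lemma integrable_sq_of_variance (hvar : variance id μ = 1) : Integrable (fun x : ℝ => x ^ 2) μ := by
  simpa using (memLp_id_two_of_variance_eq_one hvar).integrable_sq

/-- A bounded smooth truncation of `t ↦ t ^ 2`. -/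
def truncSq (N : ℝ) (t : ℝ) : ℝ := N * t ^ 2 / (N + t ^ 2)

lemma hasDerivAt_truncSq {N : ℝ} (hN : 0 < N) (t : ℝ) :
    HasDerivAt (truncSq N) (2 * t * (N / (N + t ^ 2)) ^ 2) t := by
  have hne : N + t ^ 2 ≠ 0 := by positivity
  have h1 : HasDerivAt (fun t : ℝ => N * t ^ 2) (N * (2 * t)) t := by
    simpa using (hasDerivAt_pow 2 t).const_mul N
  have h2 : HasDerivAt (fun t : ℝ => N + t ^ 2) (2 * t) t := by
    simpa using (hasDerivAt_pow 2 t).const_add N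
  refine (h1.div h2 hne).congr_deriv ?_
  field_simp
  ring

lemma truncSq_nonneg {N : ℝ} (hN : 0 < N) (t : ℝ) : 0 ≤ truncSq N t := by
  unfold truncSq; positivity

lemma truncSq_le {N : ℝ} (hN : 0 < N) (t : ℝ) : truncSq N t ≤ t ^ 2 := by
  unfold truncSq
  rw [div_le_iff₀ (by positivity)]
  nlinarith [sq_nonneg (t ^ 2), sq_nonneg t]

lemma truncSq_le' {N : ℝ} (hN : 0 < N) (t : ℝ) : truncSq N t ≤ N := by
  unfold truncSq
  rw [div_le_iff₀ (by positivity)]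
  nlinarith

lemma continuous_truncSq {N : ℝ} (hN : 0 < N) : Continuous (truncSq N) :=
  continuous_iff_continuousAt.2 fun t => (hasDerivAt_truncSq hN t).continuousAt

/-- The truncated square is bounded with derivative at most `2|t|`, so Poincaré applies and bounds
its variance by `4C`; its mean lies between 0 and `∫ t² = 1`. The bound is uniform in `N`, which
lets the truncation be removed. -/
lemma integral_truncSq_sq_le {C : ℝ} (hvar : variance id μ = 1) (hsymm : IsSymmetricLaw μ)
    (hC : 0 < C)
    (hP : ∀ f : ℝ → ℂ, ContDiff ℝ 1 f → MemLp f 2 μ → MemLp (deriv f) 2 μ →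
      ∫ x, ‖f x - ∫ y, f y ∂μ‖ ^ 2 ∂μ ≤ C * ∫ x, ‖deriv f x‖ ^ 2 ∂μ) {N : ℝ} (hN : 0 < N) :
    ∫ t, truncSq N t ^ 2 ∂μ ≤ 4 * C + 1 := by
  have hsq := integrable_sq_of_variance (μ := μ) hvar
  set f : ℝ → ℂ := fun t => (truncSq N t : ℂ) with hf
  have hder : ∀ t, HasDerivAt f ((2 * t * (N / (N + t ^ 2)) ^ 2 : ℝ) : ℂ) t := fun t =>
    (hasDerivAt_truncSq hN t).ofReal_comp
  have hd : deriv f = fun t => ((2 * t * (N / (N + t ^ 2)) ^ 2 : ℝ) : ℂ) :=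
    funext fun t => (hder t).deriv
  have hdc : Continuous (deriv f) := by
    rw [hd]
    refine Complex.continuous_ofReal.comp ?_
    have : ∀ t : ℝ, N + t ^ 2 ≠ 0 := fun t => by positivity
    fun_prop (disch := exact this _)
  have hcd : ContDiff ℝ 1 f := contDiff_one_iff_deriv.2 ⟨fun t => (hder t).differentiableAt, hdc⟩
  have hfm : MemLp f 2 μ := by
    refine MemLp.of_bound hcd.continuous.aestronglyMeasurable N (Filter.Eventually.of_forall
      fun t => ?_)
    simp only [hf, Complex.norm_real, Real.norm_of_nonneg (truncSq_nonneg hN t)]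
    exact truncSq_le' hN t
  have hdb : ∀ t, ‖deriv f t‖ ≤ 2 * |t| := by
    intro t
    rw [hd]
    simp only [Complex.norm_real, Real.norm_eq_abs, abs_mul, abs_two, abs_pow]
    have h1 : |N / (N + t ^ 2)| ≤ 1 := by
      rw [abs_of_nonneg (by positivity), div_le_one (by positivity)]; nlinarith
    have h2 : |N / (N + t ^ 2)| ^ 2 ≤ 1 := pow_le_one₀ (abs_nonneg _) h1
    calc _ ≤ 2 * |t| * 1 := by gcongr
      _ = _ := mul_one _
  have hdm : MemLp (deriv f) 2 μ :=
    MemLp.of_le ((memLp_id_two_of_variance_eq_one hvar).const_mul 2) hdc.aestronglyMeasurable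
      (Filter.Eventually.of_forall fun t => by simpa using hdb t)
  have key := hP f hcd hfm hdm
  have hint : Integrable (fun t => truncSq N t) μ :=
    Integrable.of_bound (continuous_truncSq hN).aestronglyMeasurable N
      (Filter.Eventually.of_forall fun t => by
        rw [Real.norm_of_nonneg (truncSq_nonneg hN t)]; exact truncSq_le' hN t)
  have hint2 : Integrable (fun t => truncSq N t ^ 2) μ :=
    Integrable.of_bound ((continuous_truncSq hN).pow 2).aestronglyMeasurable (N ^ 2)
      (Filter.Eventually.of_forall fun t => by
        rw [norm_pow, Real.norm_of_nonneg (truncSq_nonneg hN t)]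
        exact pow_le_pow_left₀ (truncSq_nonneg hN t) (truncSq_le' hN t) 2)
  set M := ∫ t, truncSq N t ∂μ with hM
  have hMf : ∫ y, f y ∂μ = (M : ℂ) := integral_ofReal
  have hM1 : M ≤ 1 := by
    rw [← integral_sq_eq_one hsymm hvar]
    exact integral_mono hint hsq fun t => truncSq_le hN t
  have hM0 : 0 ≤ M := integral_nonneg fun t => truncSq_nonneg hN t
  have hlhs : ∫ x, ‖f x - ∫ y, f y ∂μ‖ ^ 2 ∂μ = ∫ t, truncSq N t ^ 2 ∂μ - M ^ 2 := by
    rw [hMf]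
    have : ∀ x, ‖f x - (M : ℂ)‖ ^ 2 = truncSq N x ^ 2 - (2 * M) * truncSq N x + M ^ 2 := by
      intro x
      simp only [hf]
      rw [← Complex.ofReal_sub, Complex.norm_real, Real.norm_eq_abs, sq_abs]
      ring
    simp_rw [this]
    rw [integral_add (by exact hint2.sub (hint.const_mul _)) (integrable_const _),
      integral_sub hint2 (hint.const_mul _), integral_const_mul, ← hM]
    simp; ring
  have hrhs : ∫ x, ‖deriv f x‖ ^ 2 ∂μ ≤ 4 := by
    calc ∫ x, ‖deriv f x‖ ^ 2 ∂μ ≤ ∫ x, 4 * x ^ 2 ∂μ := by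
          refine integral_mono hdm.integrable_norm_pow' (hsq.const_mul 4) fun t => ?_
          have := pow_le_pow_left₀ (norm_nonneg _) (hdb t) 2
          rw [mul_pow, sq_abs] at this
          norm_num at this
          exact this
      _ = 4 := by rw [integral_const_mul, integral_sq_eq_one hsymm hvar, mul_one]
  rw [hlhs] at key
  nlinarith [mul_le_mul_of_nonneg_left hrhs hC.le]

lemma integrable_pow_four_of_poincare (hsymm : IsSymmetricLaw μ) (hvar : variance id μ = 1)
    (hpoin : SatisfiesPoincare μ) : Integrable (fun x : ℝ => x ^ 4) μ := by
  obtain ⟨C, hC, hP⟩ := hpoin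
  refine ⟨by fun_prop, ?_⟩
  have hlim : ∀ t : ℝ, Filter.Tendsto (fun k : ℕ => truncSq (k + 1) t ^ 2) Filter.atTop
      (nhds (t ^ 4)) := by
    intro t
    have h1 : Filter.Tendsto (fun k : ℕ => t ^ 2 / (1 + t ^ 2 * (1 / ((k : ℝ) + 1)))) Filter.atTop
        (nhds (t ^ 2 / (1 + t ^ 2 * 0))) :=
      tendsto_const_nhds.div (tendsto_const_nhds.add
        (tendsto_const_nhds.mul tendsto_one_div_add_atTop_nhds_zero_nat)) (by simp)
    have h2 := h1.pow 2
    have h3 : (t ^ 2 / (1 + t ^ 2 * 0)) ^ 2 = t ^ 4 := by ring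
    rw [h3] at h2
    refine h2.congr fun k => ?_
    unfold truncSq
    field_simp
  have hfin : ∀ k : ℕ, ∫⁻ t, ‖truncSq ((k : ℝ) + 1) t ^ 2‖ₑ ∂μ ≤ ENNReal.ofReal (4 * C + 1) := by
    intro k
    have hk : (0 : ℝ) < (k : ℝ) + 1 := by positivity
    have h1 := integral_truncSq_sq_le hvar hsymm hC hP hk
    rw [← ofReal_integral_norm_eq_lintegral_enorm]
    · refine ENNReal.ofReal_le_ofReal ?_
      simpa using h1
    · exact Integrable.of_bound ((continuous_truncSq hk).pow 2).aestronglyMeasurable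
        (((k : ℝ) + 1) ^ 2) (Filter.Eventually.of_forall fun t => by
        rw [norm_pow, Real.norm_of_nonneg (truncSq_nonneg hk t)]
        exact pow_le_pow_left₀ (truncSq_nonneg hk t) (truncSq_le' hk t) 2)
  -- Fatou's lemma: the truncations converge pointwise to `t⁴` with integrals bounded by `4C + 1`.
  have hfatou : ∫⁻ t, ‖t ^ 4‖ₑ ∂μ ≤
      Filter.liminf (fun k : ℕ => ∫⁻ t, ‖truncSq ((k : ℝ) + 1) t ^ 2‖ₑ ∂μ) Filter.atTop := by
    have : ∀ t : ℝ, ‖t ^ 4‖ₑ =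
        Filter.liminf (fun k : ℕ => ‖truncSq ((k : ℝ) + 1) t ^ 2‖ₑ) Filter.atTop := fun t =>
      ((hlim t).enorm.liminf_eq).symm
    simp_rw [this]
    refine lintegral_liminf_le fun k => ?_
    have hk : (0 : ℝ) < (k : ℝ) + 1 := by positivity
    exact ((continuous_truncSq hk).pow 2).measurable.enorm
  refine lt_of_le_of_lt (hfatou.trans ?_) (ENNReal.ofReal_lt_top (r := 4 * C + 1))
  refine (Filter.liminf_le_liminf (Filter.Eventually.of_forall hfin)).trans ?_
  simp

end Moments

/-! ### Approximate integration by parts for resolvents -/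

section IntegrationByParts

variable {A : Type*} [NormedRing A] [NormedAlgebra ℝ A]

/-- Here `s` is the resolvent at `t` and `r₀` at 0. Both `t s` and `s B s` are expanded far enough
that the remainder contains three factors `B`. The explicit part has coefficients `t`, `t² - 1`, `t³
- 2t`, which all have mean zero when the first three moments are 0, 1, 0. -/
lemma resolvent_remainder_eq {r₀ s B : A} {t : ℝ} (h : s = r₀ + t • (r₀ * B * s)) :
    t • s - s * B * s = t • r₀ + (t ^ 2 - 1) • (r₀ * B * r₀) +
      (t ^ 3 - 2 * t) • (r₀ * B * r₀ * B * r₀) + (t ^ 4 • (r₀ * B * r₀ * B * r₀ * B * s) -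
        t ^ 2 • (r₀ * B * r₀ * B * r₀ * B * s + r₀ * B * r₀ * B * r₀ * B * s +
          r₀ * B * r₀ * B * s * B * s)) := by
  have e2 : s = r₀ + t • (r₀ * B * r₀) + t ^ 2 • (r₀ * B * r₀ * B * s) := by
    conv_lhs => rw [h, h]
    simp only [mul_add, mul_smul_comm, mul_assoc]
    module
  have e3 : s = r₀ + t • (r₀ * B * r₀) + t ^ 2 • (r₀ * B * r₀ * B * r₀) +
      t ^ 3 • (r₀ * B * r₀ * B * r₀ * B * s) := by
    conv_lhs => rw [e2, h]
    simp only [mul_add, mul_smul_comm, mul_assoc]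
    module
  have e4 : s * B * s = r₀ * B * s + t • (r₀ * B * r₀ * B * s) +
      t ^ 2 • (r₀ * B * r₀ * B * s * B * s) := by
    have := congrArg (· * (B * s)) e2
    simp only [add_mul, smul_mul_assoc, mul_assoc] at this ⊢
    exact this
  have e5 : r₀ * B * s = r₀ * B * r₀ + t • (r₀ * B * r₀ * B * r₀) +
      t ^ 2 • (r₀ * B * r₀ * B * r₀ * B * s) := by
    conv_lhs => rw [e2]
    simp only [mul_add, mul_smul_comm, mul_assoc]
  have e6 : r₀ * B * r₀ * B * s = r₀ * B * r₀ * B * r₀ +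
      t • (r₀ * B * r₀ * B * r₀ * B * s) := by
    conv_lhs => rw [h]
    simp only [mul_add, mul_smul_comm, mul_assoc]
  have e7 : t • s = t • (r₀ + t • (r₀ * B * r₀) + t ^ 2 • (r₀ * B * r₀ * B * r₀) +
      t ^ 3 • (r₀ * B * r₀ * B * r₀ * B * s)) := by rw [← e3]
  rw [e7, e4, e5, e6]
  module

lemma norm_prod_seven_le {x b : ℝ} {a₁ a₂ a₃ a₄ B : A} (h₁ : ‖a₁‖ ≤ x) (h₂ : ‖a₂‖ ≤ x)
    (h₃ : ‖a₃‖ ≤ x) (h₄ : ‖a₄‖ ≤ x) (hB : ‖B‖ ≤ b) :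
    ‖a₁ * B * a₂ * B * a₃ * B * a₄‖ ≤ b ^ 3 * x ^ 4 := by
  have hx : 0 ≤ x := (norm_nonneg _).trans h₁
  have hb : 0 ≤ b := (norm_nonneg _).trans hB
  have m := fun (u v : A) (α β : ℝ) (hu : ‖u‖ ≤ α) (hv : ‖v‖ ≤ β) =>
    (norm_mul_le u v).trans (mul_le_mul hu hv (norm_nonneg _) ((norm_nonneg _).trans hu))
  refine (m _ _ _ _ (m _ _ _ _ (m _ _ _ _ (m _ _ _ _ (m _ _ _ _ (m _ _ _ _ h₁ hB) h₂) hB) h₃) hB)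
    h₄).trans (le_of_eq ?_)
  ring

variable {μ : Measure ℝ} [IsProbabilityMeasure μ]

/-- Approximate integration by parts for resolvents, in one variable. -/
lemma norm_integral_smul_sub_le [CompleteSpace A] {r : ℝ → A} {B : A} {x : ℝ}
    (hr : ∀ t, r t = r 0 + t • (r 0 * B * r t)) (hx : ∀ t, ‖r t‖ ≤ x)
    (h1 : ∫ t, t ∂μ = 0) (h2 : ∫ t, t ^ 2 ∂μ = 1) (h3 : ∫ t, t ^ 3 ∂μ = 0)
    (h4 : Integrable (fun t : ℝ => t ^ 4) μ) :
    ‖∫ t, (t • r t - r t * B * r t) ∂μ‖ ≤ (∫ t, t ^ 4 ∂μ + 3) * (‖B‖ ^ 3 * x ^ 4) := by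
  have hx0 : 0 ≤ x := (norm_nonneg _).trans (hx 0)
  have i2 : Integrable (fun t : ℝ => t ^ 2) μ := by
    by_contra h
    rw [integral_undef h] at h2
    exact zero_ne_one h2
  have dom : ∀ k : ℕ, k ≤ 4 → Integrable (fun t : ℝ => t ^ k) μ := by
    intro k hk
    refine Integrable.mono' ((integrable_const (1 : ℝ)).add h4) (by fun_prop)
      (Filter.Eventually.of_forall fun t => ?_)
    simp only [norm_pow, Real.norm_eq_abs, Pi.add_apply]
    rw [← Even.pow_abs (by decide : Even 4) t]
    rcases le_total |t| 1 with h | h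
    · have := pow_le_one₀ (n := k) (abs_nonneg t) h
      have : 0 ≤ |t| ^ 4 := by positivity
      linarith
    · have := pow_le_pow_right₀ h hk
      linarith
  have i1 : Integrable (fun t : ℝ => t) μ := by simpa using dom 1 (by norm_num)
  have i3 := dom 3 (by norm_num)
  set M := ‖B‖ ^ 3 * x ^ 4 with hM
  set q : ℝ → A := fun t => t • r 0 + (t ^ 2 - 1) • (r 0 * B * r 0) +
      (t ^ 3 - 2 * t) • (r 0 * B * r 0 * B * r 0) with hq
  set rem : ℝ → A := fun t => t ^ 4 • (r 0 * B * r 0 * B * r 0 * B * r t) -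
        t ^ 2 • (r 0 * B * r 0 * B * r 0 * B * r t + r 0 * B * r 0 * B * r 0 * B * r t +
          r 0 * B * r 0 * B * r t * B * r t) with hrem
  have hdec : ∀ t, t • r t - r t * B * r t = q t + rem t := fun t =>
    resolvent_remainder_eq (hr t)
  have j1 : Integrable (fun t : ℝ => t • r 0) μ := i1.smul_const _
  have j2 : Integrable (fun t : ℝ => (t ^ 2 - 1) • (r 0 * B * r 0)) μ :=
    (i2.sub (integrable_const 1)).smul_const _
  have j3 : Integrable (fun t : ℝ => (t ^ 3 - 2 * t) • (r 0 * B * r 0 * B * r 0)) μ :=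
    (i3.sub (i1.const_mul 2)).smul_const _
  have jq : Integrable q μ := (j1.add j2).add j3
  have hq0 : ∫ t, q t ∂μ = 0 := by
    simp only [hq]
    rw [integral_add (by exact j1.add j2) j3, integral_add j1 j2, integral_smul_const,
      integral_smul_const, integral_smul_const, integral_sub i2 (integrable_const _),
      integral_sub i3 (i1.const_mul 2), integral_const_mul, h1, h2, h3]
    simp
  -- The four remainder terms are each a product of four resolvents and three `B`; one carries `t⁴`
  -- and three carry `t²`, whence the constant `∫ t⁴ + 3`.
  have hremb : ∀ t, ‖rem t‖ ≤ (t ^ 4 + 3 * t ^ 2) * M := by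
    intro t
    have n1 := norm_prod_seven_le (hx 0) (hx 0) (hx 0) (hx t) le_rfl (B := B)
    have n2 := norm_prod_seven_le (hx 0) (hx 0) (hx t) (hx t) le_rfl (B := B)
    simp only [hrem]
    refine (norm_sub_le _ _).trans ?_
    rw [norm_smul, norm_smul, Real.norm_of_nonneg (by positivity : (0 : ℝ) ≤ t ^ 4),
      Real.norm_of_nonneg (by positivity : (0 : ℝ) ≤ t ^ 2)]
    have n3 : ‖r 0 * B * r 0 * B * r 0 * B * r t + r 0 * B * r 0 * B * r 0 * B * r t +
          r 0 * B * r 0 * B * r t * B * r t‖ ≤ 3 * M := by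
      refine (norm_add₃_le).trans ?_
      linarith
    calc _ ≤ t ^ 4 * M + t ^ 2 * (3 * M) := by gcongr
      _ = _ := by ring
  have ib : Integrable (fun t : ℝ => (t ^ 4 + 3 * t ^ 2) * M) μ :=
    (h4.add (i2.const_mul 3)).mul_const M
  by_cases hri : Integrable rem μ
  · simp_rw [hdec]
    rw [integral_add jq hri, hq0, zero_add]
    refine (norm_integral_le_of_norm_le ib (Filter.Eventually.of_forall hremb)).trans (le_of_eq ?_)
    rw [integral_mul_const, integral_add h4 (i2.const_mul 3), integral_const_mul, h2, mul_one]
  -- No measurability of `r` is assumed. If the remainder is not integrable, neither is the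
  -- integrand, and its integral is 0 by convention.
  · have : ¬ Integrable (fun t => t • r t - r t * B * r t) μ := by
      intro hi
      apply hri
      have := hi.sub jq
      refine this.congr (Filter.Eventually.of_forall fun t => ?_)
      simp [hdec]
    rw [integral_undef this, norm_zero]
    have : 0 ≤ ∫ t, t ^ 4 ∂μ := integral_nonneg fun t => by positivity
    positivity

lemma integrable_eval_smul {ι F : Type*} [Fintype ι] [NormedAddCommGroup F] [NormedSpace ℝ F]
    {R : (ι → ℝ) → F} {x : ℝ} (hR : StronglyMeasurable R) (hx : ∀ z, ‖R z‖ ≤ x)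
    (h1 : Integrable (fun t : ℝ => t) μ) (i : ι) :
    Integrable (fun z => z i • R z) (Measure.pi fun _ => μ) := by
  have hi : Integrable (fun z : ι → ℝ => z i) (Measure.pi fun _ => μ) :=
    integrable_comp_eval (μ := fun _ : ι => μ) h1
  refine Integrable.mono' (hi.norm.mul_const x)
    ((measurable_pi_apply i).aestronglyMeasurable.smul hR.aestronglyMeasurable)
    (Filter.Eventually.of_forall fun z => ?_)
  rw [norm_smul]
  exact mul_le_mul_of_nonneg_left (hx z) (norm_nonneg _)

/-- Approximate integration by parts for resolvents, in several independent variables. -/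
lemma norm_integral_eval_smul_sub_le [CompleteSpace A] {ι : Type*} [Fintype ι] [DecidableEq ι]
    {R : (ι → ℝ) → A} {B : A} {x : ℝ} (i : ι) (hR : StronglyMeasurable R)
    (hr : ∀ z t, R (Function.update z i t) = R (Function.update z i 0) +
      t • (R (Function.update z i 0) * B * R (Function.update z i t))) (hx : ∀ z, ‖R z‖ ≤ x)
    (h1 : ∫ t, t ∂μ = 0) (h2 : ∫ t, t ^ 2 ∂μ = 1) (h3 : ∫ t, t ^ 3 ∂μ = 0)
    (i1 : Integrable (fun t : ℝ => t) μ) (h4 : Integrable (fun t : ℝ => t ^ 4) μ) :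
    ‖∫ z, z i • R z ∂(Measure.pi fun _ => μ) - ∫ z, R z * B * R z ∂(Measure.pi fun _ => μ)‖ ≤
      (∫ t, t ^ 4 ∂μ + 3) * (‖B‖ ^ 3 * x ^ 4) := by
  have j1 := integrable_eval_smul hR hx i1 i
  have j2 : Integrable (fun z => R z * B * R z) (Measure.pi fun _ : ι => μ) := by
    refine integrable_of_bounded (c := x * ‖B‖ * x)
      ((hR.mul stronglyMeasurable_const).mul hR) fun z => ?_
    refine norm_mul₃_le.trans ?_
    have := hx z
    have h0 := (norm_nonneg _).trans this
    gcongr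
  rw [← integral_sub j1 j2, integral_pi_eq_integral_update μ
    (f := fun z => z i • R z - R z * B * R z) (j1.sub j2) i]
  have := norm_integral_le_of_norm_le_const (μ := Measure.pi fun _ : ι => μ)
    (f := fun z => ∫ t, (Function.update z i t i • R (Function.update z i t) -
      R (Function.update z i t) * B * R (Function.update z i t)) ∂μ)
    (C := (∫ t, t ^ 4 ∂μ + 3) * (‖B‖ ^ 3 * x ^ 4))
    (Filter.Eventually.of_forall fun z => by
      simp only [Function.update_self]
      exact norm_integral_smul_sub_le (r := fun t => R (Function.update z i t)) (hr z)
        (fun t => hx _) h1 h2 h3 h4)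
  simpa using this

end IntegrationByParts

/-! ### Poincaré inequality for product measures -/

section PoincareProduct

variable {μ : Measure ℝ} [IsProbabilityMeasure μ] {ι : Type*} [Fintype ι] [DecidableEq ι]

/-- Tensorization of the Poincaré inequality. -/
lemma integral_norm_sub_sq_le_of_poincare {C : ℝ}
    (hP : ∀ f : ℝ → ℂ, ContDiff ℝ 1 f → MemLp f 2 μ → MemLp (deriv f) 2 μ →
      ∫ x, ‖f x - ∫ y, f y ∂μ‖ ^ 2 ∂μ ≤ C * ∫ x, ‖deriv f x‖ ^ 2 ∂μ)
    {f : (ι → ℝ) → ℂ} {f' : ι → (ι → ℝ) → ℂ} {c d : ℝ} (hf : Continuous f) (hc : ∀ z, ‖f z‖ ≤ c)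
    (hf' : ∀ i, Continuous (f' i)) (hd : ∀ i z, ‖f' i z‖ ≤ d)
    (hder : ∀ i z t, HasDerivAt (fun s => f (Function.update z i s))
      (f' i (Function.update z i t)) t) :
    ∫ z, ‖f z - ∫ w, f w ∂(Measure.pi fun _ => μ)‖ ^ 2 ∂(Measure.pi fun _ => μ) ≤
      C * ∫ z, ∑ i, ‖f' i z‖ ^ 2 ∂(Measure.pi fun _ => μ) := by
  -- Efron–Stein reduces the variance to the one-coordinate variances, to each of which the
  -- one-dimensional inequality applies with the other coordinates frozen.
  refine (efronStein μ hf.stronglyMeasurable hc).trans ?_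
  have hint : ∀ i, Integrable (fun z => ‖f' i z‖ ^ 2) (Measure.pi fun _ : ι => μ) := fun i =>
    integrable_norm_sq_of_bounded (hf' i).stronglyMeasurable (hd i)
  rw [integral_finsetSum _ fun i _ => hint i, Finset.mul_sum]
  refine Finset.sum_le_sum fun i _ => ?_
  rw [integral_pi_eq_integral_update μ (hint i) i, ← integral_const_mul]
  have hcu : ∀ z : ι → ℝ, Continuous fun t : ℝ => Function.update z i t := fun z =>
    continuous_const.update i continuous_id
  refine integral_mono_of_nonneg (Filter.Eventually.of_forall fun z =>
    integral_nonneg fun t => by positivity) ?_ (Filter.Eventually.of_forall fun z => ?_)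
  · refine Integrable.const_mul ?_ C
    have h1 : StronglyMeasurable fun p : (ι → ℝ) × ℝ => ‖f' i (Function.update p.1 i p.2)‖ ^ 2 :=
      (stronglyMeasurable_update (hf' i).stronglyMeasurable i).norm.pow 2
    refine integrable_of_bounded (c := d ^ 2) h1.integral_prod_right fun z => ?_
    have := norm_integral_le_of_norm_le_const (μ := μ)
      (f := fun t => ‖f' i (Function.update z i t)‖ ^ 2) (C := d ^ 2)
      (Filter.Eventually.of_forall fun t => by
        rw [norm_pow, norm_norm]
        exact pow_le_pow_left₀ (norm_nonneg _) (hd _ _) 2)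
    simpa using this
  · have hdv : deriv (fun s => f (Function.update z i s)) =
        fun t => f' i (Function.update z i t) := funext fun t => (hder i z t).deriv
    have hcd : ContDiff ℝ 1 fun s => f (Function.update z i s) := by
      rw [contDiff_one_iff_deriv, hdv]
      exact ⟨fun t => (hder i z t).differentiableAt, (hf' i).comp (hcu z)⟩
    have := hP _ hcd
      (MemLp.of_bound (hf.comp (hcu z)).aestronglyMeasurable c
        (Filter.Eventually.of_forall fun t => hc _))
      (by
        rw [hdv]
        exact MemLp.of_bound ((hf' i).comp (hcu z)).aestronglyMeasurable d
          (Filter.Eventually.of_forall fun t => hd _ _))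
    rwa [hdv] at this

end PoincareProduct

/-! ### Operator norms, entries and blocks -/

section MatrixNorm

variable {N : Type*} [Fintype N] [DecidableEq N]

lemma sum_norm_sq_col_le (M : Matrix N N ℂ) (j : N) : ∑ i, ‖M i j‖ ^ 2 ≤ ‖M‖ ^ 2 := by
  have h := Matrix.l2_opNorm_mulVec M (EuclideanSpace.single j (1 : ℂ))
  rw [PiLp.norm_single, norm_one, mul_one] at h
  have h2 := pow_le_pow_left₀ (norm_nonneg _) h 2
  rw [EuclideanSpace.norm_sq_eq] at h2
  simpa using h2

lemma sum_norm_sq_row_le (M : Matrix N N ℂ) (i : N) : ∑ j, ‖M i j‖ ^ 2 ≤ ‖M‖ ^ 2 := by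
  have := sum_norm_sq_col_le Mᴴ i
  rw [Matrix.l2_opNorm_conjTranspose] at this
  simpa using this

lemma norm_entry_le (M : Matrix N N ℂ) (i j : N) : ‖M i j‖ ≤ ‖M‖ := by
  have h1 := sum_norm_sq_row_le M i
  have h2 := Finset.single_le_sum (f := fun j => ‖M i j‖ ^ 2) (fun j _ => by positivity)
    (Finset.mem_univ j)
  exact le_of_sq_le_sq (h2.trans h1) (norm_nonneg _)

lemma norm_single_le (i j : N) (c : ℂ) : ‖Matrix.single i j c‖ ≤ ‖c‖ := by
  have h : ‖Matrix.single i j c‖ * ‖Matrix.single i j c‖ = ‖c‖ * ‖c‖ := by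
    rw [← Matrix.l2_opNorm_conjTranspose_mul_self, Matrix.conjTranspose_single,
      Matrix.single_mul_single_same, ← Matrix.diagonal_single, Matrix.l2_opNorm_diagonal,
      Pi.norm_single]
    simp
  nlinarith [norm_nonneg (Matrix.single i j c), norm_nonneg c]

lemma norm_le_sum_norm (M : Matrix N N ℂ) : ‖M‖ ≤ ∑ i, ∑ j, ‖M i j‖ := by
  conv_lhs => rw [Matrix.matrix_eq_sum_single M]
  refine (norm_sum_le _ _).trans (Finset.sum_le_sum fun i _ => ?_)
  exact (norm_sum_le _ _).trans (Finset.sum_le_sum fun j _ => norm_single_le _ _ _)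

/-- Cauchy–Schwarz applied to the entrywise bound. The dimensional factor is harmless since the
lemma is applied to `m × m` blocks, whose size does not depend on `n`. -/
lemma norm_sq_le_card_mul_sum (M : Matrix N N ℂ) :
    ‖M‖ ^ 2 ≤ (Fintype.card N : ℝ) ^ 2 * ∑ i, ∑ j, ‖M i j‖ ^ 2 := by
  have h := pow_le_pow_left₀ (norm_nonneg _) (norm_le_sum_norm M) 2
  refine h.trans ?_
  rw [← Finset.univ.sum_product' Finset.univ, ← Finset.univ.sum_product' Finset.univ]
  refine sq_sum_le_card_mul_sum_sq.trans (le_of_eq ?_)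
  rw [Finset.card_product]
  push_cast
  rw [sq]; rfl

variable {m n : ℕ}

lemma norm_matrixBlock_le (M : Matrix (Fin m × Fin n) (Fin m × Fin n) ℂ) (k l : Fin n) :
    ‖matrixBlock M k l‖ ≤ (m : ℝ) ^ 2 * ‖M‖ := by
  refine (norm_le_sum_norm _).trans ?_
  calc _ ≤ ∑ _i : Fin m, ∑ _j : Fin m, ‖M‖ :=
        Finset.sum_le_sum fun i _ => Finset.sum_le_sum fun j _ => norm_entry_le M _ _
    _ = _ := by simp; ring

/-- The block map as a continuous linear map. -/
def matrixBlockL (k l : Fin n) : Matrix (Fin m × Fin n) (Fin m × Fin n) ℂ →L[ℝ]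
    Matrix (Fin m) (Fin m) ℂ :=
  LinearMap.toContinuousLinearMap
    { toFun := fun M => matrixBlock M k l
      map_add' := fun _ _ => rfl
      map_smul' := fun _ _ => rfl }

lemma matrixBlockL_apply (k l : Fin n) (M : Matrix (Fin m × Fin n) (Fin m × Fin n) ℂ) :
    matrixBlockL k l M = matrixBlock M k l := rfl

/-- The entry map as a continuous linear map. -/
def entryL (i j : N) : Matrix N N ℂ →L[ℝ] ℂ :=
  LinearMap.toContinuousLinearMap
    { toFun := fun M => M i j
      map_add' := fun _ _ => rfl
      map_smul' := fun _ _ => rfl }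

lemma entryL_apply (i j : N) (M : Matrix N N ℂ) : entryL i j M = M i j := rfl

lemma matrixBlock_kronecker_mul (c : Matrix (Fin m) (Fin m) ℂ) (e : Matrix (Fin n) (Fin n) ℂ)
    (M : Matrix (Fin m × Fin n) (Fin m × Fin n) ℂ) (k l : Fin n) :
    matrixBlock ((c ⊗ₖ e) * M) k l = ∑ j, e k j • (c * matrixBlock M j l) := by
  ext α β
  simp only [matrixBlock, Matrix.of_apply, Matrix.mul_apply, Matrix.sum_apply, Matrix.smul_apply,
    Matrix.kroneckerMap_apply, smul_eq_mul, Fintype.sum_prod_type, Finset.mul_sum]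
  rw [Finset.sum_comm]
  refine Finset.sum_congr rfl fun j _ => Finset.sum_congr rfl fun γ _ => ?_
  ring

lemma matrixBlock_kronecker_one_mul (c : Matrix (Fin m) (Fin m) ℂ)
    (M : Matrix (Fin m × Fin n) (Fin m × Fin n) ℂ) (k l : Fin n) :
    matrixBlock ((c ⊗ₖ (1 : Matrix (Fin n) (Fin n) ℂ)) * M) k l = c * matrixBlock M k l := by
  rw [matrixBlock_kronecker_mul, Finset.sum_eq_single k]
  · simp
  · intro j _ hj; simp [Matrix.one_apply_ne hj.symm]
  · simp

lemma matrixBlock_one (k : Fin n) :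
    matrixBlock (1 : Matrix (Fin m × Fin n) (Fin m × Fin n) ℂ) k k = 1 := by
  ext α β
  simp [matrixBlock, Matrix.one_apply]

end MatrixNorm

/-! ### An orthonormal basis of Hermitian matrices -/

section HermitianBasis

variable {n : ℕ}

/-- The orthonormal basis of the real space of Hermitian matrices dual to `hermitianCoord`. -/
def hermitianBasis (q : Fin n × Fin n) : Matrix (Fin n) (Fin n) ℂ :=
  Matrix.of fun k l =>
    if q.1 = q.2 then (if k = q.1 ∧ l = q.1 then 1 else 0)
    else if q.1 < q.2 then
      ((√2)⁻¹ : ℂ) * ((if k = q.1 ∧ l = q.2 then 1 else 0) + (if k = q.2 ∧ l = q.1 then 1 else 0))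
    else ((√2)⁻¹ * Complex.I : ℂ) *
      ((if k = q.2 ∧ l = q.1 then 1 else 0) - (if k = q.1 ∧ l = q.2 then 1 else 0))

lemma hermitianBasis_isHermitian (q : Fin n × Fin n) : (hermitianBasis q).IsHermitian := by
  ext k l
  simp only [hermitianBasis, Matrix.conjTranspose_apply, Matrix.of_apply]
  split_ifs <;> simp_all

lemma norm_hermitianBasis_le (q : Fin n × Fin n) (k l : Fin n) :
    ‖hermitianBasis q k l‖ ≤ (if q = (k, l) then 1 else 0) + (if q = (l, k) then 1 else 0) := by
  obtain ⟨i, j⟩ := q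
  have h2 : ‖((√2 : ℝ) : ℂ)⁻¹‖ ≤ 1 := by
    rw [norm_inv, Complex.norm_real, Real.norm_of_nonneg (Real.sqrt_nonneg _)]
    exact inv_le_one_of_one_le₀ (Real.one_le_sqrt.2 one_le_two)
  have hite : ∀ (p : Prop) [Decidable p], ‖(if p then (1 : ℂ) else 0)‖ = if p then 1 else 0 := by
    intro p _; split_ifs <;> simp
  have e1 : (if k = i ∧ l = j then (1 : ℝ) else 0) = if ((i, j) : Fin n × Fin n) = (k, l) then 1 else 0 := by
    simp only [Prod.mk.injEq, eq_comm]
  have e2 : (if k = j ∧ l = i then (1 : ℝ) else 0) = if ((i, j) : Fin n × Fin n) = (l, k) then 1 else 0 := by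
    simp only [Prod.mk.injEq, eq_comm, and_comm]
  rw [← e1, ← e2]
  simp only [hermitianBasis, Matrix.of_apply]
  by_cases h1 : i = j
  · subst h1
    rw [if_pos rfl, hite]
    split_ifs <;> norm_num
  · rw [if_neg h1]
    by_cases h3 : i < j
    · rw [if_pos h3, norm_mul]
      try rw [Complex.ofReal_inv]
      refine (mul_le_mul_of_nonneg_right h2 (norm_nonneg _)).trans ?_
      rw [one_mul]
      refine (norm_add_le _ _).trans ?_
      rw [hite, hite]
    · rw [if_neg h3, norm_mul, norm_mul, Complex.norm_I, mul_one]
      try rw [Complex.ofReal_inv]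
      refine (mul_le_mul_of_nonneg_right h2 (norm_nonneg _)).trans ?_
      rw [one_mul]
      refine (norm_sub_le _ _).trans ?_
      rw [hite, hite, add_comm]

lemma sum_hermitianBasis_support {F : Type*} [AddCommMonoid F] (k l : Fin n)
    (f : Fin n × Fin n → F) (hf : ∀ q, q ≠ (k, l) → q ≠ (l, k) → f q = 0) :
    ∑ q, f q = if k = l then f (k, k) else f (k, l) + f (l, k) := by
  split_ifs with h
  · subst h
    exact Finset.sum_eq_single _ (fun q _ hq => hf q hq hq) (by simp)
  · have hne : ((k, l) : Fin n × Fin n) ≠ (l, k) := by simp; tauto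
    rw [← Finset.sum_pair hne]
    symm
    refine Finset.sum_subset (Finset.subset_univ _) fun q _ hq => ?_
    simp only [Finset.mem_insert, Finset.mem_singleton, not_or] at hq
    exact hf q hq.1 hq.2

lemma hermitianBasis_eq_zero (q : Fin n × Fin n) (k l : Fin n) (h1 : q ≠ (k, l))
    (h2 : q ≠ (l, k)) : hermitianBasis q k l = 0 := by
  have := norm_hermitianBasis_le q k l
  simpa [h1, h2] using this

lemma inv_sqrt_two_mul_self : ((√2 : ℝ) : ℂ)⁻¹ * ((√2 : ℝ) : ℂ)⁻¹ = 1 / 2 := by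
  rw [← mul_inv, ← Complex.ofReal_mul, Real.mul_self_sqrt (by norm_num)]
  norm_num

lemma sqrt_two_ne_zero_complex : ((√2 : ℝ) : ℂ) ≠ 0 := by
  simp

/-- Completeness of the basis. Off the diagonal, only the symmetric and antisymmetric matrices
attached to `{k, l}` contribute, namely `(A + B)/2` and `(B - A)/2`; the transposed term `A`
cancels. This is why the covariance of the matrix model is a pure partial trace, with no transpose
term. -/
lemma sum_hermitianBasis_mul (k l l' k' : Fin n) :
    ∑ q, hermitianBasis q k l * hermitianBasis q l' k' = if k = k' ∧ l = l' then 1 else 0 := by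
  rw [sum_hermitianBasis_support k l _ fun q h1 h2 => by
    rw [hermitianBasis_eq_zero q k l h1 h2, zero_mul]]
  have hI := Complex.I_mul_I
  have hs := inv_sqrt_two_mul_self
  have hr : (if k = k' ∧ l = l' then (1 : ℂ) else 0) = if l' = l ∧ k' = k then 1 else 0 := by
    simp only [eq_comm, and_comm]
  rw [hr]
  generalize hB : (if l' = l ∧ k' = k then (1 : ℂ) else 0) = B
  generalize hA : (if l' = k ∧ k' = l then (1 : ℂ) else 0) = A
  rcases lt_trichotomy k l with h | h | h
  · have e1 : hermitianBasis (k, l) k l = (√2)⁻¹ := by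
      simp [hermitianBasis, h.ne, h.ne', h]
    have e2 : hermitianBasis (l, k) k l = (√2)⁻¹ * Complex.I := by
      simp [hermitianBasis, h.ne, h.ne', h.not_gt]
    have e3 : hermitianBasis (k, l) l' k' = ((√2)⁻¹ : ℂ) * (A + B) := by
      simp only [hermitianBasis, Matrix.of_apply, h.ne, h, if_true, if_false, hA, hB]
    have e4 : hermitianBasis (l, k) l' k' = ((√2)⁻¹ * Complex.I : ℂ) * (A - B) := by
      simp only [hermitianBasis, Matrix.of_apply, h.ne', h.not_gt, if_false, hA, hB]
    rw [if_neg h.ne, e1, e2, e3, e4]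
    push_cast
    linear_combination (A + B + Complex.I * Complex.I * (A - B)) * hs + (1 / 2) * (A - B) * hI
  · subst h
    simp [hermitianBasis, hB]
  · have e1 : hermitianBasis (k, l) k l = -((√2)⁻¹ * Complex.I) := by
      simp [hermitianBasis, h.ne, h.ne', h.not_gt]
    have e2 : hermitianBasis (l, k) k l = (√2)⁻¹ := by
      simp [hermitianBasis, h.ne, h.ne', h]
    have e3 : hermitianBasis (k, l) l' k' = ((√2)⁻¹ * Complex.I : ℂ) * (B - A) := by
      simp only [hermitianBasis, Matrix.of_apply, h.ne', h.not_gt, if_false, hA, hB]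
    have e4 : hermitianBasis (l, k) l' k' = ((√2)⁻¹ : ℂ) * (B + A) := by
      simp only [hermitianBasis, Matrix.of_apply, h.ne, h, if_true, if_false, hA, hB]
    rw [if_neg h.ne', e1, e2, e3, e4]
    push_cast
    linear_combination (A + B - Complex.I * Complex.I * (B - A)) * hs + (1 / 2) * (A - B) * hI

lemma sum_hermitianCoord_smul {M : Matrix (Fin n) (Fin n) ℂ} (hM : M.IsHermitian) :
    ∑ q, (hermitianCoord M q : ℂ) • hermitianBasis q = M := by
  ext k l
  rw [Matrix.sum_apply, sum_hermitianBasis_support k l _ fun q h1 h2 => by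
    rw [Matrix.smul_apply, hermitianBasis_eq_zero q k l h1 h2, smul_zero]]
  have hs := sqrt_two_ne_zero_complex
  have hre : ((M l k).re : ℂ) = (M k l).re := by rw [← hM.apply k l]; simp
  have him : ((M l k).im : ℂ) = -(M k l).im := by rw [← hM.apply k l]; simp
  have hd := Complex.re_add_im (M k l)
  split_ifs with h
  · subst h
    have h0 : ((M k k).im : ℂ) = 0 := by linear_combination (1 / 2 : ℂ) * him
    rw [h0] at hd
    simpa [hermitianCoord, hermitianBasis] using hd
  · rcases lt_or_gt_of_ne h with hlt | hlt
    · simp [hermitianCoord, hermitianBasis, h, Ne.symm h, hlt, hlt.not_gt]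
      field_simp
      linear_combination hd
    · simp [hermitianCoord, hermitianBasis, h, Ne.symm h, hlt, hlt.not_gt, hre, him]
      field_simp
      linear_combination hd

end HermitianBasis

/-! ### Resolvents of affine self-adjoint families -/

section AffineResolvent

variable {A : Type*} [CStarAlgebra A] {ι : Type*} [Fintype ι] [DecidableEq ι]

/-- The resolvent `(L - ∑ i, z i • B i)⁻¹`. -/
def affineResolvent (L : A) (B : ι → A) (z : ι → ℝ) : A := Ring.inverse (L - ∑ i, z i • B i)

lemma imaginaryPart_affine {L : A} {B : ι → A} (hB : ∀ i, IsSelfAdjoint (B i)) (z : ι → ℝ) :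
    (ℑ (L - ∑ i, z i • B i) : A) = ℑ L := by
  have : IsSelfAdjoint (∑ i, z i • B i) := by
    refine isSelfAdjoint_sum _ fun i _ => IsSelfAdjoint.smul (IsSelfAdjoint.all _) (hB i)
  rw [map_sub, AddSubgroupClass.coe_sub, this.imaginaryPart]
  simp

variable [PartialOrder A] [StarOrderedRing A]

variable {L : A} {B : ι → A} {c : ℝ}

lemma isUnit_affine (hB : ∀ i, IsSelfAdjoint (B i)) (hc : 0 < c)
    (hL : algebraMap ℝ A c ≤ (ℑ L : A)) (z : ι → ℝ) : IsUnit (L - ∑ i, z i • B i) :=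
  isUnit_of_le_imaginaryPart hc (by rwa [imaginaryPart_affine hB])

lemma norm_affineResolvent_le (hB : ∀ i, IsSelfAdjoint (B i)) (hc : 0 < c)
    (hL : algebraMap ℝ A c ≤ (ℑ L : A)) (z : ι → ℝ) : ‖affineResolvent L B z‖ ≤ c⁻¹ :=
  norm_ringInverse_le hc (by rwa [imaginaryPart_affine hB])

lemma imaginaryPart_affineResolvent_nonpos (hB : ∀ i, IsSelfAdjoint (B i)) (hc : 0 < c)
    (hL : algebraMap ℝ A c ≤ (ℑ L : A)) (z : ι → ℝ) : (ℑ (affineResolvent L B z) : A) ≤ 0 := by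
  refine imaginaryPart_ringInverse_nonpos (isUnit_affine hB hc hL z) ?_
  rw [imaginaryPart_affine hB]
  refine le_trans ?_ hL
  rw [Algebra.algebraMap_eq_smul_one]
  exact smul_nonneg hc.le zero_le_one

lemma continuous_affineResolvent (hB : ∀ i, IsSelfAdjoint (B i)) (hc : 0 < c)
    (hL : algebraMap ℝ A c ≤ (ℑ L : A)) : Continuous (affineResolvent L B) := by
  rw [continuous_iff_continuousAt]
  intro z
  obtain ⟨u, hu⟩ := isUnit_affine hB hc hL z
  have h1 : ContinuousAt Ring.inverse (L - ∑ i, z i • B i) := by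
    rw [← hu]; exact NormedRing.inverse_continuousAt u
  have h2 : Continuous fun z : ι → ℝ => L - ∑ i, z i • B i := by fun_prop
  exact ContinuousAt.comp (f := fun z : ι → ℝ => L - ∑ i, z i • B i) h1 h2.continuousAt

lemma ringInverse_sub_ringInverse {R : Type*} [Ring R] {a b : R} (ha : IsUnit a) (hb : IsUnit b) :
    Ring.inverse a - Ring.inverse b = Ring.inverse b * (b - a) * Ring.inverse a := by
  rw [mul_sub, sub_mul, Ring.inverse_mul_cancel _ hb, mul_assoc, Ring.mul_inverse_cancel _ ha]
  simp

/-- The resolvent identity along one coordinate. It serves both as the expansion behind the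
integration by parts and as the source of the derivative. -/
lemma affineResolvent_update (hB : ∀ i, IsSelfAdjoint (B i)) (hc : 0 < c)
    (hL : algebraMap ℝ A c ≤ (ℑ L : A)) (z : ι → ℝ) (i : ι) (s t : ℝ) :
    affineResolvent L B (Function.update z i t) = affineResolvent L B (Function.update z i s) +
      (t - s) • (affineResolvent L B (Function.update z i s) * B i *
        affineResolvent L B (Function.update z i t)) := by
  rw [← sub_eq_iff_eq_add']
  unfold affineResolvent
  rw [ringInverse_sub_ringInverse (isUnit_affine hB hc hL _) (isUnit_affine hB hc hL _)]
  have : (L - ∑ j, Function.update z i s j • B j) - (L - ∑ j, Function.update z i t j • B j) =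
      (t - s) • B i := by
    rw [sub_sub_sub_cancel_left, ← Finset.sum_sub_distrib, Finset.sum_eq_single i]
    · simp [sub_smul]
    · intro j _ hj; simp [Function.update_of_ne hj]
    · simp
  rw [this, mul_smul_comm, smul_mul_assoc]

/-- By the resolvent identity the difference quotient is exactly `R(t) B R(s)`, and the resolvent is
continuous. -/
lemma hasDerivAt_affineResolvent (hB : ∀ i, IsSelfAdjoint (B i)) (hc : 0 < c)
    (hL : algebraMap ℝ A c ≤ (ℑ L : A)) (z : ι → ℝ) (i : ι) (t : ℝ) :
    HasDerivAt (fun s => affineResolvent L B (Function.update z i s))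
      (affineResolvent L B (Function.update z i t) * B i *
        affineResolvent L B (Function.update z i t)) t := by
  rw [hasDerivAt_iff_tendsto_slope]
  have hcu : Continuous fun s : ℝ => affineResolvent L B (Function.update z i s) :=
    (continuous_affineResolvent hB hc hL).comp (continuous_const.update i continuous_id)
  have h1 : Filter.Tendsto (fun s => affineResolvent L B (Function.update z i t) * B i *
      affineResolvent L B (Function.update z i s)) (nhdsWithin t {t}ᶜ)
      (nhds (affineResolvent L B (Function.update z i t) * B i *
        affineResolvent L B (Function.update z i t))) :=
    ((continuous_const.mul hcu).tendsto t).mono_left nhdsWithin_le_nhds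
  refine h1.congr' ?_
  filter_upwards [self_mem_nhdsWithin] with s hs
  have hne : s - t ≠ 0 := sub_ne_zero.2 hs
  rw [slope_def_module, affineResolvent_update hB hc hL z i t s, add_sub_cancel_left, smul_smul,
    inv_mul_cancel₀ hne, one_smul, ← affineResolvent_update hB hc hL z i t s]

end AffineResolvent

/-! ### The Wigner model in standardized coordinates -/

section WignerResolvent

open scoped MatrixOrder

variable {m n r : ℕ}

/-- The coefficients `a p ⊗ e q / √n` of the normalized Wigner coordinates. -/
def wignerCoeff (n : ℕ) (a : Fin r → Matrix (Fin m) (Fin m) ℂ) (i : Fin r × (Fin n × Fin n)) :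
    Matrix (Fin m × Fin n) (Fin m × Fin n) ℂ :=
  (√(n : ℝ))⁻¹ • (a i.1 ⊗ₖ hermitianBasis i.2)

lemma isSelfAdjoint_wignerCoeff {a : Fin r → Matrix (Fin m) (Fin m) ℂ}
    (ha : ∀ p, (a p).IsHermitian) (i : Fin r × (Fin n × Fin n)) :
    IsSelfAdjoint (wignerCoeff n a i) := by
  refine IsSelfAdjoint.smul (IsSelfAdjoint.all _) ?_
  rw [isSelfAdjoint_iff, Matrix.star_eq_conjTranspose, Matrix.conjTranspose_kronecker,
    (ha _).eq, (hermitianBasis_isHermitian _).eq]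

lemma wignerCoeff_apply (a : Fin r → Matrix (Fin m) (Fin m) ℂ) (i : Fin r × (Fin n × Fin n))
    (α β : Fin m × Fin n) : wignerCoeff n a i α β =
      ((√(n : ℝ))⁻¹ : ℝ) * (a i.1 α.1 β.1 * hermitianBasis i.2 α.2 β.2) := rfl

/-- The sum of the absolute values of the entries. -/
def entrySum (c : Matrix (Fin m) (Fin m) ℂ) : ℝ := ∑ i, ∑ j, ‖c i j‖

lemma entrySum_nonneg (c : Matrix (Fin m) (Fin m) ℂ) : 0 ≤ entrySum c := by
  unfold entrySum; positivity

lemma sum_sum_norm_hermitianBasis_le (q : Fin n × Fin n) :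
    ∑ k, ∑ l, ‖hermitianBasis q k l‖ ≤ 2 := by
  refine (Finset.sum_le_sum fun k _ => Finset.sum_le_sum fun l _ =>
    norm_hermitianBasis_le q k l).trans (le_of_eq ?_)
  obtain ⟨i, j⟩ := q
  simp only [Finset.sum_add_distrib, Prod.mk.injEq, ite_and]
  have h2 : ∑ x : Fin n, ∑ x_1 : Fin n, (if i = x_1 then if j = x then (1 : ℝ) else 0 else 0) = 1 := by
    rw [Finset.sum_comm]; simp
  simp only [h2]
  simp
  norm_num

/-- Only `O(n)` of the `n²` basis matrices have a nonzero `k`-th row. This saves the factor `n`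
needed when the integration by parts errors are summed. -/
lemma sum_norm_hermitianBasis_row_le (k : Fin n) :
    ∑ q, ∑ l, ‖hermitianBasis q k l‖ ≤ 2 * n := by
  refine (Finset.sum_le_sum fun k _ => Finset.sum_le_sum fun l _ =>
    norm_hermitianBasis_le _ _ l).trans (le_of_eq ?_)
  rw [Finset.sum_comm]
  simp [Finset.sum_add_distrib]
  ring

lemma norm_wignerCoeff_le (a : Fin r → Matrix (Fin m) (Fin m) ℂ) (i : Fin r × (Fin n × Fin n)) :
    ‖wignerCoeff n a i‖ ≤ (√(n : ℝ))⁻¹ * (2 * entrySum (a i.1)) := by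
  unfold wignerCoeff
  rw [norm_smul, Real.norm_of_nonneg (by positivity)]
  gcongr
  refine (norm_le_sum_norm _).trans ?_
  calc _ = entrySum (a i.1) * ∑ k, ∑ l, ‖hermitianBasis i.2 k l‖ := by
        unfold entrySum
        rw [Fintype.sum_prod_type, Finset.sum_mul_sum]
        refine Finset.sum_congr rfl fun α _ => Finset.sum_congr rfl fun k _ => ?_
        rw [Fintype.sum_prod_type, Finset.sum_mul_sum]
        simp only [Matrix.kroneckerMap_apply, norm_mul]
    _ ≤ entrySum (a i.1) * 2 := by
        gcongr
        · exact entrySum_nonneg _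
        · exact sum_sum_norm_hermitianBasis_le _
    _ = _ := by ring

lemma norm_le_entrySum (c : Matrix (Fin m) (Fin m) ℂ) : ‖c‖ ≤ entrySum c := norm_le_sum_norm c

/-- The factor `√n` moves from the coefficients to the coordinates, so that the latter have law `μ`
itself, independently of `n`. -/
lemma matrixPencil_eq (a₀ : Matrix (Fin m) (Fin m) ℂ)
    (a : Fin r → Matrix (Fin m) (Fin m) ℂ) {Y : Fin r → Matrix (Fin n) (Fin n) ℂ}
    (hY : ∀ p, (Y p).IsHermitian) (l : Matrix (Fin m) (Fin m) ℂ) (hn : 1 ≤ n) :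
    matrixPencil a₀ a Y l = (l - a₀) ⊗ₖ (1 : Matrix (Fin n) (Fin n) ℂ) -
      ∑ i, (√(n : ℝ) * hermitianCoord (Y i.1) i.2) • wignerCoeff n a i := by
  have hn0 : √(n : ℝ) ≠ 0 := by
    have : (0 : ℝ) < n := by exact_mod_cast hn
    positivity
  have h : ∀ p, a p ⊗ₖ Y p =
      ∑ q, (√(n : ℝ) * hermitianCoord (Y p) q) • wignerCoeff n a (p, q) := by
    intro p
    conv_lhs => rw [← sum_hermitianCoord_smul (hY p)]
    ext ⟨α, k⟩ ⟨β, l⟩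
    simp only [Matrix.kroneckerMap_apply, Matrix.sum_apply, Finset.mul_sum, Matrix.smul_apply,
      wignerCoeff, smul_smul]
    refine Finset.sum_congr rfl fun q _ => ?_
    rw [mul_comm (√(n : ℝ)), mul_assoc, mul_inv_cancel₀ hn0, mul_one]
    simp only [smul_eq_mul, Complex.real_smul]
    ring
  unfold matrixPencil
  rw [Fintype.sum_prod_type, sub_add_eq_sub_sub]
  congr 1
  · ext ⟨α, k⟩ ⟨β, l⟩
    simp [sub_mul]
  · exact Finset.sum_congr rfl fun p _ => h p

lemma le_imaginaryPart_kronecker_one {c : ℝ} {L : Matrix (Fin m) (Fin m) ℂ}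
    (hL : algebraMap ℝ _ c ≤ (ℑ L : Matrix (Fin m) (Fin m) ℂ)) :
    algebraMap ℝ _ c ≤ (ℑ (L ⊗ₖ (1 : Matrix (Fin n) (Fin n) ℂ)) :
      Matrix (Fin m × Fin n) (Fin m × Fin n) ℂ) := by
  have h1 : (ℑ (L ⊗ₖ (1 : Matrix (Fin n) (Fin n) ℂ)) :
      Matrix (Fin m × Fin n) (Fin m × Fin n) ℂ) =
      (ℑ L : Matrix (Fin m) (Fin m) ℂ) ⊗ₖ (1 : Matrix (Fin n) (Fin n) ℂ) := by
    apply imaginaryPart_eq_of_sub_star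
    rw [Matrix.star_eq_conjTranspose, Matrix.conjTranspose_kronecker, Matrix.conjTranspose_one,
      ← Matrix.smul_kronecker, two_I_smul_imaginaryPart, Matrix.star_eq_conjTranspose]
    ext ⟨α, k⟩ ⟨β, l⟩
    simp [sub_mul]
  rw [h1, Matrix.le_iff]
  have h2 := (Matrix.le_iff.1 hL).kronecker (Matrix.PosSemidef.one (n := Fin n) (R := ℂ))
  convert h2 using 1
  ext ⟨α, k⟩ ⟨β, l⟩
  simp only [Matrix.sub_apply, Matrix.kroneckerMap_apply, sub_mul]
  congr 1
  simp [Algebra.algebraMap_eq_smul_one, Matrix.one_apply, Prod.ext_iff, ite_and]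
  split_ifs <;> rfl

/-- `∑ i, B i * M * B i = η(tr M) ⊗ 1` for the Wigner coefficients `B`. -/
lemma sum_wignerCoeff_mul_mul (hn : 1 ≤ n) (a : Fin r → Matrix (Fin m) (Fin m) ℂ)
    (M : Matrix (Fin m × Fin n) (Fin m × Fin n) ℂ) :
    ∑ i, wignerCoeff n a i * M * wignerCoeff n a i =
      covarianceMap a ((n : ℝ)⁻¹ • ∑ k, matrixBlock M k k) ⊗ₖ (1 : Matrix (Fin n) (Fin n) ℂ) := by
  have hnn : ((√(n : ℝ))⁻¹ : ℝ) * (√(n : ℝ))⁻¹ = (n : ℝ)⁻¹ := by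
    rw [← mul_inv, Real.mul_self_sqrt (by positivity)]
  rw [Fintype.sum_prod_type, covarianceMap_apply]
  ext ⟨α, k⟩ ⟨β, l⟩
  rw [Matrix.kroneckerMap_apply, Matrix.sum_apply, Matrix.sum_apply, Finset.sum_mul]
  refine Finset.sum_congr rfl fun p _ => ?_
  have h1 : (∑ q, wignerCoeff n a (p, q) * M * wignerCoeff n a (p, q)) (α, k) (β, l) =
      ∑ x, ∑ y, ((n : ℝ)⁻¹ : ℝ) * (a p α y.1 * M y x * a p x.1 β) *
        ∑ q, hermitianBasis q k y.2 * hermitianBasis q x.2 l := by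
    simp only [Matrix.sum_apply, Matrix.mul_apply, wignerCoeff_apply, Finset.sum_mul,
      Finset.mul_sum]
    rw [Finset.sum_comm]
    refine Finset.sum_congr rfl fun x _ => ?_
    rw [Finset.sum_comm]
    refine Finset.sum_congr rfl fun y _ => Finset.sum_congr rfl fun q _ => ?_
    rw [← hnn]
    push_cast
    ring
  rw [h1]
  -- Completeness forces `k = l` and contracts the inner indices of `M` into the partial trace.
  simp only [sum_hermitianBasis_mul]
  simp only [Fintype.sum_prod_type, ite_and, Matrix.mul_apply,
    Matrix.smul_apply, Matrix.sum_apply, matrixBlock, Matrix.of_apply, Complex.real_smul,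
    Matrix.one_apply]
  by_cases hkl : k = l
  · simp only [hkl, if_true, mul_ite, mul_one, mul_zero, Finset.sum_ite_eq',
      Finset.mem_univ, Finset.sum_mul, Finset.mul_sum]
    refine Finset.sum_congr rfl fun x _ => ?_
    rw [Finset.sum_comm]
    refine Finset.sum_congr rfl fun y _ => Finset.sum_congr rfl fun j _ => ?_
    ring
  · simp [hkl]

end WignerResolvent

/-! ### Dimension-free gradient bound for resolvent entries -/

section GradientBound

variable {m n r : ℕ}

lemma norm_sum_hermitianBasis_mul_sq_le (q : Fin n × Fin n) (Y : Fin n → Fin n → ℂ) :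
    ‖∑ i, ∑ j, hermitianBasis q i j * Y i j‖ ^ 2 ≤ 2 * (‖Y q.1 q.2‖ ^ 2 + ‖Y q.2 q.1‖ ^ 2) := by
  have h : ‖∑ i, ∑ j, hermitianBasis q i j * Y i j‖ ≤ ‖Y q.1 q.2‖ + ‖Y q.2 q.1‖ := by
    calc _ ≤ ∑ i, ∑ j, ((if q = (i, j) then 1 else 0) + (if q = (j, i) then 1 else 0)) * ‖Y i j‖ := by
          refine (norm_sum_le _ _).trans (Finset.sum_le_sum fun i _ => ?_)
          refine (norm_sum_le _ _).trans (Finset.sum_le_sum fun j _ => ?_)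
          rw [norm_mul]
          gcongr
          exact norm_hermitianBasis_le q i j
      _ = _ := by
          obtain ⟨k, l⟩ := q
          simp only [add_mul, ite_mul, one_mul, zero_mul, Finset.sum_add_distrib, Prod.mk.injEq,
            ite_and]
          congr 1
          · simp
          · rw [Finset.sum_comm]; simp
  refine (pow_le_pow_left₀ (norm_nonneg _) h 2).trans ?_
  nlinarith [sq_nonneg (‖Y q.1 q.2‖ - ‖Y q.2 q.1‖)]

/-- The squared Frobenius norm. -/
def frobeniusSq (c : Matrix (Fin m) (Fin m) ℂ) : ℝ := ∑ i, ∑ j, ‖c i j‖ ^ 2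

lemma frobeniusSq_nonneg (c : Matrix (Fin m) (Fin m) ℂ) : 0 ≤ frobeniusSq c := by
  unfold frobeniusSq; positivity

/-- The entry is the pairing of the basis matrix with an array `Y` built from one row and one column
of `M`. Cauchy–Schwarz over the `m × m` indices separates that row from that column, and each has
squared length at most `‖M‖²`. Hence the sum over all `n²` basis matrices is bounded independently
of `n`. -/
lemma sum_norm_mul_hermitianBasis_mul_sq_le (c : Matrix (Fin m) (Fin m) ℂ)
    (M : Matrix (Fin m × Fin n) (Fin m × Fin n) ℂ) (x y : Fin m × Fin n) :
    ∑ q, ‖(M * (c ⊗ₖ hermitianBasis q) * M : Matrix (Fin m × Fin n) (Fin m × Fin n) ℂ) x y‖ ^ 2 ≤ 4 * frobeniusSq c * ‖M‖ ^ 4 := by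
  set Y : Fin n → Fin n → ℂ := fun i j => ∑ g : Fin m × Fin m,
    c g.1 g.2 * (M x (g.1, i) * M (g.2, j) y) with hY
  have h1 : ∀ q, (M * (c ⊗ₖ hermitianBasis q) * M : Matrix (Fin m × Fin n) (Fin m × Fin n) ℂ) x y =
      ∑ i, ∑ j, hermitianBasis q i j * Y i j := by
    intro q
    simp only [hY, Matrix.mul_apply, Matrix.kroneckerMap_apply, Finset.sum_mul, Finset.mul_sum,
      Fintype.sum_prod_type]
    rw [Finset.sum_comm]
    conv_lhs => enter [2, j]; rw [Finset.sum_comm]; enter [2, γ]; rw [Finset.sum_comm]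
    rw [Finset.sum_comm]
    conv_lhs => enter [2, γ]; rw [Finset.sum_comm]
    rw [Finset.sum_comm]
    refine Finset.sum_congr rfl fun i _ => ?_
    rw [Finset.sum_comm]
    refine Finset.sum_congr rfl fun j _ => Finset.sum_congr rfl fun γ _ =>
      Finset.sum_congr rfl fun δ _ => ?_
    ring
  have h2 : ∀ i j, ‖Y i j‖ ^ 2 ≤ frobeniusSq c *
      ((∑ γ, ‖M x (γ, i)‖ ^ 2) * ∑ δ, ‖M (δ, j) y‖ ^ 2) := by
    intro i j
    have e1 : ‖Y i j‖ ≤ ∑ g : Fin m × Fin m, ‖c g.1 g.2‖ * (‖M x (g.1, i)‖ * ‖M (g.2, j) y‖) := by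
      refine (norm_sum_le _ _).trans (le_of_eq ?_)
      simp only [norm_mul]
    refine (pow_le_pow_left₀ (norm_nonneg _) e1 2).trans
      ((Finset.sum_mul_sq_le_sq_mul_sq _ _ _).trans (le_of_eq ?_))
    congr 1
    · exact Fintype.sum_prod_type' (fun i j => ‖c i j‖ ^ 2)
    · rw [Finset.sum_mul_sum]
      simp only [mul_pow]
      exact Fintype.sum_prod_type' (fun k l => ‖M x (k, i)‖ ^ 2 * ‖M (l, j) y‖ ^ 2)
  have h3 : ∑ q, ‖(M * (c ⊗ₖ hermitianBasis q) * M : Matrix (Fin m × Fin n) (Fin m × Fin n) ℂ) x y‖ ^ 2 ≤ 4 * ∑ i, ∑ j, ‖Y i j‖ ^ 2 := by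
    calc _ ≤ ∑ q : Fin n × Fin n, 2 * (‖Y q.1 q.2‖ ^ 2 + ‖Y q.2 q.1‖ ^ 2) :=
          Finset.sum_le_sum fun q _ => by
            rw [h1]; exact norm_sum_hermitianBasis_mul_sq_le q Y
      _ = _ := by
          rw [← Finset.mul_sum, Finset.sum_add_distrib, Fintype.sum_prod_type,
            Fintype.sum_prod_type]
          simp only
          rw [Finset.sum_comm (f := fun i j => ‖Y j i‖ ^ 2)]
          ring
  have h4 : ∑ i, ∑ j, ‖Y i j‖ ^ 2 ≤ frobeniusSq c * ‖M‖ ^ 4 := by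
    calc _ ≤ ∑ i, ∑ j, frobeniusSq c *
          ((∑ γ, ‖M x (γ, i)‖ ^ 2) * ∑ δ, ‖M (δ, j) y‖ ^ 2) :=
          Finset.sum_le_sum fun i _ => Finset.sum_le_sum fun j _ => h2 i j
      _ = frobeniusSq c * ((∑ w, ‖M x w‖ ^ 2) * ∑ w, ‖M w y‖ ^ 2) := by
          simp only [← Finset.mul_sum]
          rw [← Finset.sum_mul, Fintype.sum_prod_type_right, Fintype.sum_prod_type_right]
      _ ≤ frobeniusSq c * (‖M‖ ^ 2 * ‖M‖ ^ 2) := by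
          gcongr
          · exact frobeniusSq_nonneg c
          · exact sum_norm_sq_row_le M x
          · exact sum_norm_sq_col_le M y
      _ = _ := by ring
  linarith

lemma sum_norm_mul_wignerCoeff_mul_sq_le (a : Fin r → Matrix (Fin m) (Fin m) ℂ)
    (M : Matrix (Fin m × Fin n) (Fin m × Fin n) ℂ) (x y : Fin m × Fin n) :
    ∑ i, ‖(M * wignerCoeff n a i * M) x y‖ ^ 2 ≤
      4 * (∑ p, frobeniusSq (a p)) * ‖M‖ ^ 4 / n := by
  have h : ∀ i, ‖(M * wignerCoeff n a i * M) x y‖ ^ 2 =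
      (n : ℝ)⁻¹ * ‖(M * (a i.1 ⊗ₖ hermitianBasis i.2) * M) x y‖ ^ 2 := by
    intro i
    rw [wignerCoeff, mul_smul_comm, smul_mul_assoc, Matrix.smul_apply, norm_smul, mul_pow,
      Real.norm_eq_abs, sq_abs, inv_pow, Real.sq_sqrt (by positivity)]
  simp_rw [h]
  rw [← Finset.mul_sum, div_eq_inv_mul]
  gcongr
  calc _ = ∑ p, ∑ q, ‖(M * (a p ⊗ₖ hermitianBasis q) * M : Matrix (Fin m × Fin n) (Fin m × Fin n) ℂ) x y‖ ^ 2 :=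
        Fintype.sum_prod_type' (fun p q => ‖(M * (a p ⊗ₖ hermitianBasis q) * M : Matrix (Fin m × Fin n) (Fin m × Fin n) ℂ) x y‖ ^ 2)
    _ ≤ ∑ p, 4 * frobeniusSq (a p) * ‖M‖ ^ 4 :=
        Finset.sum_le_sum fun p _ => sum_norm_mul_hermitianBasis_mul_sq_le (a p) M x y
    _ = _ := by rw [← Finset.sum_mul, ← Finset.mul_sum]

end GradientBound

/-! ### Variance of the resolvent entries -/

section WignerEstimates

open scoped MatrixOrder

/-- The consequences of symmetry, unit variance and the Poincaré inequality that are used. -/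
structure IsPoincareLaw (μ : Measure ℝ) (C : ℝ) : Prop where
  mean : ∫ t, t ∂μ = 0
  second : ∫ t, t ^ 2 ∂μ = 1
  third : ∫ t, t ^ 3 ∂μ = 0
  integrable_id : Integrable (fun t : ℝ => t) μ
  integrable_four : Integrable (fun t : ℝ => t ^ 4) μ
  pos : 0 < C
  poincare : ∀ f : ℝ → ℂ, ContDiff ℝ 1 f → MemLp f 2 μ → MemLp (deriv f) 2 μ →
    ∫ x, ‖f x - ∫ y, f y ∂μ‖ ^ 2 ∂μ ≤ C * ∫ x, ‖deriv f x‖ ^ 2 ∂μ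

lemma exists_isPoincareLaw {μ : Measure ℝ} [IsProbabilityMeasure μ]
    (hsymm : IsSymmetricLaw μ) (hvar : variance id μ = 1) (hpoin : SatisfiesPoincare μ) :
    ∃ C, IsPoincareLaw μ C := by
  have h4 := integrable_pow_four_of_poincare hsymm hvar hpoin
  obtain ⟨C, hC, hP⟩ := hpoin
  exact ⟨C, integral_odd_eq_zero hsymm measurable_id (by simp), integral_sq_eq_one hsymm hvar,
    integral_odd_eq_zero hsymm (f := fun t => t ^ 3) (by fun_prop) (fun x => by ring),
    (memLp_id_two_of_variance_eq_one hvar).integrable one_le_two, h4, hC, hP⟩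

variable {μ : Measure ℝ} [IsProbabilityMeasure μ] {C : ℝ} {m n r : ℕ}
  {L : Matrix (Fin m) (Fin m) ℂ} {a : Fin r → Matrix (Fin m) (Fin m) ℂ} {c : ℝ}

/-- The resolvent of a Wigner matrix model in terms of the normalized coordinates. -/
def wignerResolvent (n : ℕ) (L : Matrix (Fin m) (Fin m) ℂ)
    (a : Fin r → Matrix (Fin m) (Fin m) ℂ) (z : Fin r × (Fin n × Fin n) → ℝ) :
    Matrix (Fin m × Fin n) (Fin m × Fin n) ℂ :=
  affineResolvent (L ⊗ₖ (1 : Matrix (Fin n) (Fin n) ℂ)) (wignerCoeff n a) z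

lemma norm_wignerResolvent_le (ha : ∀ p, (a p).IsHermitian) (hc : 0 < c)
    (hL : algebraMap ℝ _ c ≤ (ℑ L : Matrix (Fin m) (Fin m) ℂ)) (z) :
    ‖wignerResolvent n L a z‖ ≤ c⁻¹ :=
  norm_affineResolvent_le (isSelfAdjoint_wignerCoeff ha) hc (le_imaginaryPart_kronecker_one hL) z

lemma continuous_wignerResolvent (ha : ∀ p, (a p).IsHermitian) (hc : 0 < c)
    (hL : algebraMap ℝ _ c ≤ (ℑ L : Matrix (Fin m) (Fin m) ℂ)) :
    Continuous (wignerResolvent n L a) :=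
  continuous_affineResolvent (isSelfAdjoint_wignerCoeff ha) hc (le_imaginaryPart_kronecker_one hL)

/-- The partial derivatives of an entry are the entries of `-` or `+` one common form `R B_i R`,
here with sign `+`. The gradient bound, with the factor `1/n` coming from `B_i`, feeds the
tensorized Poincaré inequality. -/
lemma integral_norm_entry_sub_sq_le (hμ : IsPoincareLaw μ C) (ha : ∀ p, (a p).IsHermitian)
    (hc : 0 < c) (hL : algebraMap ℝ _ c ≤ (ℑ L : Matrix (Fin m) (Fin m) ℂ))
    (x y : Fin m × Fin n) :
    ∫ z, ‖wignerResolvent n L a z x y - ∫ w, wignerResolvent n L a w x y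
      ∂(Measure.pi fun _ => μ)‖ ^ 2 ∂(Measure.pi fun _ => μ) ≤
      C * (4 * (∑ p, frobeniusSq (a p)) * c⁻¹ ^ 4 / n) := by
  have hB := isSelfAdjoint_wignerCoeff (n := n) ha
  have hL' := le_imaginaryPart_kronecker_one (n := n) hL
  have hR := continuous_wignerResolvent (n := n) ha hc hL
  have hRb := norm_wignerResolvent_le (n := n) ha hc hL
  have hent : ∀ w : (Fin r × (Fin n × Fin n) → ℝ) → Matrix (Fin m × Fin n) (Fin m × Fin n) ℂ,
      Continuous w → Continuous fun z => w z x y := fun w hw =>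
    (entryL x y).continuous.comp hw
  set R := wignerResolvent n L a with hRdef
  set f' : Fin r × (Fin n × Fin n) → (Fin r × (Fin n × Fin n) → ℝ) → ℂ := fun i z =>
    (R z * wignerCoeff n a i * R z) x y
  have hsum : ∀ z, ∑ i, ‖f' i z‖ ^ 2 ≤ 4 * (∑ p, frobeniusSq (a p)) * c⁻¹ ^ 4 / n := by
    intro z
    refine (sum_norm_mul_wignerCoeff_mul_sq_le a (R z) x y).trans ?_
    have := hRb z
    have h0 : 0 ≤ ∑ p, frobeniusSq (a p) := Finset.sum_nonneg fun p _ => frobeniusSq_nonneg _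
    gcongr
  -- The tensorized inequality only asks for some uniform bound on each partial derivative; the
  -- bound on the full gradient supplies one.
  have hd : ∀ i z, ‖f' i z‖ ≤ √(4 * (∑ p, frobeniusSq (a p)) * c⁻¹ ^ 4 / n) := by
    intro i z
    refine Real.le_sqrt_of_sq_le (le_trans ?_ (hsum z))
    exact Finset.single_le_sum (f := fun i => ‖f' i z‖ ^ 2) (fun i _ => by positivity)
      (Finset.mem_univ i)
  have key := integral_norm_sub_sq_le_of_poincare hμ.poincare (f := fun z => R z x y) (f' := f')
    (hent _ hR) (fun z => (norm_entry_le _ _ _).trans (hRb z))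
    (fun i => hent _ ((hR.mul continuous_const).mul hR)) hd
    (fun i z t => (entryL x y).hasFDerivAt.comp_hasDerivAt t
      (hasDerivAt_affineResolvent hB hc hL' z i t))
  refine key.trans (mul_le_mul_of_nonneg_left ?_ hμ.pos.le)
  have := integral_mono_of_nonneg (μ := Measure.pi fun _ : Fin r × (Fin n × Fin n) => μ)
    (Filter.Eventually.of_forall fun z => Finset.sum_nonneg fun i _ => sq_nonneg ‖f' i z‖)
    (integrable_const _) (Filter.Eventually.of_forall hsum)
  simpa using this

end WignerEstimates

/-! ### Factorization of expectations under small variance -/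

section Decorrelation

variable {Ω : Type*} [MeasurableSpace Ω] {ρ : Measure Ω} [IsProbabilityMeasure ρ]
  {A : Type*} [NormedRing A] [NormedAlgebra ℝ A] [CompleteSpace A]

/-- The difference is the covariance `E[φ(F - EF)(G - EG)]`, bounded by an arithmetic-geometric
inequality. The linear map `φ` covers both uses: `φ = η` for the Dyson equation and right
multiplication by `b` for the final quantity. -/
lemma norm_integral_mul_sub_le {F G : Ω → A} {f g κ : ℝ} (φ : A →L[ℝ] A) (hφ : ∀ M, ‖φ M‖ ≤ κ * ‖M‖)
    (hκ : 0 ≤ κ) (hF : StronglyMeasurable F) (hG : StronglyMeasurable G) (hf : ∀ z, ‖F z‖ ≤ f)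
    (hg : ∀ z, ‖G z‖ ≤ g) :
    ‖∫ z, φ (F z) * G z ∂ρ - φ (∫ z, F z ∂ρ) * ∫ z, G z ∂ρ‖ ≤
      κ * (∫ z, ‖F z - ∫ w, F w ∂ρ‖ ^ 2 ∂ρ + ∫ z, ‖G z - ∫ w, G w ∂ρ‖ ^ 2 ∂ρ) := by
  set EF := ∫ w, F w ∂ρ with hEF
  set EG := ∫ w, G w ∂ρ with hEG
  have iF : Integrable F ρ := integrable_of_bounded hF hf
  have iG : Integrable G ρ := integrable_of_bounded hG hg
  have iφ : Integrable (fun z => φ (F z)) ρ := φ.integrable_comp iF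
  have sφ : StronglyMeasurable fun z => φ (F z) := φ.continuous.comp_stronglyMeasurable hF
  have bφ : ∀ z, ‖φ (F z)‖ ≤ κ * f := fun z =>
    (hφ _).trans (mul_le_mul_of_nonneg_left (hf z) hκ)
  have iFG : Integrable (fun z => φ (F z) * G z) ρ := by
    refine integrable_of_bounded (c := κ * f * g) (sφ.mul hG) fun z => ?_
    exact (norm_mul_le _ _).trans (mul_le_mul (bφ z) (hg z) (norm_nonneg _)
      ((norm_nonneg _).trans (bφ z)))
  have eφ : ∫ z, φ (F z) ∂ρ = φ EF := φ.integral_comp_comm iF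
  have key : ∫ z, φ (F z) * G z ∂ρ - φ EF * EG = ∫ z, φ (F z - EF) * (G z - EG) ∂ρ := by
    have : ∀ z, φ (F z - EF) * (G z - EG) =
        φ (F z) * G z - φ EF * G z - (φ (F z) * EG - φ EF * EG) := by
      intro z; rw [map_sub, sub_mul, mul_sub, mul_sub]; abel
    simp_rw [this]
    rw [integral_sub (by exact iFG.sub (iG.const_mul _))
      (by exact (iφ.mul_const _).sub (integrable_const _)), integral_sub iFG (iG.const_mul _),
      integral_sub (iφ.mul_const _) (integrable_const _), integral_const_mul_of_integrable iG,
      integral_mul_const_of_integrable iφ, eφ, ← hEG]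
    simp
  rw [key]
  have i1 : Integrable (fun z => ‖F z - EF‖ ^ 2) ρ :=
    integrable_norm_sq_of_bounded (hF.sub stronglyMeasurable_const) (c := f + ‖EF‖) fun z =>
      (norm_sub_le _ _).trans (by gcongr; exact hf z)
  have i2 : Integrable (fun z => ‖G z - EG‖ ^ 2) ρ :=
    integrable_norm_sq_of_bounded (hG.sub stronglyMeasurable_const) (c := g + ‖EG‖) fun z =>
      (norm_sub_le _ _).trans (by gcongr; exact hg z)
  rw [← integral_add i1 i2, ← integral_const_mul]
  refine norm_integral_le_of_norm_le ((i1.add i2).const_mul κ) (Filter.Eventually.of_forall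
    fun z => ?_)
  refine (norm_mul_le _ _).trans ?_
  calc _ ≤ κ * ‖F z - EF‖ * ‖G z - EG‖ := by gcongr; exact hφ _
    _ = κ * (‖F z - EF‖ * ‖G z - EG‖) := by ring
    _ ≤ _ := by
        gcongr
        nlinarith [sq_nonneg (‖F z - EF‖ - ‖G z - EG‖), sq_nonneg ‖F z - EF‖,
          sq_nonneg ‖G z - EG‖]

end Decorrelation

/-! ### Diagonal blocks: bounds, imaginary parts and variance -/

section BlockEstimates

open scoped MatrixOrder

variable {μ : Measure ℝ} [IsProbabilityMeasure μ] {C : ℝ} {m n r : ℕ}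
  {L : Matrix (Fin m) (Fin m) ℂ} {a : Fin r → Matrix (Fin m) (Fin m) ℂ} {c : ℝ}

/-- The diagonal blocks of the Wigner resolvent. -/
def resolventBlock (n : ℕ) (L : Matrix (Fin m) (Fin m) ℂ)
    (a : Fin r → Matrix (Fin m) (Fin m) ℂ) (k : Fin n) (z : Fin r × (Fin n × Fin n) → ℝ) :
    Matrix (Fin m) (Fin m) ℂ :=
  matrixBlock (wignerResolvent n L a z) k k

/-- The expected diagonal blocks of the Wigner resolvent. -/
def meanBlock (μ : Measure ℝ) (n : ℕ) (L : Matrix (Fin m) (Fin m) ℂ)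
    (a : Fin r → Matrix (Fin m) (Fin m) ℂ) (k : Fin n) : Matrix (Fin m) (Fin m) ℂ :=
  ∫ z, resolventBlock n L a k z ∂(Measure.pi fun _ => μ)

/-- The expected normalized partial trace of the Wigner resolvent. -/
def meanTrace (μ : Measure ℝ) (n : ℕ) (L : Matrix (Fin m) (Fin m) ℂ)
    (a : Fin r → Matrix (Fin m) (Fin m) ℂ) : Matrix (Fin m) (Fin m) ℂ :=
  (n : ℝ)⁻¹ • ∑ k, meanBlock μ n L a k

lemma continuous_resolventBlock (ha : ∀ p, (a p).IsHermitian) (hc : 0 < c)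
    (hL : algebraMap ℝ _ c ≤ (ℑ L : Matrix (Fin m) (Fin m) ℂ)) (k : Fin n) :
    Continuous (resolventBlock n L a k) :=
  (matrixBlockL k k).continuous.comp (continuous_wignerResolvent ha hc hL)

lemma norm_resolventBlock_le (ha : ∀ p, (a p).IsHermitian) (hc : 0 < c)
    (hL : algebraMap ℝ _ c ≤ (ℑ L : Matrix (Fin m) (Fin m) ℂ)) (k : Fin n) (z) :
    ‖resolventBlock n L a k z‖ ≤ (m : ℝ) ^ 2 * c⁻¹ :=
  (norm_matrixBlock_le _ _ _).trans
    (mul_le_mul_of_nonneg_left (norm_wignerResolvent_le ha hc hL z) (by positivity))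

lemma norm_meanBlock_le (ha : ∀ p, (a p).IsHermitian) (hc : 0 < c)
    (hL : algebraMap ℝ _ c ≤ (ℑ L : Matrix (Fin m) (Fin m) ℂ)) (k : Fin n) :
    ‖meanBlock μ n L a k‖ ≤ (m : ℝ) ^ 2 * c⁻¹ := by
  have := norm_integral_le_of_norm_le_const
    (μ := Measure.pi fun _ : Fin r × (Fin n × Fin n) => μ)
    (Filter.Eventually.of_forall (norm_resolventBlock_le ha hc hL k))
  simpa [meanBlock] using this

lemma integrable_resolventBlock (ha : ∀ p, (a p).IsHermitian) (hc : 0 < c)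
    (hL : algebraMap ℝ _ c ≤ (ℑ L : Matrix (Fin m) (Fin m) ℂ)) (k : Fin n) :
    Integrable (resolventBlock n L a k) (Measure.pi fun _ => μ) :=
  integrable_of_bounded (continuous_resolventBlock ha hc hL k).stronglyMeasurable
    (norm_resolventBlock_le ha hc hL k)

lemma imaginaryPart_matrixBlock_nonpos {M : Matrix (Fin m × Fin n) (Fin m × Fin n) ℂ}
    (hM : (ℑ M : Matrix (Fin m × Fin n) (Fin m × Fin n) ℂ) ≤ 0) (k : Fin n) :
    (ℑ (matrixBlock M k k) : Matrix (Fin m) (Fin m) ℂ) ≤ 0 := by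
  have h1 := (Matrix.le_iff.1 hM).submatrix (fun α : Fin m => (α, k))
  rw [Matrix.le_iff]
  convert h1 using 1
  rw [zero_sub, zero_sub, Matrix.submatrix_neg]
  refine congrArg Neg.neg (imaginaryPart_eq_of_sub_star ?_)
  have := two_I_smul_imaginaryPart M
  ext α β
  have h2 := congrFun (congrFun this (α, k)) (β, k)
  simpa [matrixBlock] using h2.symm

lemma convex_imaginaryPart_nonpos :
    Convex ℝ {M : Matrix (Fin m) (Fin m) ℂ | (ℑ M : Matrix (Fin m) (Fin m) ℂ) ≤ 0} := by
  intro x hx y hy s t hs ht _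
  simp only [Set.mem_ofPred_eq, map_add, map_smul, AddSubgroup.coe_add, selfAdjoint.val_smul] at *
  exact add_nonpos (smul_nonpos_of_nonneg_of_nonpos hs hx) (smul_nonpos_of_nonneg_of_nonpos ht hy)

lemma isClosed_imaginaryPart_nonpos :
    IsClosed {M : Matrix (Fin m) (Fin m) ℂ | (ℑ M : Matrix (Fin m) (Fin m) ℂ) ≤ 0} := by
  refine isClosed_le ?_ continuous_const
  simp only [imaginaryPart_apply_coe]
  fun_prop

/-- Nonpositivity of the imaginary part passes from the resolvent to its diagonal blocks, and to
their expectation because the condition is closed and convex. -/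
lemma imaginaryPart_meanBlock_nonpos (ha : ∀ p, (a p).IsHermitian) (hc : 0 < c)
    (hL : algebraMap ℝ _ c ≤ (ℑ L : Matrix (Fin m) (Fin m) ℂ)) (k : Fin n) :
    (ℑ (meanBlock μ n L a k) : Matrix (Fin m) (Fin m) ℂ) ≤ 0 :=
  convex_imaginaryPart_nonpos.integral_mem isClosed_imaginaryPart_nonpos
    (Filter.Eventually.of_forall fun z => imaginaryPart_matrixBlock_nonpos
      (imaginaryPart_affineResolvent_nonpos (isSelfAdjoint_wignerCoeff ha) hc
        (le_imaginaryPart_kronecker_one hL) z) k) (integrable_resolventBlock ha hc hL k)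

lemma imaginaryPart_meanTrace_nonpos (ha : ∀ p, (a p).IsHermitian) (hc : 0 < c)
    (hL : algebraMap ℝ _ c ≤ (ℑ L : Matrix (Fin m) (Fin m) ℂ)) :
    (ℑ (meanTrace μ n L a) : Matrix (Fin m) (Fin m) ℂ) ≤ 0 := by
  simp only [meanTrace, map_smul, map_sum, selfAdjoint.val_smul, AddSubgroup.val_finsetSum]
  exact smul_nonpos_of_nonneg_of_nonpos (by positivity)
    (Finset.sum_nonpos fun k _ => imaginaryPart_meanBlock_nonpos ha hc hL k)

/-- The constant in the variance bound for the diagonal blocks. -/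
def varConst (C : ℝ) (a : Fin r → Matrix (Fin m) (Fin m) ℂ) : ℝ :=
  (m : ℝ) ^ 4 * (C * (4 * ∑ p, frobeniusSq (a p)))

lemma varConst_nonneg (hC : 0 ≤ C) (a : Fin r → Matrix (Fin m) (Fin m) ℂ) : 0 ≤ varConst C a := by
  have h0 : 0 ≤ ∑ p, frobeniusSq (a p) := Finset.sum_nonneg fun p _ => frobeniusSq_nonneg _
  unfold varConst
  positivity

lemma integral_norm_resolventBlock_sub_sq_le (hμ : IsPoincareLaw μ C)
    (ha : ∀ p, (a p).IsHermitian) (hc : 0 < c)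
    (hL : algebraMap ℝ _ c ≤ (ℑ L : Matrix (Fin m) (Fin m) ℂ)) (k : Fin n) :
    ∫ z, ‖resolventBlock n L a k z - meanBlock μ n L a k‖ ^ 2 ∂(Measure.pi fun _ => μ) ≤
      varConst C a * c⁻¹ ^ 4 / n := by
  have hcont := continuous_resolventBlock (n := n) ha hc hL k
  have hb := norm_resolventBlock_le (n := n) ha hc hL k
  have hi := integrable_resolventBlock (μ := μ) (n := n) ha hc hL k
  have hent : ∀ i j, meanBlock μ n L a k i j =
      ∫ w, wignerResolvent n L a w (i, k) (j, k) ∂(Measure.pi fun _ => μ) := fun i j =>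
    ((entryL i j).integral_comp_comm hi).symm
  have hii : ∀ i j, Integrable (fun z => ‖wignerResolvent n L a z (i, k) (j, k) -
      ∫ w, wignerResolvent n L a w (i, k) (j, k) ∂(Measure.pi fun _ => μ)‖ ^ 2)
      (Measure.pi fun _ => μ) := by
    intro i j
    have h1 : Continuous fun z => wignerResolvent n L a z (i, k) (j, k) :=
      (entryL (i, k) (j, k)).continuous.comp (continuous_wignerResolvent ha hc hL)
    refine integrable_norm_sq_of_bounded (c := c⁻¹ + ‖∫ w, wignerResolvent n L a w (i, k) (j, k)
      ∂(Measure.pi fun _ => μ)‖) (h1.sub continuous_const).stronglyMeasurable fun z => ?_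
    refine (norm_sub_le _ _).trans ?_
    gcongr
    exact (norm_entry_le _ _ _).trans (norm_wignerResolvent_le ha hc hL z)
  calc _ ≤ ∫ z, (m : ℝ) ^ 2 * ∑ i, ∑ j, ‖wignerResolvent n L a z (i, k) (j, k) -
      ∫ w, wignerResolvent n L a w (i, k) (j, k) ∂(Measure.pi fun _ => μ)‖ ^ 2
        ∂(Measure.pi fun _ => μ) := by
        refine integral_mono_of_nonneg (Filter.Eventually.of_forall fun z => by positivity) ?_
          (Filter.Eventually.of_forall fun z => ?_)
        · exact (integrable_finsetSum _ fun i _ => integrable_finsetSum _ fun j _ =>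
            hii i j).const_mul _
        · have := norm_sq_le_card_mul_sum (resolventBlock n L a k z - meanBlock μ n L a k)
          simp only [Matrix.sub_apply, hent, Fintype.card_fin] at this
          exact this
    _ = (m : ℝ) ^ 2 * ∑ i, ∑ j, ∫ z, ‖wignerResolvent n L a z (i, k) (j, k) -
      ∫ w, wignerResolvent n L a w (i, k) (j, k) ∂(Measure.pi fun _ => μ)‖ ^ 2
        ∂(Measure.pi fun _ => μ) := by
        rw [integral_const_mul, integral_finsetSum _ fun i _ => integrable_finsetSum _ fun j _ =>
            hii i j]
        congr 1
        refine Finset.sum_congr rfl fun i _ => ?_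
        rw [integral_finsetSum _ fun j _ => hii i j]
    -- One factor `m²` is the price of passing to entries, the other counts them; together they give
    -- the `m⁴` in `varConst`.
    _ ≤ (m : ℝ) ^ 2 * ∑ _i : Fin m, ∑ _j : Fin m,
          C * (4 * (∑ p, frobeniusSq (a p)) * c⁻¹ ^ 4 / n) := by
        gcongr with i _ j _
        exact integral_norm_entry_sub_sq_le hμ ha hc hL _ _
    _ = _ := by
        simp only [Finset.sum_const, Finset.card_univ, Fintype.card_fin, nsmul_eq_mul, varConst]
        ring

/-- An average of the blocks varies no more than the blocks do, by convexity of the square. This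
rate `1/n` is enough, so no finer trace estimate is required. -/
lemma integral_norm_trace_sub_sq_le (hn : 1 ≤ n) (hμ : IsPoincareLaw μ C)
    (ha : ∀ p, (a p).IsHermitian) (hc : 0 < c)
    (hL : algebraMap ℝ _ c ≤ (ℑ L : Matrix (Fin m) (Fin m) ℂ)) :
    ∫ z, ‖(n : ℝ)⁻¹ • ∑ k, resolventBlock n L a k z - meanTrace μ n L a‖ ^ 2
      ∂(Measure.pi fun _ => μ) ≤ varConst C a * c⁻¹ ^ 4 / n := by
  have hn0 : (0 : ℝ) < n := by exact_mod_cast hn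
  have hi : ∀ k : Fin n, Integrable (fun z => ‖resolventBlock n L a k z - meanBlock μ n L a k‖ ^ 2)
      (Measure.pi fun _ => μ) := fun k =>
    integrable_norm_sq_of_bounded (c := (m : ℝ) ^ 2 * c⁻¹ + ‖meanBlock μ n L a k‖)
      ((continuous_resolventBlock ha hc hL k).sub continuous_const).stronglyMeasurable fun z =>
        (norm_sub_le _ _).trans (by gcongr; exact norm_resolventBlock_le ha hc hL k z)
  calc _ ≤ ∫ z, (n : ℝ)⁻¹ * ∑ k, ‖resolventBlock n L a k z - meanBlock μ n L a k‖ ^ 2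
        ∂(Measure.pi fun _ => μ) := by
        refine integral_mono_of_nonneg (Filter.Eventually.of_forall fun z => by positivity) ?_
          (Filter.Eventually.of_forall fun z => ?_)
        · exact (integrable_finsetSum _ fun k _ => hi k).const_mul _
        · simp only [meanTrace]
          rw [← smul_sub, ← Finset.sum_sub_distrib, norm_smul, mul_pow,
            Real.norm_of_nonneg (by positivity)]
          have h1 := pow_le_pow_left₀ (norm_nonneg _) (norm_sum_le Finset.univ fun k =>
            resolventBlock n L a k z - meanBlock μ n L a k) 2
          have h2 := h1.trans (sq_sum_le_card_mul_sum_sq (s := Finset.univ)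
            (f := fun k => ‖resolventBlock n L a k z - meanBlock μ n L a k‖))
          rw [Finset.card_univ, Fintype.card_fin] at h2
          calc _ ≤ (n : ℝ)⁻¹ ^ 2 * (n * ∑ k, ‖resolventBlock n L a k z -
                meanBlock μ n L a k‖ ^ 2) := by gcongr
            _ = _ := by field_simp
    _ = (n : ℝ)⁻¹ * ∑ k, ∫ z, ‖resolventBlock n L a k z - meanBlock μ n L a k‖ ^ 2
        ∂(Measure.pi fun _ => μ) := by
        rw [integral_const_mul, integral_finsetSum _ fun k _ => hi k]
    _ ≤ (n : ℝ)⁻¹ * ∑ _k : Fin n, varConst C a * c⁻¹ ^ 4 / n := by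
        gcongr with k
        exact integral_norm_resolventBlock_sub_sq_le hμ ha hc hL k
    _ = _ := by
        rw [Finset.sum_const, Finset.card_univ, Fintype.card_fin, nsmul_eq_mul]
        field_simp

end BlockEstimates

/-! ### Approximate Dyson equation for the expected blocks -/

section ApproximateDyson

open scoped MatrixOrder

variable {μ : Measure ℝ} [IsProbabilityMeasure μ] {C : ℝ} {m n r : ℕ}
  {L : Matrix (Fin m) (Fin m) ℂ} {a : Fin r → Matrix (Fin m) (Fin m) ℂ} {c : ℝ}

/-- The covariance map as a real continuous linear map. -/
def covarianceMapL (a : Fin r → Matrix (Fin m) (Fin m) ℂ) :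
    Matrix (Fin m) (Fin m) ℂ →L[ℝ] Matrix (Fin m) (Fin m) ℂ :=
  LinearMap.toContinuousLinearMap ((covarianceMap a).restrictScalars ℝ)

lemma covarianceMapL_apply (M : Matrix (Fin m) (Fin m) ℂ) :
    covarianceMapL a M = covarianceMap a M := rfl

lemma wignerResolvent_update (ha : ∀ p, (a p).IsHermitian) (hc : 0 < c)
    (hL : algebraMap ℝ _ c ≤ (ℑ L : Matrix (Fin m) (Fin m) ℂ)) (z) (i) (t : ℝ) :
    wignerResolvent n L a (Function.update z i t) = wignerResolvent n L a (Function.update z i 0) +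
      t • (wignerResolvent n L a (Function.update z i 0) * wignerCoeff n a i *
        wignerResolvent n L a (Function.update z i t)) := by
  have := affineResolvent_update (isSelfAdjoint_wignerCoeff ha) hc
    (le_imaginaryPart_kronecker_one (n := n) hL) z i 0 t
  rwa [sub_zero] at this

/-- The error in the integration by parts for the Wigner resolvent. -/
def ibpError (μ : Measure ℝ) (n : ℕ) (L : Matrix (Fin m) (Fin m) ℂ)
    (a : Fin r → Matrix (Fin m) (Fin m) ℂ) (i : Fin r × (Fin n × Fin n)) :
    Matrix (Fin m × Fin n) (Fin m × Fin n) ℂ :=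
  ∫ z, z i • wignerResolvent n L a z ∂(Measure.pi fun _ => μ) -
    ∫ z, wignerResolvent n L a z * wignerCoeff n a i * wignerResolvent n L a z
      ∂(Measure.pi fun _ => μ)

lemma norm_ibpError_le (hμ : IsPoincareLaw μ C) (ha : ∀ p, (a p).IsHermitian) (hc : 0 < c)
    (hL : algebraMap ℝ _ c ≤ (ℑ L : Matrix (Fin m) (Fin m) ℂ)) (i : Fin r × (Fin n × Fin n)) :
    ‖ibpError μ n L a i‖ ≤ (∫ t, t ^ 4 ∂μ + 3) *
      (((√(n : ℝ))⁻¹ * (2 * entrySum (a i.1))) ^ 3 * c⁻¹ ^ 4) := by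
  refine (norm_integral_eval_smul_sub_le i (continuous_wignerResolvent ha hc hL).stronglyMeasurable
    (fun z t => wignerResolvent_update ha hc hL z i t) (norm_wignerResolvent_le ha hc hL)
    hμ.mean hμ.second hμ.third hμ.integrable_id hμ.integrable_four).trans ?_
  have h4 : 0 ≤ ∫ t, t ^ 4 ∂μ := integral_nonneg fun t => by positivity
  gcongr
  exact norm_wignerCoeff_le a i

lemma affine_mul_wignerResolvent (ha : ∀ p, (a p).IsHermitian) (hc : 0 < c)
    (hL : algebraMap ℝ _ c ≤ (ℑ L : Matrix (Fin m) (Fin m) ℂ)) (z) :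
    (L ⊗ₖ (1 : Matrix (Fin n) (Fin n) ℂ)) * wignerResolvent n L a z -
      ∑ i, wignerCoeff n a i * (z i • wignerResolvent n L a z) = 1 := by
  have h := Ring.mul_inverse_cancel _ (isUnit_affine (isSelfAdjoint_wignerCoeff ha) hc
    (le_imaginaryPart_kronecker_one (n := n) hL) z)
  rw [sub_mul, Finset.sum_mul] at h
  rw [← h]
  congr 1
  refine Finset.sum_congr rfl fun i _ => ?_
  rw [smul_mul_assoc, mul_smul_comm]
  rfl

/-- The expectation of the resolvent equation, with each `E[z_i R]` replaced by `E[R B_i R]` plus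
its error. The sum of the main terms collapses through `∑ B_i R B_i = η(tr R) ⊗ 1`, and the `(k, k)`
block is taken. -/
lemma expected_resolvent_equation (hn : 1 ≤ n) (hμ : IsPoincareLaw μ C)
    (ha : ∀ p, (a p).IsHermitian) (hc : 0 < c)
    (hL : algebraMap ℝ _ c ≤ (ℑ L : Matrix (Fin m) (Fin m) ℂ)) (k : Fin n) :
    L * meanBlock μ n L a k -
      ∫ z, covarianceMapL a ((n : ℝ)⁻¹ • ∑ j, resolventBlock n L a j z) * resolventBlock n L a k z
        ∂(Measure.pi fun _ => μ) = 1 + ∑ i, matrixBlock (wignerCoeff n a i * ibpError μ n L a i) k k := by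
  have hR := continuous_wignerResolvent (n := n) ha hc hL
  have hb := norm_wignerResolvent_le (n := n) ha hc hL
  have iR : Integrable (wignerResolvent n L a) (Measure.pi fun _ => μ) :=
    integrable_of_bounded hR.stronglyMeasurable hb
  have iz : ∀ i, Integrable (fun z => z i • wignerResolvent n L a z) (Measure.pi fun _ => μ) :=
    fun i => integrable_eval_smul hR.stronglyMeasurable hb hμ.integrable_id i
  have iRBR : ∀ i, Integrable (fun z => wignerResolvent n L a z * wignerCoeff n a i *
      wignerResolvent n L a z) (Measure.pi fun _ => μ) := fun i => by
    refine integrable_of_bounded (c := c⁻¹ * ‖wignerCoeff n a i‖ * c⁻¹)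
      ((hR.mul continuous_const).mul hR).stronglyMeasurable fun z => ?_
    refine norm_mul₃_le.trans ?_
    have := hb z
    gcongr
  have e1 : (L ⊗ₖ (1 : Matrix (Fin n) (Fin n) ℂ)) * ∫ z, wignerResolvent n L a z
      ∂(Measure.pi fun _ => μ) - ∑ i, wignerCoeff n a i * ∫ z, z i • wignerResolvent n L a z
      ∂(Measure.pi fun _ => μ) = 1 := by
    have h1 : ∫ z, ((L ⊗ₖ (1 : Matrix (Fin n) (Fin n) ℂ)) * wignerResolvent n L a z -
      ∑ i, wignerCoeff n a i * (z i • wignerResolvent n L a z)) ∂(Measure.pi fun _ => μ) = 1 := by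
      simp_rw [affine_mul_wignerResolvent ha hc hL]
      simp
    rw [integral_sub (iR.const_mul _) (integrable_finsetSum _ fun i _ => (iz i).const_mul _),
      integral_const_mul_of_integrable iR, integral_finsetSum _ fun i _ => (iz i).const_mul _] at h1
    rw [← h1]
    congr 1
    exact Finset.sum_congr rfl fun i _ => (integral_const_mul_of_integrable (iz i)).symm
  have e2 : ∑ i, wignerCoeff n a i * ∫ z, z i • wignerResolvent n L a z ∂(Measure.pi fun _ => μ) =
      ∫ z, (covarianceMapL a ((n : ℝ)⁻¹ • ∑ j, resolventBlock n L a j z) ⊗ₖ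
        (1 : Matrix (Fin n) (Fin n) ℂ)) * wignerResolvent n L a z ∂(Measure.pi fun _ => μ) +
      ∑ i, wignerCoeff n a i * ibpError μ n L a i := by
    have h2 : ∀ z, (covarianceMapL a ((n : ℝ)⁻¹ • ∑ j, resolventBlock n L a j z) ⊗ₖ
        (1 : Matrix (Fin n) (Fin n) ℂ)) * wignerResolvent n L a z =
        ∑ i, wignerCoeff n a i * (wignerResolvent n L a z * wignerCoeff n a i *
          wignerResolvent n L a z) := by
      intro z
      rw [covarianceMapL_apply]
      have := sum_wignerCoeff_mul_mul hn a (wignerResolvent n L a z)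
      simp only [resolventBlock]
      rw [← this, Finset.sum_mul]
      simp only [mul_assoc]
    simp_rw [h2]
    rw [integral_finsetSum _ fun i _ => (iRBR i).const_mul _, ← Finset.sum_add_distrib]
    refine Finset.sum_congr rfl fun i _ => ?_
    rw [integral_const_mul_of_integrable (iRBR i), ← mul_add, ibpError, add_sub_cancel]
  rw [e2] at e1
  have e3 := congrArg (matrixBlockL k k) e1
  have iK : Integrable (fun z => (covarianceMapL a ((n : ℝ)⁻¹ • ∑ j, resolventBlock n L a j z) ⊗ₖ
        (1 : Matrix (Fin n) (Fin n) ℂ)) * wignerResolvent n L a z) (Measure.pi fun _ => μ) := by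
    have : ∀ z, (covarianceMapL a ((n : ℝ)⁻¹ • ∑ j, resolventBlock n L a j z) ⊗ₖ
        (1 : Matrix (Fin n) (Fin n) ℂ)) * wignerResolvent n L a z =
        ∑ i, wignerCoeff n a i * (wignerResolvent n L a z * wignerCoeff n a i *
          wignerResolvent n L a z) := by
      intro z
      rw [covarianceMapL_apply]
      have := sum_wignerCoeff_mul_mul hn a (wignerResolvent n L a z)
      simp only [resolventBlock]
      rw [← this, Finset.sum_mul]
      simp only [mul_assoc]
    simp_rw [this]
    exact integrable_finsetSum _ fun i _ => (iRBR i).const_mul _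
  rw [map_sub, map_add, map_sum, ← (matrixBlockL k k).integral_comp_comm iK] at e3
  simp only [matrixBlockL_apply, matrixBlock_kronecker_one_mul, matrixBlock_one] at e3
  have e4 : matrixBlock (∫ z, wignerResolvent n L a z ∂(Measure.pi fun _ => μ)) k k =
      meanBlock μ n L a k := ((matrixBlockL k k).integral_comp_comm iR).symm
  rw [e4] at e3
  simp only [resolventBlock] at e3 ⊢
  rw [← e3]
  abel

/-- The constant in the approximate Dyson equation. -/
def dysonConst (μ : Measure ℝ) (C : ℝ) (a : Fin r → Matrix (Fin m) (Fin m) ℂ) : ℝ :=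
  16 * (m : ℝ) ^ 2 * (∫ t, t ^ 4 ∂μ + 3) * (∑ p, entrySum (a p) ^ 4) +
    2 * (∑ p, ‖a p‖ ^ 2) * varConst C a

lemma dysonConst_nonneg (hC : 0 ≤ C) (a : Fin r → Matrix (Fin m) (Fin m) ℂ) :
    0 ≤ dysonConst μ C a := by
  have h4 : 0 ≤ ∫ t, t ^ 4 ∂μ := integral_nonneg fun t => by positivity
  have := varConst_nonneg hC a
  unfold dysonConst
  positivity

/-- Each term carries `n⁻²`: one `n^(-1/2)` from the outer coefficient and three from the error. The
outer coefficient restricts the sum to basis matrices meeting row `k`, whose total row mass is at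
most `2n`, leaving `1/n`. The constant is `16 = 2³ · 2`. -/
lemma norm_sum_matrixBlock_ibpError_le (hn : 1 ≤ n) (hμ : IsPoincareLaw μ C)
    (ha : ∀ p, (a p).IsHermitian) (hc : 0 < c)
    (hL : algebraMap ℝ _ c ≤ (ℑ L : Matrix (Fin m) (Fin m) ℂ)) (k : Fin n) :
    ‖∑ i, matrixBlock (wignerCoeff n a i * ibpError μ n L a i) k k‖ ≤
      16 * (m : ℝ) ^ 2 * (∫ t, t ^ 4 ∂μ + 3) * (∑ p, entrySum (a p) ^ 4) * c⁻¹ ^ 4 / n := by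
  have hn0 : (0 : ℝ) < n := by exact_mod_cast hn
  have h4 : 0 ≤ ∫ t, t ^ 4 ∂μ := integral_nonneg fun t => by positivity
  set s := (√(n : ℝ))⁻¹ with hs
  have hs0 : 0 ≤ s := by positivity
  have hs4 : s ^ 4 = (n : ℝ)⁻¹ ^ 2 := by
    rw [hs, show 4 = 2 * 2 from rfl, pow_mul, inv_pow, Real.sq_sqrt hn0.le]
  have hterm : ∀ i : Fin r × (Fin n × Fin n),
      ‖matrixBlock (wignerCoeff n a i * ibpError μ n L a i) k k‖ ≤
      (8 * s ^ 4 * (m : ℝ) ^ 2 * (∫ t, t ^ 4 ∂μ + 3) * entrySum (a i.1) ^ 4 * c⁻¹ ^ 4) *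
        ∑ j, ‖hermitianBasis i.2 k j‖ := by
    intro i
    have e1 : matrixBlock (wignerCoeff n a i * ibpError μ n L a i) k k =
        s • ∑ j, hermitianBasis i.2 k j • (a i.1 * matrixBlock (ibpError μ n L a i) j k) := by
      rw [← matrixBlock_kronecker_mul, wignerCoeff, smul_mul_assoc]
      rfl
    rw [e1, norm_smul, Real.norm_of_nonneg hs0]
    have e2 : ∀ j, ‖a i.1 * matrixBlock (ibpError μ n L a i) j k‖ ≤ entrySum (a i.1) *
        ((m : ℝ) ^ 2 * ((∫ t, t ^ 4 ∂μ + 3) * ((s * (2 * entrySum (a i.1))) ^ 3 * c⁻¹ ^ 4))) := by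
      intro j
      refine (norm_mul_le _ _).trans (mul_le_mul (norm_le_entrySum _) ?_ (norm_nonneg _)
        (entrySum_nonneg _))
      refine (norm_matrixBlock_le _ _ _).trans ?_
      gcongr
      exact norm_ibpError_le hμ ha hc hL i
    calc _ ≤ s * ∑ j, ‖hermitianBasis i.2 k j‖ * (entrySum (a i.1) *
        ((m : ℝ) ^ 2 * ((∫ t, t ^ 4 ∂μ + 3) * ((s * (2 * entrySum (a i.1))) ^ 3 * c⁻¹ ^ 4)))) := by
          gcongr
          refine (norm_sum_le _ _).trans (Finset.sum_le_sum fun j _ => ?_)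
          rw [norm_smul]
          gcongr
          exact e2 j
      _ = _ := by
          rw [← Finset.sum_mul]; ring
  calc _ ≤ ∑ i : Fin r × (Fin n × Fin n),
        (8 * s ^ 4 * (m : ℝ) ^ 2 * (∫ t, t ^ 4 ∂μ + 3) * entrySum (a i.1) ^ 4 * c⁻¹ ^ 4) *
        ∑ j, ‖hermitianBasis i.2 k j‖ :=
        (norm_sum_le _ _).trans (Finset.sum_le_sum fun i _ => hterm i)
    _ = ∑ p, (8 * s ^ 4 * (m : ℝ) ^ 2 * (∫ t, t ^ 4 ∂μ + 3) * entrySum (a p) ^ 4 * c⁻¹ ^ 4) *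
        ∑ q, ∑ j, ‖hermitianBasis q k j‖ := by
        simp only [Finset.mul_sum (s := (Finset.univ : Finset (Fin n × Fin n)))]
        exact Fintype.sum_prod_type' (fun (p : Fin r) (q : Fin n × Fin n) =>
          (8 * s ^ 4 * (m : ℝ) ^ 2 * (∫ t, t ^ 4 ∂μ + 3) * entrySum (a p) ^ 4 * c⁻¹ ^ 4) *
            ∑ j, ‖hermitianBasis q k j‖)
    _ ≤ ∑ p, (8 * s ^ 4 * (m : ℝ) ^ 2 * (∫ t, t ^ 4 ∂μ + 3) * entrySum (a p) ^ 4 * c⁻¹ ^ 4) *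
        (2 * n) := by
        gcongr with p
        exact sum_norm_hermitianBasis_row_le k
    _ = _ := by
        rw [← Finset.sum_mul, ← Finset.sum_mul, ← Finset.mul_sum, hs4]
        field_simp
        ring

/-- The approximate Dyson equation for the expected diagonal blocks. -/
theorem norm_dyson_sub_one_le (hn : 1 ≤ n) (hμ : IsPoincareLaw μ C)
    (ha : ∀ p, (a p).IsHermitian) (hc : 0 < c)
    (hL : algebraMap ℝ _ c ≤ (ℑ L : Matrix (Fin m) (Fin m) ℂ)) (k : Fin n) :
    ‖(L - covarianceMap a (meanTrace μ n L a)) * meanBlock μ n L a k - 1‖ ≤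
      dysonConst μ C a * c⁻¹ ^ 4 / n := by
  have hn0 : (0 : ℝ) < n := by exact_mod_cast hn
  have hg := fun k => continuous_resolventBlock (n := n) ha hc hL k
  have hgb := fun k => norm_resolventBlock_le (n := n) ha hc hL k
  have hgi := fun k => integrable_resolventBlock (μ := μ) (n := n) ha hc hL k
  have hF : Continuous fun z => (n : ℝ)⁻¹ • ∑ j, resolventBlock n L a j z := by
    have h1 := continuous_finsetSum Finset.univ fun j _ => hg j
    exact (continuous_const_smul ((n : ℝ)⁻¹)).comp h1
  have hFb : ∀ z, ‖(n : ℝ)⁻¹ • ∑ j, resolventBlock n L a j z‖ ≤ (m : ℝ) ^ 2 * c⁻¹ := by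
    intro z
    rw [norm_smul, Real.norm_of_nonneg (by positivity), inv_mul_le_iff₀ hn0]
    refine (norm_sum_le _ _).trans ((Finset.sum_le_sum fun k _ => hgb k z).trans (le_of_eq ?_))
    simp
  have hFm : ∫ z, (n : ℝ)⁻¹ • ∑ j, resolventBlock n L a j z ∂(Measure.pi fun _ => μ) =
      meanTrace μ n L a := by
    rw [integral_smul, integral_finsetSum _ fun j _ => hgi j]
    rfl
  have hκ : 0 ≤ ∑ p, ‖a p‖ ^ 2 := by positivity
  have e1 := norm_integral_mul_sub_le (ρ := Measure.pi fun _ : Fin r × (Fin n × Fin n) => μ)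
    (covarianceMapL a) (norm_covarianceMap_le a) hκ hF.stronglyMeasurable
    (hg k).stronglyMeasurable hFb (hgb k)
  rw [hFm] at e1
  have e2 := expected_resolvent_equation hn hμ ha hc hL k
  have e3 := norm_sum_matrixBlock_ibpError_le hn hμ ha hc hL k
  have v1 := integral_norm_trace_sub_sq_le hn hμ ha hc hL
  have v2 := integral_norm_resolventBlock_sub_sq_le hμ ha hc hL k
  -- The defect splits into the integration by parts error and the covariance between `η(tr R)` and
  -- `R_kk`.
  have hdec : (L - covarianceMap a (meanTrace μ n L a)) * meanBlock μ n L a k - 1 =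
      ∑ i, matrixBlock (wignerCoeff n a i * ibpError μ n L a i) k k +
      (∫ z, covarianceMapL a ((n : ℝ)⁻¹ • ∑ j, resolventBlock n L a j z) * resolventBlock n L a k z
        ∂(Measure.pi fun _ => μ) - covarianceMapL a (meanTrace μ n L a) *
          ∫ z, resolventBlock n L a k z ∂(Measure.pi fun _ => μ)) := by
    rw [← sub_eq_iff_eq_add'] at e2
    rw [← e2, sub_mul]
    simp only [covarianceMapL_apply, meanBlock]
    abel
  rw [hdec]
  refine (norm_add_le _ _).trans ((add_le_add e3 (e1.trans (mul_le_mul_of_nonneg_left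
    (add_le_add v1 v2) hκ))).trans (le_of_eq ?_))
  unfold dysonConst
  ring

lemma norm_integral_diag_sub_le (hμ : IsPoincareLaw μ C)
    (ha : ∀ p, (a p).IsHermitian) (hc : 0 < c)
    (hL : algebraMap ℝ _ c ≤ (ℑ L : Matrix (Fin m) (Fin m) ℂ)) (b : Matrix (Fin m) (Fin m) ℂ)
    (k : Fin n) :
    ‖∫ z, resolventBlock n L a k z * b * resolventBlock n L a k z ∂(Measure.pi fun _ => μ) -
      meanBlock μ n L a k * b * meanBlock μ n L a k‖ ≤ 2 * ‖b‖ * varConst C a * c⁻¹ ^ 4 / n := by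
  have hg := continuous_resolventBlock (n := n) ha hc hL k
  have hgb := norm_resolventBlock_le (n := n) ha hc hL k
  have e1 := norm_integral_mul_sub_le (ρ := Measure.pi fun _ : Fin r × (Fin n × Fin n) => μ)
    ((ContinuousLinearMap.mul ℝ (Matrix (Fin m) (Fin m) ℂ)).flip b) (κ := ‖b‖)
    (fun M => by
      rw [ContinuousLinearMap.flip_apply, ContinuousLinearMap.mul_apply', mul_comm ‖b‖]
      exact norm_mul_le _ _) (norm_nonneg _)
    hg.stronglyMeasurable hg.stronglyMeasurable hgb hgb
  have v2 := integral_norm_resolventBlock_sub_sq_le hμ ha hc hL k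
  simp only [ContinuousLinearMap.flip_apply, ContinuousLinearMap.mul_apply'] at e1
  refine e1.trans ((mul_le_mul_of_nonneg_left (add_le_add v2 v2) (norm_nonneg _)).trans
    (le_of_eq ?_))
  ring

end ApproximateDyson

/-! ### Semicircle moments and the Catalan recursion -/

section SemicircleMoments

/-- The moments of the standard semicircle law. -/
def semicircleMoment (k : ℕ) : ℝ :=
  ∫ t in (-2 : ℝ)..2, t ^ k * (√(4 - t ^ 2) / (2 * Real.pi))

lemma semicircleMoment_zero : semicircleMoment 0 = 1 := by
  have h1 : ∀ t : ℝ, √(4 - t ^ 2) = 2 * √(1 - (t / 2) ^ 2) := by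
    intro t
    rw [show 4 - t ^ 2 = 2 ^ 2 * (1 - (t / 2) ^ 2) by ring, Real.sqrt_mul (by positivity),
      Real.sqrt_sq (by norm_num)]
  have h2 := intervalIntegral.integral_comp_div (a := -2) (b := 2)
    (fun t : ℝ => √(1 - t ^ 2)) (two_ne_zero' ℝ)
  rw [show (-2 : ℝ) / 2 = -1 by norm_num, show (2 : ℝ) / 2 = 1 by norm_num,
    integral_sqrt_one_sub_sq] at h2
  simp only [semicircleMoment, pow_zero, one_mul, h1]
  rw [intervalIntegral.integral_div, intervalIntegral.integral_const_mul, h2]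
  simp only [smul_eq_mul]
  field_simp

lemma semicircleMoment_odd {k : ℕ} (hk : Odd k) : semicircleMoment k = 0 := by
  have h := intervalIntegral.integral_comp_neg (a := -2) (b := 2)
    (fun t : ℝ => t ^ k * (√(4 - t ^ 2) / (2 * Real.pi)))
  simp only [hk.neg_pow, neg_sq, neg_mul, neg_neg] at h
  rw [intervalIntegral.integral_neg] at h
  unfold semicircleMoment
  linarith

/-- Integrate the derivative of `t^(k+1) (4 - t²)^(3/2)`, which vanishes at both endpoints. -/
lemma semicircleMoment_add_two (k : ℕ) :
    (k + 4) * semicircleMoment (k + 2) = 4 * (k + 1) * semicircleMoment k := by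
  have hderiv : ∀ t ∈ Set.Ioo (-2 : ℝ) 2,
      HasDerivAt (fun t : ℝ => t ^ (k + 1) * ((4 - t ^ 2) * √(4 - t ^ 2)))
        ((4 * (k + 1)) * (t ^ k * √(4 - t ^ 2)) - (k + 4) * (t ^ (k + 2) * √(4 - t ^ 2))) t := by
    intro t ht
    have hpos : 0 < 4 - t ^ 2 := by nlinarith [ht.1, ht.2]
    have h1 : HasDerivAt (fun t : ℝ => 4 - t ^ 2) (-(2 * t)) t := by
      simpa using (hasDerivAt_pow 2 t).const_sub 4
    have h3 := (hasDerivAt_pow (k + 1) t).fun_mul (h1.fun_mul (h1.sqrt hpos.ne'))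
    refine h3.congr_deriv ?_
    have hs : √(4 - t ^ 2) ≠ 0 := (Real.sqrt_pos.2 hpos).ne'
    have hsq : 4 - t ^ 2 = √(4 - t ^ 2) ^ 2 := (Real.sq_sqrt hpos.le).symm
    have e : (4 - t ^ 2) * (-(2 * t) / (2 * √(4 - t ^ 2))) = -t * √(4 - t ^ 2) := by
      rw [mul_div_assoc', div_eq_iff (by positivity)]
      nth_rewrite 1 [hsq]
      ring
    rw [e, Nat.add_sub_cancel]
    push_cast
    ring
  have hcont : ContinuousOn (fun t : ℝ => t ^ (k + 1) * ((4 - t ^ 2) * √(4 - t ^ 2)))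
      (Set.Icc (-2) 2) := by fun_prop
  have i1 : IntervalIntegrable (fun t : ℝ => (4 * (k + 1)) * (t ^ k * √(4 - t ^ 2)))
      volume (-2) 2 := Continuous.intervalIntegrable (by fun_prop) _ _
  have i2 : IntervalIntegrable (fun t : ℝ => (k + 4) * (t ^ (k + 2) * √(4 - t ^ 2)))
      volume (-2) 2 := Continuous.intervalIntegrable (by fun_prop) _ _
  have h := intervalIntegral.integral_eq_sub_of_hasDerivAt_of_le (by norm_num) hcont hderiv
    (i1.sub i2)
  rw [intervalIntegral.integral_sub i1 i2, intervalIntegral.integral_const_mul,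
    intervalIntegral.integral_const_mul] at h
  norm_num at h
  simp only [semicircleMoment, ← mul_div_assoc, intervalIntegral.integral_div]
  have hpi := Real.pi_ne_zero
  field_simp
  linarith

lemma semicircleMoment_two_mul (j : ℕ) : semicircleMoment (2 * j) = catalan j := by
  induction j with
  | zero => simp [semicircleMoment_zero]
  | succ j ih =>
    have h1 := semicircleMoment_add_two (2 * j)
    rw [ih] at h1
    have h2 : ((j + 1 : ℕ) + 1 : ℝ) * catalan (j + 1) = (j + 1).centralBinom := by
      exact_mod_cast succ_mul_catalan_eq_centralBinom (j + 1)
    have h3 : ((j : ℝ) + 1) * catalan j = j.centralBinom := by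
      exact_mod_cast succ_mul_catalan_eq_centralBinom j
    have h4 : ((j : ℝ) + 1) * (j + 1).centralBinom = 2 * (2 * j + 1) * j.centralBinom := by
      exact_mod_cast Nat.succ_mul_centralBinom_succ j
    rw [← h2, ← h3] at h4
    push_cast at h1 h4
    have hj : (0 : ℝ) < j + 1 := by positivity
    have hj2 : (0 : ℝ) < 2 * j + 4 := by positivity
    rw [show 2 * (j + 1) = 2 * j + 2 by ring]
    apply mul_left_cancel₀ hj2.ne'
    rw [h1]
    apply mul_left_cancel₀ hj.ne'
    linear_combination -2 * h4

/-- This is the Schwinger–Dyson equation for the monomial `t^k`: the right side is the free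
difference quotient of `t^k` with both tensor legs integrated. For odd `k` it is the Catalan
recursion, for even `k` both sides vanish by parity. -/
lemma semicircleMoment_succ (k : ℕ) : semicircleMoment (k + 1) =
    ∑ i ∈ Finset.range k, semicircleMoment i * semicircleMoment (k - 1 - i) := by
  rcases Nat.even_or_odd k with hk | hk
  · rw [semicircleMoment_odd hk.add_one, Finset.sum_eq_zero]
    intro i hi
    have hi' := Finset.mem_range.1 hi
    rcases Nat.even_or_odd i with h | h
    · rw [semicircleMoment_odd (k := k - 1 - i), mul_zero]
      obtain ⟨u, hu⟩ := hk
      obtain ⟨v, hv⟩ := h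
      exact ⟨u - v - 1, by omega⟩
    · rw [semicircleMoment_odd h, zero_mul]
  · obtain ⟨j, rfl⟩ := hk
    rw [show 2 * j + 1 + 1 = 2 * (j + 1) by ring, semicircleMoment_two_mul, catalan_succ',
      Finset.Nat.sum_antidiagonal_eq_sum_range_succ_mk]
    push_cast
    -- Terms of odd index vanish, so the sum runs over even indices only.
    have key : ∀ N : ℕ, ∑ i ∈ Finset.range (2 * N + 1),
        semicircleMoment i * semicircleMoment (2 * j - i) =
        ∑ i ∈ Finset.range (N + 1), semicircleMoment (2 * i) *
          semicircleMoment (2 * j - 2 * i) := by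
      intro N
      induction N with
      | zero => simp
      | succ N ih =>
        rw [show 2 * (N + 1) + 1 = 2 * N + 1 + 1 + 1 by ring, Finset.sum_range_succ,
          Finset.sum_range_succ, ih, semicircleMoment_odd (k := 2 * N + 1) ⟨N, rfl⟩,
          Finset.sum_range_succ _ (N + 1)]
        simp [show 2 * N + 1 + 1 = 2 * (N + 1) by ring]
    rw [key]
    refine Finset.sum_congr rfl fun i _ => ?_
    rw [← Nat.mul_sub, semicircleMoment_two_mul, semicircleMoment_two_mul]

end SemicircleMoments

/-! ### Free difference quotients -/

section FreeDifference

lemma leibniz_pow {R S : Type*} [Ring R] [Ring S] (φ : R →+* S) (D : R → S) (h1 : D 1 = 0)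
    (hD : ∀ f g, D (f * g) = φ f * D g + D f * φ g) (f : R) (k : ℕ) :
    D (f ^ k) = ∑ i ∈ Finset.range k, φ f ^ i * D f * φ f ^ (k - 1 - i) := by
  induction k with
  | zero => simpa using h1
  | succ k ih =>
    rw [pow_succ, hD, ih, Finset.sum_range_succ, add_comm, Finset.sum_mul]
    congr 1
    · refine Finset.sum_congr rfl fun i hi => ?_
      have := Finset.mem_range.1 hi
      rw [mul_assoc, ← pow_succ]
      congr 2
      omega
    · simp

variable {B : Type*} [Ring B] [Algebra ℂ B] {r : ℕ} (τ : B →ₗ[ℂ] ℂ) (x : Fin r → B)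

/-- The map `b ↦ τ(b) 1`. -/
def stateProj : Module.End ℂ B := τ.smulRight (1 : B)

@[simp] lemma stateProj_apply (b : B) : stateProj τ b = τ b • (1 : B) := rfl

/-- Evaluation of noncommutative polynomials. -/
def freeEval : FreeAlgebra ℂ (Fin r) →ₐ[ℂ] B := FreeAlgebra.lift ℂ x

@[simp] lemma freeEval_ι (q : Fin r) : freeEval x (FreeAlgebra.ι ℂ q) = x q := by
  simp [freeEval]

/-- The triangular representation whose corner entry is the free difference quotient. -/
def freeTriangular (p : Fin r) :
    FreeAlgebra ℂ (Fin r) →ₐ[ℂ] Matrix (Fin 2) (Fin 2) (Module.End ℂ B) :=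
  FreeAlgebra.lift ℂ fun q => !![Algebra.lmul ℂ B (x q), if q = p then stateProj τ else 0;
    0, Algebra.lmul ℂ B (x q)]

/-- The `p`-th free difference quotient, where the monomial `u ⊗ v` is realised as the operator
`b ↦ τ(v b) u`. -/
def freeDiff (p : Fin r) : FreeAlgebra ℂ (Fin r) →ₗ[ℂ] Module.End ℂ B :=
  Matrix.entryLinearMap ℂ (Module.End ℂ B) 0 1 ∘ₗ (freeTriangular τ x p).toLinearMap

lemma freeDiff_apply (p : Fin r) (f : FreeAlgebra ℂ (Fin r)) :
    freeDiff τ x p f = freeTriangular τ x p f 0 1 := rfl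

lemma freeTriangular_entries (p : Fin r) (f : FreeAlgebra ℂ (Fin r)) :
    freeTriangular τ x p f 0 0 = Algebra.lmul ℂ B (freeEval x f) ∧
      freeTriangular τ x p f 1 0 = 0 ∧
      freeTriangular τ x p f 1 1 = Algebra.lmul ℂ B (freeEval x f) := by
  induction f using FreeAlgebra.induction with
  | grade0 z =>
    simp only [AlgHom.commutes, Matrix.algebraMap_matrix_apply]
    simp
  | grade1 q => simp [freeTriangular]
  | mul f g hf hg =>
    simp [map_mul, Matrix.mul_apply, Fin.sum_univ_two, hf.1, hf.2.1, hf.2.2, hg.1, hg.2.1, hg.2.2]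
  | add f g hf hg =>
    simp [map_add, hf.1, hf.2.1, hf.2.2, hg.1, hg.2.1, hg.2.2]

/-- The Leibniz rule is the corner entry of a product of upper triangular matrices, which is why the
derivation is defined through a representation and needs no well-definedness check. -/
lemma freeDiff_mul (p : Fin r) (f g : FreeAlgebra ℂ (Fin r)) :
    freeDiff τ x p (f * g) = Algebra.lmul ℂ B (freeEval x f) * freeDiff τ x p g +
      freeDiff τ x p f * Algebra.lmul ℂ B (freeEval x g) := by
  simp only [freeDiff_apply, map_mul, Matrix.mul_apply, Fin.sum_univ_two,
    (freeTriangular_entries τ x p f).1, (freeTriangular_entries τ x p g).2.2]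

lemma freeDiff_algebraMap (p : Fin r) (z : ℂ) :
    freeDiff τ x p (algebraMap ℂ _ z) = 0 := by
  simp [freeDiff_apply, Matrix.algebraMap_matrix_apply]

lemma freeDiff_one (p : Fin r) : freeDiff τ x p 1 = 0 := by
  simpa using freeDiff_algebraMap τ x p 1

lemma freeDiff_ι (p q : Fin r) :
    freeDiff τ x p (FreeAlgebra.ι ℂ q) = if q = p then stateProj τ else 0 := by
  simp [freeDiff_apply, freeTriangular]

lemma freeDiff_pow_ι (p q : Fin r) (k : ℕ) :
    freeDiff τ x p (FreeAlgebra.ι ℂ q ^ k) = ∑ i ∈ Finset.range k,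
      Algebra.lmul ℂ B (x q) ^ i * (if q = p then stateProj τ else 0) *
        Algebra.lmul ℂ B (x q) ^ (k - 1 - i) := by
  have h := leibniz_pow (((Algebra.lmul ℂ B).comp (freeEval x)).toRingHom) (freeDiff τ x p)
    (freeDiff_one τ x p) (freeDiff_mul τ x p) (FreeAlgebra.ι ℂ q) k
  simpa [freeDiff_ι] using h

lemma freeDiff_aeval_of_ne {p q : Fin r} (hq : q ≠ p) (P : Polynomial ℂ) :
    freeDiff τ x p (Polynomial.aeval (FreeAlgebra.ι ℂ q) P) = 0 := by
  induction P using Polynomial.induction_on' with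
  | add P Q hP hQ => rw [map_add, map_add, hP, hQ, add_zero]
  | monomial k z =>
    rw [Polynomial.aeval_monomial, ← Algebra.smul_def, map_smul, freeDiff_pow_ι]
    simp [hq]

/-- The difference quotient of a power is a sum of terms `b ↦ τ(x^j b) x^i`, and each scalar
vanishes at `b = y`. -/
lemma freeDiff_aeval_apply_eq_zero {p : Fin r} {y : B}
    (hy : ∀ Q : Polynomial ℂ, τ (Polynomial.aeval (x p) Q * y) = 0) (P : Polynomial ℂ) :
    freeDiff τ x p (Polynomial.aeval (FreeAlgebra.ι ℂ p) P) y = 0 := by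
  induction P using Polynomial.induction_on' with
  | add P Q hP hQ => rw [map_add, map_add, LinearMap.add_apply, hP, hQ, add_zero]
  | monomial k z =>
    rw [Polynomial.aeval_monomial, ← Algebra.smul_def, map_smul, freeDiff_pow_ι,
      LinearMap.smul_apply, LinearMap.sum_apply, Finset.sum_eq_zero, smul_zero]
    intro i _
    have h := hy (Polynomial.X ^ (k - 1 - i))
    simp only [map_pow, Polynomial.aeval_X] at h
    rw [if_pos rfl, ← map_pow (Algebra.lmul ℂ B) (x p) (k - 1 - i)]
    simp only [Module.End.mul_apply, Algebra.coe_lmul_eq_mul, LinearMap.mul_apply',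
      stateProj_apply, h, zero_smul, map_zero]

end FreeDifference

/-! ### Schwinger–Dyson equation for semicircular systems -/

section SchwingerDyson

/-- The one-variable case, read off from the moment recursion. That the result is again a polynomial
in `x p` alone is recorded because freeness can then be applied to it. -/
lemma exists_freeDiff_aeval_one {B : Type*} [CStarAlgebra B] {r : ℕ} {τ : B →ₗ[ℂ] ℂ}
    {x : Fin r → B} {p : Fin r} (hs : IsSemicircular τ (x p)) (P : Polynomial ℂ) :
    ∃ Q : Polynomial ℂ, freeDiff τ x p (Polynomial.aeval (FreeAlgebra.ι ℂ p) P) 1 =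
        Polynomial.aeval (x p) Q ∧
      τ (Polynomial.aeval (x p) Q) = τ (x p * Polynomial.aeval (x p) P) := by
  induction P using Polynomial.induction_on' with
  | add P P' hP hP' =>
    obtain ⟨Q, h1, h2⟩ := hP
    obtain ⟨Q', h1', h2'⟩ := hP'
    refine ⟨Q + Q', ?_, ?_⟩
    · rw [map_add, map_add, LinearMap.add_apply, h1, h1', map_add]
    · rw [map_add, map_add, h2, h2', map_add, mul_add, map_add]
  | monomial k z =>
    have hm : ∀ j, τ (x p ^ j) = (semicircleMoment j : ℂ) := hs
    refine ⟨z • ∑ i ∈ Finset.range k,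
      (semicircleMoment (k - 1 - i) : ℂ) • Polynomial.X ^ i, ?_, ?_⟩
    · rw [Polynomial.aeval_monomial, ← Algebra.smul_def, map_smul, freeDiff_pow_ι,
        LinearMap.smul_apply, LinearMap.sum_apply, map_smul, map_sum]
      congr 1
      refine Finset.sum_congr rfl fun i _ => ?_
      rw [if_pos rfl, ← map_pow, ← map_pow, map_smul, Polynomial.aeval_X_pow]
      simp only [Module.End.mul_apply, Algebra.coe_lmul_eq_mul, LinearMap.mul_apply',
        stateProj_apply, mul_one, mul_smul_comm, hm]
    · rw [Polynomial.aeval_monomial, ← Algebra.smul_def, mul_smul_comm, ← pow_succ', map_smul,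
        map_smul, map_smul, hm, semicircleMoment_succ, map_sum, map_sum]
      congr 1
      push_cast
      refine Finset.sum_congr rfl fun i _ => ?_
      rw [map_smul, map_smul, map_pow, Polynomial.aeval_X, hm, smul_eq_mul, mul_comm]

variable {B : Type*} [CStarAlgebra B] {r : ℕ} {τ : B →ₗ[ℂ] ℂ} {x : Fin r → B}

/-- The product of the polynomials of a list, each evaluated at its own indeterminate. -/
def freeWord (L : List (Fin r × Polynomial ℂ)) : FreeAlgebra ℂ (Fin r) :=
  (L.map fun q => Polynomial.aeval (FreeAlgebra.ι ℂ q.1) q.2).prod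

lemma freeWord_cons (q : Fin r × Polynomial ℂ) (L : List (Fin r × Polynomial ℂ)) :
    freeWord (q :: L) = Polynomial.aeval (FreeAlgebra.ι ℂ q.1) q.2 * freeWord L := by
  simp [freeWord]

lemma freeWord_append (L L' : List (Fin r × Polynomial ℂ)) :
    freeWord (L ++ L') = freeWord L * freeWord L' := by
  simp [freeWord]

lemma freeEval_aeval (x : Fin r → B) (q : Fin r) (P : Polynomial ℂ) :
    freeEval x (Polynomial.aeval (FreeAlgebra.ι ℂ q) P) = Polynomial.aeval (x q) P := by
  rw [← Polynomial.aeval_algHom_apply, freeEval_ι]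

/-- Alternating lists of centred polynomials. -/
def IsAlternatingCentered (τ : B →ₗ[ℂ] ℂ) (x : Fin r → B)
    (L : List (Fin r × Polynomial ℂ)) : Prop :=
  L.IsChain (fun q q' => q.1 ≠ q'.1) ∧ ∀ q ∈ L, τ (Polynomial.aeval (x q.1) q.2) = 0

lemma IsFreeFamily.map_freeWord (hx : IsFreeFamily τ x) {L : List (Fin r × Polynomial ℂ)}
    (hL : L ≠ []) (h : IsAlternatingCentered τ x L) : τ (freeEval x (freeWord L)) = 0 := by
  have h1 := hx L hL h.1 h.2
  rwa [freeWord, map_list_prod, List.map_map, Function.comp_def,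
    funext fun q : Fin r × Polynomial ℂ => freeEval_aeval x q.1 q.2]

lemma IsAlternatingCentered.of_append_left {L L' : List (Fin r × Polynomial ℂ)}
    (h : IsAlternatingCentered τ x (L ++ L')) : IsAlternatingCentered τ x L :=
  ⟨(List.isChain_append.1 h.1).1, fun q hq => h.2 q (List.mem_append_left _ hq)⟩

lemma IsAlternatingCentered.of_append_right {L L' : List (Fin r × Polynomial ℂ)}
    (h : IsAlternatingCentered τ x (L ++ L')) : IsAlternatingCentered τ x L' :=
  ⟨(List.isChain_append.1 h.1).2.1, fun q hq => h.2 q (List.mem_append_right _ hq)⟩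

lemma IsAlternatingCentered.of_cons {q : Fin r × Polynomial ℂ} {L : List (Fin r × Polynomial ℂ)}
    (h : IsAlternatingCentered τ x (q :: L)) : IsAlternatingCentered τ x L :=
  IsAlternatingCentered.of_append_right (L := [q]) h

lemma IsAlternatingCentered.replace {L L' : List (Fin r × Polynomial ℂ)} {p : Fin r}
    {P Q : Polynomial ℂ} (h : IsAlternatingCentered τ x (L ++ (p, P) :: L'))
    (hQ : τ (Polynomial.aeval (x p) Q) = 0) :
    IsAlternatingCentered τ x (L ++ (p, Q) :: L') := by
  refine ⟨?_, fun q hq => ?_⟩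
  · have h1 := h.1
    rw [List.isChain_append, List.isChain_cons] at h1 ⊢
    refine ⟨h1.1, h1.2.1, fun a ha b hb => ?_⟩
    have := h1.2.2 a ha (p, P) (by simp)
    simp only [List.head?_cons, Option.mem_def, Option.some.injEq] at hb
    rwa [← hb]
  · rw [List.mem_append, List.mem_cons] at hq
    rcases hq with hq | rfl | hq
    · exact h.2 q (by simp [hq])
    · exact hQ
    · exact h.2 q (by simp [hq])

lemma map_aeval_sub_C (hτ : τ 1 = 1) (y : B) (Q : Polynomial ℂ) :
    τ (Polynomial.aeval y (Q - Polynomial.C (τ (Polynomial.aeval y Q)))) = 0 := by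
  rw [map_sub, map_sub, Polynomial.aeval_C, Algebra.algebraMap_eq_smul_one, map_smul, hτ]
  simp

lemma aeval_eq_sub_C_add (τ : B →ₗ[ℂ] ℂ) (y : B) (Q : Polynomial ℂ) :
    Polynomial.aeval y Q = Polynomial.aeval y (Q - Polynomial.C (τ (Polynomial.aeval y Q))) +
      τ (Polynomial.aeval y Q) • 1 := by
  rw [map_sub, Polynomial.aeval_C, Algebra.algebraMap_eq_smul_one, sub_add_cancel]

/-- Split `Q` into its centred part and a constant: the former continues the alternating centred
word, the latter leaves a nonempty one, and both have zero state. So the outer letter need not be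
centred. -/
lemma IsFreeFamily.map_aeval_mul_freeWord (hτ : τ 1 = 1) (hx : IsFreeFamily τ x) {p : Fin r}
    {P : Polynomial ℂ} {L : List (Fin r × Polynomial ℂ)} (hL : L ≠ [])
    (h : IsAlternatingCentered τ x ((p, P) :: L)) (Q : Polynomial ℂ) :
    τ (Polynomial.aeval (x p) Q * freeEval x (freeWord L)) = 0 := by
  have h1 := hx.map_freeWord (by simp)
    (IsAlternatingCentered.replace (L := []) h (map_aeval_sub_C hτ (x p) Q))
  rw [List.nil_append, freeWord_cons, map_mul, freeEval_aeval] at h1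
  rw [aeval_eq_sub_C_add τ, add_mul, map_add, h1, smul_mul_assoc, one_mul, map_smul,
    hx.map_freeWord hL h.of_cons, smul_zero, add_zero]

lemma IsFreeFamily.map_freeWord_mul_aeval (hτ : τ 1 = 1) (hx : IsFreeFamily τ x) {p : Fin r}
    {P : Polynomial ℂ} {L : List (Fin r × Polynomial ℂ)} (hL : L ≠ [])
    (h : IsAlternatingCentered τ x (L ++ [(p, P)])) (Q : Polynomial ℂ) :
    τ (freeEval x (freeWord L) * Polynomial.aeval (x p) Q) = 0 := by
  have h1 := hx.map_freeWord (by simp)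
    (IsAlternatingCentered.replace h (map_aeval_sub_C hτ (x p) Q))
  rw [freeWord_append, freeWord_cons, map_mul (freeEval x), map_mul (freeEval x),
    freeEval_aeval] at h1
  rw [aeval_eq_sub_C_add τ, mul_add, map_add, mul_smul_comm, mul_one, map_smul,
    hx.map_freeWord hL h.of_append_left, smul_zero, add_zero]
  simpa [freeWord] using h1

/-- Differentiating the leading letter produces factors `τ(x^j · rest)`, which vanish by freeness as
the rest is nonempty. Only derivatives of later letters survive. -/
lemma freeDiff_freeWord_cons_apply_one (hτ : τ 1 = 1) (hx : IsFreeFamily τ x) (p : Fin r)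
    {q : Fin r × Polynomial ℂ} {L : List (Fin r × Polynomial ℂ)} (hL : L ≠ [])
    (h : IsAlternatingCentered τ x (q :: L)) :
    freeDiff τ x p (freeWord (q :: L)) 1 =
      Polynomial.aeval (x q.1) q.2 * freeDiff τ x p (freeWord L) 1 := by
  have h0 : freeDiff τ x p (Polynomial.aeval (FreeAlgebra.ι ℂ q.1) q.2)
      (freeEval x (freeWord L)) = 0 := by
    by_cases hq : q.1 = p
    · subst hq
      exact freeDiff_aeval_apply_eq_zero τ x
        (fun Q => hx.map_aeval_mul_freeWord hτ hL h Q) _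
    · rw [freeDiff_aeval_of_ne τ x hq, LinearMap.zero_apply]
  rw [freeWord_cons, freeDiff_mul, LinearMap.add_apply]
  simp only [Module.End.mul_apply, Algebra.coe_lmul_eq_mul, LinearMap.mul_apply', mul_one,
    h0, add_zero, freeEval_aeval]

/-- Induction moves letters from `L` to the prefix until the last one, whose derivative is a
polynomial in `x p`. The prefix times this polynomial has zero state, the prefix being nonempty. -/
lemma map_freeWord_mul_freeDiff_apply_one (hτ : τ 1 = 1) (hx : IsFreeFamily τ x) {p : Fin r}
    (hs : IsSemicircular τ (x p)) (L : List (Fin r × Polynomial ℂ)) :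
    ∀ L₀ : List (Fin r × Polynomial ℂ), L₀ ≠ [] → L ≠ [] →
      IsAlternatingCentered τ x (L₀ ++ L) →
      τ (freeEval x (freeWord L₀) * freeDiff τ x p (freeWord L) 1) = 0 := by
  induction L with
  | nil => intro L₀ _ h; exact absurd rfl h
  | cons q L ih =>
    intro L₀ hL₀ _ h
    by_cases hL : L = []
    · subst hL
      rw [freeWord_cons, show freeWord ([] : List (Fin r × Polynomial ℂ)) = 1 from rfl, mul_one]
      by_cases hq : q.1 = p
      · subst hq
        obtain ⟨Q, h1, -⟩ := exists_freeDiff_aeval_one hs q.2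
        rw [h1]
        exact hx.map_freeWord_mul_aeval hτ hL₀ h Q
      · rw [freeDiff_aeval_of_ne τ x hq, LinearMap.zero_apply, mul_zero, map_zero]
    · rw [freeDiff_freeWord_cons_apply_one hτ hx p hL h.of_append_right, ← mul_assoc]
      have h1 := ih (L₀ ++ [q]) (by simp) hL (by simpa using h)
      rwa [freeWord_append, map_mul (freeEval x), freeWord_cons,
        show freeWord ([] : List (Fin r × Polynomial ℂ)) = 1 from rfl, mul_one,
        freeEval_aeval] at h1

/-- On alternating centred words both sides vanish, except for a word consisting of a single letter
in the variable `p`, where the equation is the one-variable case. -/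
lemma map_mul_freeEval_freeWord (hτ : τ 1 = 1) (hx : IsFreeFamily τ x) {p : Fin r}
    (hs : IsSemicircular τ (x p)) {L : List (Fin r × Polynomial ℂ)}
    (h : IsAlternatingCentered τ x L) :
    τ (x p * freeEval x (freeWord L)) = τ (freeDiff τ x p (freeWord L) 1) := by
  have h0 : τ (x p) = 0 := by
    have := hs 1
    change τ (x p ^ 1) = (semicircleMoment 1 : ℂ) at this
    rwa [semicircleMoment_odd odd_one, pow_one, Complex.ofReal_zero] at this
  have hX : τ (Polynomial.aeval (x p) (Polynomial.X : Polynomial ℂ)) = 0 := by rwa [Polynomial.aeval_X]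
  cases L with
  | nil =>
    rw [show freeWord ([] : List (Fin r × Polynomial ℂ)) = 1 from rfl, freeDiff_one, map_one,
      mul_one, h0, LinearMap.zero_apply, map_zero]
  | cons q L =>
    have hne : q.1 ≠ p → τ (x p * freeEval x (freeWord (q :: L))) = 0 := by
      intro hq
      have h1 : IsAlternatingCentered τ x ((p, Polynomial.X) :: q :: L) := by
        refine ⟨List.isChain_cons_cons.2 ⟨fun e => hq e.symm, h.1⟩, fun q' hq' => ?_⟩
        rcases List.mem_cons.1 hq' with rfl | hq'
        · exact hX
        · exact h.2 q' hq'
      have h2 := hx.map_aeval_mul_freeWord hτ (by simp) h1 Polynomial.X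
      rwa [Polynomial.aeval_X] at h2
    by_cases hL : L = []
    · subst hL
      by_cases hq : q.1 = p
      · subst hq
        obtain ⟨Q, h1, h2⟩ := exists_freeDiff_aeval_one hs q.2
        rw [freeWord_cons, show freeWord ([] : List (Fin r × Polynomial ℂ)) = 1 from rfl,
          mul_one, freeEval_aeval, h1, h2]
      · rw [hne hq, freeWord_cons, show freeWord ([] : List (Fin r × Polynomial ℂ)) = 1 from rfl,
          mul_one, freeDiff_aeval_of_ne τ x hq, LinearMap.zero_apply, map_zero]
    · have h1 := map_freeWord_mul_freeDiff_apply_one hτ hx hs L [q] (by simp) hL h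
      rw [freeWord_cons, show freeWord ([] : List (Fin r × Polynomial ℂ)) = 1 from rfl,
        mul_one, freeEval_aeval] at h1
      rw [freeDiff_freeWord_cons_apply_one hτ hx p hL h, h1]
      by_cases hq : q.1 = p
      · subst hq
        have h2 := hx.map_aeval_mul_freeWord hτ hL h (Polynomial.X * q.2)
        rw [freeWord_cons, map_mul (freeEval x), freeEval_aeval, ← mul_assoc]
        rwa [map_mul (Polynomial.aeval (x q.1)), Polynomial.aeval_X] at h2
      · exact hne hq

/-- The span contains 1, the empty word, and is stable under left multiplication by each generator:
the generator either merges with the leading letter of the same index or starts a new letter, and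
recentring costs only a shorter word. -/
lemma span_freeWord (hτ : τ 1 = 1) :
    Submodule.span ℂ (freeWord '' {L | IsAlternatingCentered τ x L}) =
      (⊤ : Submodule ℂ (FreeAlgebra ℂ (Fin r))) := by
  set S := Submodule.span ℂ (freeWord '' {L | IsAlternatingCentered τ x L}) with hS
  have hcons : ∀ (q : Fin r × Polynomial ℂ) (L), IsAlternatingCentered τ x (q :: L) →
      ∀ Q : Polynomial ℂ, Polynomial.aeval (FreeAlgebra.ι ℂ q.1) Q * freeWord L ∈ S := by
    intro q L h Q
    have h1 := IsAlternatingCentered.replace (L := []) h (map_aeval_sub_C hτ (x q.1) Q)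
    have h2 : freeWord ((q.1, Q - Polynomial.C (τ (Polynomial.aeval (x q.1) Q))) :: L) +
        τ (Polynomial.aeval (x q.1) Q) • freeWord L =
        Polynomial.aeval (FreeAlgebra.ι ℂ q.1) Q * freeWord L := by
      rw [freeWord_cons, map_sub, Polynomial.aeval_C, sub_mul, ← Algebra.smul_def,
        sub_add_cancel]
    rw [← h2]
    exact S.add_mem (Submodule.subset_span ⟨_, h1, rfl⟩)
      (S.smul_mem _ (Submodule.subset_span ⟨_, h.of_cons, rfl⟩))
  have hgen : ∀ (p : Fin r), ∀ s ∈ S, FreeAlgebra.ι ℂ p * s ∈ S := by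
    intro p s hs
    induction hs using Submodule.span_induction with
    | mem s hs =>
      obtain ⟨L, hL, rfl⟩ := hs
      have hnew : IsAlternatingCentered τ x ((p, 0) :: L) →
          FreeAlgebra.ι ℂ p * freeWord L ∈ S := by
        intro h
        have := hcons (p, 0) L h Polynomial.X
        rwa [Polynomial.aeval_X] at this
      have hmem : ∀ q' ∈ (p, (0 : Polynomial ℂ)) :: L,
          τ (Polynomial.aeval (x q'.1) q'.2) = 0 := by
        intro q' hq'
        rcases List.mem_cons.1 hq' with rfl | hq'
        · simp
        · exact hL.2 q' hq'
      cases L with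
      | nil => exact hnew ⟨List.isChain_singleton _, hmem⟩
      | cons q L =>
        by_cases hq : p = q.1
        · have := hcons q L hL (Polynomial.X * q.2)
          rwa [map_mul, Polynomial.aeval_X, mul_assoc, ← freeWord_cons, ← hq] at this
        · exact hnew ⟨List.isChain_cons_cons.2 ⟨hq, hL.1⟩, hmem⟩
    | zero => rw [mul_zero]; exact S.zero_mem
    | add s t _ _ hs ht => rw [mul_add]; exact S.add_mem hs ht
    | smul z s _ hs => rw [mul_smul_comm]; exact S.smul_mem z hs
  have hall : ∀ f : FreeAlgebra ℂ (Fin r), ∀ s ∈ S, f * s ∈ S := by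
    intro f
    induction f using FreeAlgebra.induction with
    | grade0 z => intro s hs; rw [← Algebra.smul_def]; exact S.smul_mem z hs
    | grade1 p => exact hgen p
    | mul f g hf hg => intro s hs; rw [mul_assoc]; exact hf _ (hg s hs)
    | add f g hf hg => intro s hs; rw [add_mul]; exact S.add_mem (hf s hs) (hg s hs)
  rw [eq_top_iff]
  intro f _
  have h1 : (1 : FreeAlgebra ℂ (Fin r)) ∈ S :=
    Submodule.subset_span ⟨[], ⟨List.isChain_nil, by simp⟩, rfl⟩
  simpa using hall f 1 h1

/-- The Schwinger–Dyson equation of a semicircular system. -/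
theorem schwingerDyson (hτ : τ 1 = 1) (hx : IsSemicircularSystem τ x) (p : Fin r)
    (f : FreeAlgebra ℂ (Fin r)) :
    τ (x p * freeEval x f) = τ (freeDiff τ x p f 1) := by
  have hf : f ∈ Submodule.span ℂ (freeWord '' {L | IsAlternatingCentered τ x L}) := by
    rw [span_freeWord hτ]; trivial
  induction hf using Submodule.span_induction with
  | mem s hs =>
    obtain ⟨L, hL, rfl⟩ := hs
    exact map_mul_freeEval_freeWord hτ hx.free (hx.semicircular p) hL
  | zero => simp
  | add s t _ _ hs ht => rw [map_add, mul_add, map_add, hs, ht, map_add, LinearMap.add_apply,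
      map_add]
  | smul z s _ hs => rw [map_smul, mul_smul_comm, map_smul, hs, map_smul, LinearMap.smul_apply,
      map_smul]

end SchwingerDyson

/-! ### Schwinger–Dyson equation for powers of a linear matrix pencil -/

section MatrixSchwingerDyson

variable {B : Type*} [CStarAlgebra B] {m r : ℕ} {τ : B →ₗ[ℂ] ℂ} {x : Fin r → B}

/-- The linear noncommutative polynomial `a₀ ⊗ 1 + ∑ p, a p ⊗ X p`. -/
def linearPolynomial (a₀ : Matrix (Fin m) (Fin m) ℂ) (a : Fin r → Matrix (Fin m) (Fin m) ℂ) :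
    Matrix (Fin m) (Fin m) (FreeAlgebra ℂ (Fin r)) :=
  a₀.map (algebraMap ℂ _) + ∑ p, (a p).map fun z => z • FreeAlgebra.ι ℂ p

lemma linearPolynomial_map_freeEval (a₀ : Matrix (Fin m) (Fin m) ℂ)
    (a : Fin r → Matrix (Fin m) (Fin m) ℂ) :
    (linearPolynomial a₀ a).map (freeEval x) =
      matrixTensor a₀ 1 + ∑ p, matrixTensor (a p) (x p) := by
  ext i j
  simp [linearPolynomial, matrixTensor, Matrix.sum_apply, Algebra.algebraMap_eq_smul_one]

lemma linearPolynomial_map_freeDiff (a₀ : Matrix (Fin m) (Fin m) ℂ)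
    (a : Fin r → Matrix (Fin m) (Fin m) ℂ) (p : Fin r) :
    (linearPolynomial a₀ a).map (freeDiff τ x p) = (a p).map fun z => z • stateProj τ := by
  ext1 i j
  simp [linearPolynomial, Matrix.sum_apply, freeDiff_algebraMap, freeDiff_ι]

/-- The Leibniz rule for the `k`-th power of a matrix of noncommutative polynomials. The pencil is
linear, so its own difference quotient is the coefficient `a p` times the projection `b ↦ τ(b) 1`,
which separates the two remaining powers into two states. -/
theorem map_state_mul_pow (hτ : τ 1 = 1) (hx : IsSemicircularSystem τ x)
    (a₀ : Matrix (Fin m) (Fin m) ℂ) (a : Fin r → Matrix (Fin m) (Fin m) ℂ)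
    {T : Matrix (Fin m) (Fin m) B}
    (hT : T = matrixTensor a₀ 1 + ∑ p, matrixTensor (a p) (x p)) (p : Fin r) (k : ℕ) :
    (T ^ k).map (fun b => τ (x p * b)) =
      ∑ i ∈ Finset.range k, (T ^ i).map τ * a p * (T ^ (k - 1 - i)).map τ := by
  set f := linearPolynomial a₀ a
  have hTf : T = (freeEval x).mapMatrix f := by
    rw [hT, ← linearPolynomial_map_freeEval]; rfl
  have hpow : ∀ j, T ^ j = (f ^ j).map (freeEval x) := by
    intro j
    rw [hTf, ← map_pow]; rfl
  have hL := leibniz_pow (((Algebra.lmul ℂ B).comp (freeEval x)).mapMatrix (m := Fin m)).toRingHom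
    (fun M => M.map (freeDiff τ x p))
    (by
      ext1 i j
      rw [Matrix.map_apply, Matrix.one_apply]
      split_ifs
      · rw [freeDiff_one]; rfl
      · rw [map_zero]; rfl)
    (fun g h => by
      ext1 i j
      simp only [Matrix.map_apply, Matrix.mul_apply, Matrix.add_apply, map_sum, freeDiff_mul,
        Finset.sum_add_distrib]
      rfl) f k
  ext i j
  rw [Matrix.map_apply, hpow, Matrix.map_apply, schwingerDyson hτ hx]
  have h1 := congrArg (fun M : Matrix (Fin m) (Fin m) (Module.End ℂ B) => τ (M i j 1)) hL
  simp only [Matrix.map_apply] at h1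
  rw [h1, Matrix.sum_apply, LinearMap.sum_apply, map_sum, Matrix.sum_apply]
  refine Finset.sum_congr rfl fun u _ => ?_
  have h2 : ∀ j, (((Algebra.lmul ℂ B).comp (freeEval x)).mapMatrix (m := Fin m)).toRingHom f ^ j =
      (T ^ j).map (Algebra.lmul ℂ B) := by
    intro j
    rw [← map_pow, hpow]
    rfl
  rw [h2, h2, linearPolynomial_map_freeDiff]
  simp only [Matrix.mul_apply, Matrix.map_apply, LinearMap.sum_apply, Module.End.mul_apply,
    Algebra.coe_lmul_eq_mul, LinearMap.mul_apply', mul_one, map_sum, LinearMap.smul_apply,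
    stateProj_apply, Finset.sum_mul, mul_smul_comm, map_smul, smul_eq_mul]
  refine Finset.sum_congr rfl fun v _ => Finset.sum_congr rfl fun w _ => ?_
  ring

end MatrixSchwingerDyson

/-! ### The operator-valued Cauchy transform in the C*-algebra of matrices -/

section FreeResolvent

open scoped MatrixOrder

variable {B : Type*} [CStarAlgebra B] [PartialOrder B] [StarOrderedRing B] {m r : ℕ}
  {τ : B →ₗ[ℂ] ℂ} {x : Fin r → B}

lemma exists_eq_star_mul_self {A : Type*} [CStarAlgebra A] [PartialOrder A] [StarOrderedRing A]
    {a : A} (ha : 0 ≤ a) : ∃ d, a = star d * d :=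
  CStarAlgebra.nonneg_iff_eq_star_mul_self.1 ha

lemma IsFaithfulState.map_nonneg (hτ : IsFaithfulState τ) {b : B} (hb : 0 ≤ b) : 0 ≤ τ b := by
  obtain ⟨d, rfl⟩ := exists_eq_star_mul_self hb
  exact hτ.nonneg d

lemma IsFaithfulState.map_algebraMap (hτ : IsFaithfulState τ) (t : ℝ) :
    τ (algebraMap ℝ B t) = t := by
  rw [IsScalarTower.algebraMap_apply ℝ ℂ B, Algebra.algebraMap_eq_smul_one, map_smul, hτ.map_one]
  simp

lemma IsFaithfulState.im_map_of_isSelfAdjoint (hτ : IsFaithfulState τ) {b : B}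
    (hb : IsSelfAdjoint b) : (τ b).im = 0 ∧ ‖τ b‖ ≤ ‖b‖ := by
  have h1 := hτ.map_nonneg (sub_nonneg.2 hb.le_algebraMap_norm_self)
  have h2 := hτ.map_nonneg (sub_nonneg.2 hb.neg_algebraMap_norm_le_self)
  rw [map_sub, hτ.map_algebraMap, Complex.le_def] at h1
  rw [map_sub, map_neg, hτ.map_algebraMap, Complex.le_def] at h2
  simp only [Complex.zero_re, Complex.zero_im, Complex.sub_re, Complex.sub_im, Complex.neg_re,
    Complex.ofReal_re, Complex.ofReal_im, Complex.neg_im] at h1 h2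
  have h3 : (τ b).im = 0 := by linarith [h1.2]
  refine ⟨h3, ?_⟩
  rw [← Complex.re_add_im (τ b), h3]
  simp only [Complex.ofReal_zero, zero_mul, add_zero, Complex.norm_real, Real.norm_eq_abs]
  exact abs_le.2 ⟨by linarith [h2.1], by linarith [h1.1]⟩

/-- Real and imaginary parts are bounded separately, whence the factor 2; the sharp constant is not
needed, only boundedness. -/
lemma IsFaithfulState.norm_map_le (hτ : IsFaithfulState τ) (b : B) : ‖τ b‖ ≤ 2 * ‖b‖ := by
  conv_lhs => rw [← realPart_add_I_smul_imaginaryPart b]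
  rw [map_add, map_smul]
  refine (norm_add_le _ _).trans ?_
  rw [norm_smul, Complex.norm_I, one_mul, two_mul]
  exact add_le_add
    ((hτ.im_map_of_isSelfAdjoint (ℜ b).2).2.trans (realPart.norm_le b))
    ((hτ.im_map_of_isSelfAdjoint (ℑ b).2).2.trans (imaginaryPart.norm_le b))

lemma IsFaithfulState.map_star (hτ : IsFaithfulState τ) (b : B) : τ (star b) = star (τ b) := by
  have h1 := Complex.conj_eq_iff_im.2 (hτ.im_map_of_isSelfAdjoint (ℜ b).2).1
  have h2 := Complex.conj_eq_iff_im.2 (hτ.im_map_of_isSelfAdjoint (ℑ b).2).1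
  rw [← realPart_add_I_smul_imaginaryPart b]
  rw [star_add, star_smul, (ℜ b).2.star_eq, (ℑ b).2.star_eq, map_add, map_add, map_smul, map_smul,
    star_add, star_smul, Complex.star_def, h1, h2]

variable (B m) in
/-- The embedding `M_m(ℂ) → M_m(ℂ) ⊗ B`. -/
def scalarMatrix : Matrix (Fin m) (Fin m) ℂ →⋆ₐ[ℂ] CStarMatrix (Fin m) (Fin m) B where
  toFun l := CStarMatrix.ofMatrix (l.map (algebraMap ℂ B))
  map_one' := (algebraMap ℂ B).mapMatrix.map_one
  map_mul' := (algebraMap ℂ B).mapMatrix.map_mul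
  map_zero' := (algebraMap ℂ B).mapMatrix.map_zero
  map_add' := (algebraMap ℂ B).mapMatrix.map_add
  commutes' z := (Algebra.ofId ℂ B).mapMatrix.commutes z
  map_star' l := by
    ext i j
    exact algebraMap_star_comm (l j i)

lemma scalarMatrix_apply (l : Matrix (Fin m) (Fin m) ℂ) (i j : Fin m) :
    scalarMatrix B m l i j = algebraMap ℂ B (l i j) := rfl

/-- `id ⊗ τ` as a continuous linear map. -/
def IsFaithfulState.matrixState (hτ : IsFaithfulState τ) (m : ℕ) :
    CStarMatrix (Fin m) (Fin m) B →L[ℂ] Matrix (Fin m) (Fin m) ℂ :=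
  LinearMap.mkContinuous
    { toFun := fun M => Matrix.of fun i j => τ (M i j)
      map_add' := fun M N => by ext i j; simp
      map_smul' := fun z M => by ext i j; simp }
    (2 * (m : ℝ) ^ 2) fun M => by
      refine (norm_le_sum_norm _).trans ?_
      calc _ ≤ ∑ _i : Fin m, ∑ _j : Fin m, 2 * ‖M‖ := by
            gcongr with i _ j _
            exact (hτ.norm_map_le _).trans (by gcongr; exact CStarMatrix.norm_entry_le_norm)
        _ = _ := by simp; ring

lemma IsFaithfulState.matrixState_apply (hτ : IsFaithfulState τ)
    (M : CStarMatrix (Fin m) (Fin m) B) (i j : Fin m) : hτ.matrixState m M i j = τ (M i j) := rfl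

lemma IsFaithfulState.norm_matrixState_le (hτ : IsFaithfulState τ)
    (M : CStarMatrix (Fin m) (Fin m) B) : ‖hτ.matrixState m M‖ ≤ 2 * (m : ℝ) ^ 2 * ‖M‖ :=
  ((hτ.matrixState m).le_opNorm M).trans (mul_le_mul_of_nonneg_right
    (LinearMap.mkContinuous_norm_le _ (by positivity) _) (norm_nonneg _))

lemma IsFaithfulState.matrixState_scalarMatrix_mul (hτ : IsFaithfulState τ)
    (l : Matrix (Fin m) (Fin m) ℂ) (M : CStarMatrix (Fin m) (Fin m) B) :
    hτ.matrixState m (scalarMatrix B m l * M) = l * hτ.matrixState m M := by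
  ext i j
  rw [hτ.matrixState_apply, CStarMatrix.mul_apply, map_sum, Matrix.mul_apply]
  refine Finset.sum_congr rfl fun k _ => ?_
  rw [scalarMatrix_apply, ← Algebra.smul_def, map_smul, hτ.matrixState_apply, smul_eq_mul]

lemma IsFaithfulState.matrixState_one (hτ : IsFaithfulState τ) : hτ.matrixState m (1 :
    CStarMatrix (Fin m) (Fin m) B) = 1 := by
  ext i j
  rw [hτ.matrixState_apply, CStarMatrix.one_apply, Matrix.one_apply]
  split_ifs
  · exact hτ.map_one
  · exact map_zero τ

lemma IsFaithfulState.matrixState_star (hτ : IsFaithfulState τ)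
    (M : CStarMatrix (Fin m) (Fin m) B) :
    hτ.matrixState m (star M) = star (hτ.matrixState m M) := by
  ext i j
  exact hτ.map_star (M j i)

lemma IsFaithfulState.imaginaryPart_matrixState (hτ : IsFaithfulState τ)
    (M : CStarMatrix (Fin m) (Fin m) B) :
    (ℑ (hτ.matrixState m M) : Matrix (Fin m) (Fin m) ℂ) =
      hτ.matrixState m (ℑ M : CStarMatrix (Fin m) (Fin m) B) := by
  apply imaginaryPart_eq_of_sub_star
  rw [← hτ.matrixState_star, ← map_sub, ← two_I_smul_imaginaryPart, map_smul]

/-- Complete positivity of the state: on a vector `u`, the form of `id ⊗ τ` at `N* N` is a sum of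
values `τ(d* d)`, one for each row of `N`. -/
lemma IsFaithfulState.matrixState_nonneg (hτ : IsFaithfulState τ)
    {M : CStarMatrix (Fin m) (Fin m) B} (hM : 0 ≤ M) : 0 ≤ hτ.matrixState m M := by
  obtain ⟨N, rfl⟩ := exists_eq_star_mul_self hM
  rw [Matrix.nonneg_iff_posSemidef, Matrix.posSemidef_iff_dotProduct_mulVec]
  refine ⟨?_, fun u => ?_⟩
  · rw [Matrix.IsHermitian, ← Matrix.star_eq_conjTranspose, ← hτ.matrixState_star, star_mul,
      star_star]
  have h1 : star u ⬝ᵥ hτ.matrixState m (star N * N) *ᵥ u =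
      ∑ k, τ (star (∑ i, u i • N k i) * ∑ i, u i • N k i) := by
    simp only [dotProduct, Matrix.mulVec, hτ.matrixState_apply, CStarMatrix.mul_apply,
      CStarMatrix.star_apply, map_sum, star_sum, star_smul, Finset.sum_mul, Finset.mul_sum,
      smul_mul_assoc, mul_smul_comm, map_smul, smul_eq_mul, Pi.star_apply]
    refine (Finset.sum_congr rfl fun i _ => Finset.sum_comm).trans ?_
    rw [Finset.sum_comm]
    refine Finset.sum_congr rfl fun k _ => ?_
    rw [Finset.sum_comm]
    refine Finset.sum_congr rfl fun j _ => Finset.sum_congr rfl fun i _ => ?_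
    ring
  rw [h1]
  exact Finset.sum_nonneg fun k _ => hτ.nonneg _

lemma imaginaryPart_scalarMatrix (l : Matrix (Fin m) (Fin m) ℂ) :
    (ℑ (scalarMatrix B m l) : CStarMatrix (Fin m) (Fin m) B) =
      scalarMatrix B m (ℑ l : Matrix (Fin m) (Fin m) ℂ) := by
  apply imaginaryPart_eq_of_sub_star
  rw [← map_star, ← map_sub, ← two_I_smul_imaginaryPart, map_smul]

/-- `1 ⊗ b`. -/
def diagonalTensor (m : ℕ) (b : B) : CStarMatrix (Fin m) (Fin m) B :=
  CStarMatrix.ofMatrix (Matrix.diagonal fun _ => b)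

lemma diagonalTensor_mul_apply (b : B) (M : CStarMatrix (Fin m) (Fin m) B) (i j : Fin m) :
    (diagonalTensor m b * M) i j = b * M i j :=
  Matrix.diagonal_mul (fun _ : Fin m => b) (M : Matrix (Fin m) (Fin m) B) i j

lemma scalarMatrix_mul_diagonalTensor (l : Matrix (Fin m) (Fin m) ℂ) (b : B) :
    scalarMatrix B m l * diagonalTensor m b = CStarMatrix.ofMatrix (matrixTensor l b) := by
  ext i j
  refine (Matrix.mul_diagonal (fun _ : Fin m => b) (l.map (algebraMap ℂ B)) i j).trans ?_
  exact (Algebra.smul_def _ _).symm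

/-- `∑ p, a p ⊗ x p`. -/
def freeSum (a : Fin r → Matrix (Fin m) (Fin m) ℂ) (x : Fin r → B) :
    CStarMatrix (Fin m) (Fin m) B :=
  ∑ p, scalarMatrix B m (a p) * diagonalTensor m (x p)

/-- `(L ⊗ 1 - ∑ p, a p ⊗ x p)⁻¹`. -/
def freeResolvent (L : Matrix (Fin m) (Fin m) ℂ) (a : Fin r → Matrix (Fin m) (Fin m) ℂ)
    (x : Fin r → B) : CStarMatrix (Fin m) (Fin m) B :=
  Ring.inverse (scalarMatrix B m L - freeSum a x)

lemma ofMatrix_freePencil (a₀ : Matrix (Fin m) (Fin m) ℂ) (a : Fin r → Matrix (Fin m) (Fin m) ℂ)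
    (l : Matrix (Fin m) (Fin m) ℂ) : CStarMatrix.ofMatrix (freePencil a₀ a x l) =
      scalarMatrix B m (l - a₀) - freeSum a x := by
  have h1 : ∀ l : Matrix (Fin m) (Fin m) ℂ,
      CStarMatrix.ofMatrix (matrixTensor l (1 : B)) = scalarMatrix B m l := by
    intro l
    ext i j
    exact (Algebra.algebraMap_eq_smul_one _).symm
  rw [map_sub, ← h1, ← h1, freeSum]
  simp only [scalarMatrix_mul_diagonalTensor, freePencil]
  rw [sub_sub]
  congr 2

lemma isSelfAdjoint_freeSum {a : Fin r → Matrix (Fin m) (Fin m) ℂ} (ha : ∀ p, (a p).IsHermitian)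
    (hx : ∀ p, IsSelfAdjoint (x p)) : IsSelfAdjoint (freeSum a x) := by
  refine isSelfAdjoint_sum _ fun p _ => ?_
  rw [scalarMatrix_mul_diagonalTensor]
  ext i j
  change star (a p j i • x p) = a p i j • x p
  rw [star_smul, (hx p).star_eq, (ha p).apply]

variable {L : Matrix (Fin m) (Fin m) ℂ} {a : Fin r → Matrix (Fin m) (Fin m) ℂ} {c : ℝ}

lemma le_imaginaryPart_scalarMatrix_sub_freeSum (ha : ∀ p, (a p).IsHermitian)
    (hx : ∀ p, IsSelfAdjoint (x p)) (hL : algebraMap ℝ _ c ≤ (ℑ L : Matrix (Fin m) (Fin m) ℂ)) :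
    algebraMap ℝ _ c ≤
      (ℑ (scalarMatrix B m L - freeSum a x) : CStarMatrix (Fin m) (Fin m) B) := by
  rw [map_sub, AddSubgroupClass.coe_sub, (isSelfAdjoint_freeSum ha hx).imaginaryPart,
    ZeroMemClass.coe_zero, sub_zero, imaginaryPart_scalarMatrix]
  refine le_trans (le_of_eq ?_) (OrderHomClass.mono (scalarMatrix B m) hL)
  rw [IsScalarTower.algebraMap_apply ℝ ℂ, IsScalarTower.algebraMap_apply ℝ ℂ (Matrix _ _ ℂ)]
  exact ((scalarMatrix B m).toAlgHom.commutes _).symm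

lemma isUnit_scalarMatrix_sub_freeSum (ha : ∀ p, (a p).IsHermitian)
    (hx : ∀ p, IsSelfAdjoint (x p)) (hc : 0 < c)
    (hL : algebraMap ℝ _ c ≤ (ℑ L : Matrix (Fin m) (Fin m) ℂ)) :
    IsUnit (scalarMatrix B m L - freeSum a x) :=
  isUnit_of_le_imaginaryPart hc (le_imaginaryPart_scalarMatrix_sub_freeSum ha hx hL)

lemma norm_freeResolvent_le (ha : ∀ p, (a p).IsHermitian)
    (hx : ∀ p, IsSelfAdjoint (x p)) (hc : 0 < c)
    (hL : algebraMap ℝ _ c ≤ (ℑ L : Matrix (Fin m) (Fin m) ℂ)) :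
    ‖freeResolvent L a x‖ ≤ c⁻¹ :=
  norm_ringInverse_le hc (le_imaginaryPart_scalarMatrix_sub_freeSum ha hx hL)

lemma norm_freeResolvent_sub_le (ha : ∀ p, (a p).IsHermitian)
    (hx : ∀ p, IsSelfAdjoint (x p)) (hc : 0 < c)
    (hL : algebraMap ℝ _ c ≤ (ℑ L : Matrix (Fin m) (Fin m) ℂ)) {c' : ℝ} (hc' : 0 < c')
    {L' : Matrix (Fin m) (Fin m) ℂ}
    (hL' : algebraMap ℝ _ c' ≤ (ℑ L' : Matrix (Fin m) (Fin m) ℂ)) :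
    ‖freeResolvent L a x - freeResolvent L' a x‖ ≤ c'⁻¹ * ‖L' - L‖ * c⁻¹ := by
  have h1 := ringInverse_sub_ringInverse (isUnit_scalarMatrix_sub_freeSum ha hx hc hL)
    (isUnit_scalarMatrix_sub_freeSum ha hx hc' hL')
  rw [sub_sub_sub_cancel_right, ← map_sub] at h1
  change freeResolvent L a x - freeResolvent L' a x =
    freeResolvent L' a x * scalarMatrix B m (L' - L) * freeResolvent L a x at h1
  rw [h1]
  refine norm_mul₃_le.trans ?_
  gcongr
  · exact norm_freeResolvent_le ha hx hc' hL'
  · exact NonUnitalStarAlgHom.norm_apply_le (scalarMatrix B m) _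
  · exact norm_freeResolvent_le ha hx hc hL

lemma IsFaithfulState.imaginaryPart_matrixState_freeResolvent (hτ : IsFaithfulState τ)
    (ha : ∀ p, (a p).IsHermitian) (hx : ∀ p, IsSelfAdjoint (x p)) (hc : 0 < c)
    (hL : algebraMap ℝ _ c ≤ (ℑ L : Matrix (Fin m) (Fin m) ℂ)) :
    (ℑ (hτ.matrixState m (freeResolvent L a x)) : Matrix (Fin m) (Fin m) ℂ) ≤ 0 := by
  have h0 : (0 : CStarMatrix (Fin m) (Fin m) B) ≤ algebraMap ℝ _ c := algebraMap_nonneg _ hc.le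
  have h1 := imaginaryPart_ringInverse_nonpos (isUnit_scalarMatrix_sub_freeSum ha hx hc hL)
    (h0.trans (le_imaginaryPart_scalarMatrix_sub_freeSum ha hx hL))
  rw [hτ.imaginaryPart_matrixState, ← neg_nonneg, ← map_neg]
  exact hτ.matrixState_nonneg (neg_nonneg.2 h1)

end FreeResolvent

/-! ### Dyson equation for the free model -/

section FreeDyson

open scoped MatrixOrder

lemma ringInverse_smul_one_sub {A : Type*} [NormedRing A] [NormedAlgebra ℂ A] [CompleteSpace A]
    {T : A} {z : ℂ} (hz : ‖T‖ < ‖z‖) :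
    Ring.inverse (z • 1 - T) = z⁻¹ • ∑' k, (z⁻¹ • T) ^ k := by
  have hz0 : z ≠ 0 := norm_pos_iff.1 ((norm_nonneg _).trans_lt hz)
  have h1 : ‖z⁻¹ • T‖ < 1 := by
    rw [norm_smul, norm_inv, inv_mul_lt_iff₀ (norm_pos_iff.2 hz0), mul_one]
    exact hz
  have hT : z • 1 - T = z • (1 - z⁻¹ • T) := by
    rw [smul_sub, smul_inv_smul₀ hz0]
  have h2 : (z⁻¹ • ∑' k, (z⁻¹ • T) ^ k) * (z • 1 - T) = 1 := by
    rw [hT, smul_mul_smul_comm, geom_series_mul_neg _ h1, inv_mul_cancel₀ hz0, one_smul]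
  have h3 : (z • 1 - T) * (z⁻¹ • ∑' k, (z⁻¹ • T) ^ k) = 1 := by
    rw [hT, smul_mul_smul_comm, mul_neg_geom_series _ h1, mul_inv_cancel₀ hz0, one_smul]
  exact Ring.inverse_unit (⟨_, _, h3, h2⟩ : Aˣ)

variable {B : Type*} [CStarAlgebra B] [PartialOrder B] [StarOrderedRing B] {m r : ℕ}
  {τ : B →ₗ[ℂ] ℂ} {x : Fin r → B} {L : Matrix (Fin m) (Fin m) ℂ}
  {a : Fin r → Matrix (Fin m) (Fin m) ℂ} {c : ℝ}

lemma IsFaithfulState.matrixState_diagonalTensor_mul_pow (hτ : IsFaithfulState τ)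
    (hx : IsSemicircularSystem τ x) (p : Fin r) (k : ℕ) :
    hτ.matrixState m (diagonalTensor m (x p) * (freeSum a x - scalarMatrix B m L) ^ k) =
      ∑ i ∈ Finset.range k, hτ.matrixState m ((freeSum a x - scalarMatrix B m L) ^ i) * a p *
        hτ.matrixState m ((freeSum a x - scalarMatrix B m L) ^ (k - 1 - i)) := by
  have hT : CStarMatrix.ofMatrix.symm (freeSum a x - scalarMatrix B m L) =
      matrixTensor (-L) 1 + ∑ p, matrixTensor (a p) (x p) := by
    have h := ofMatrix_freePencil (x := x) (-L) a 0
    rw [zero_sub, neg_neg] at h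
    rw [← neg_sub, ← h]
    change -(freePencil (-L) a x 0) = _
    rw [freePencil, neg_sub]
    ext i j
    simp [matrixTensor]
  have h := map_state_mul_pow hτ.map_one hx (-L) a hT p k
  have h2 : hτ.matrixState m (diagonalTensor m (x p) * (freeSum a x - scalarMatrix B m L) ^ k) =
      Matrix.map (CStarMatrix.ofMatrix.symm (freeSum a x - scalarMatrix B m L) ^ k)
        (fun b => τ (x p * b)) := by
    ext i j
    rw [hτ.matrixState_apply, diagonalTensor_mul_apply]
    rfl
  rw [h2, h]
  rfl

lemma scalarMatrix_add_smul_one (z : ℂ) :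
    scalarMatrix B m (L + z • 1) = scalarMatrix B m L + z • 1 := by
  rw [map_add, map_smul]
  congr 2
  exact (scalarMatrix B m).map_one'

/-- In the Neumann series, the Schwinger–Dyson equation for powers becomes a Cauchy product, so that
`E(x_p R) = E(R) a_p E(R)` for `E = id ⊗ τ`. Applying `E` to `(L + z - ∑ a_p ⊗ x_p) R = 1` then
gives the Dyson equation. -/
lemma IsFaithfulState.dyson_of_norm_lt (hτ : IsFaithfulState τ) (hx : IsSemicircularSystem τ x)
    {z : ℂ} (hz : ‖freeSum a x - scalarMatrix B m L‖ < ‖z‖)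
    (hu : IsUnit (scalarMatrix B m (L + z • 1) - freeSum a x)) :
    (L + z • 1 - covarianceMap a (hτ.matrixState m (freeResolvent (L + z • 1) a x))) *
      hτ.matrixState m (freeResolvent (L + z • 1) a x) = 1 := by
  set T := freeSum a x - scalarMatrix B m L with hT
  set E := hτ.matrixState m
  set R := freeResolvent (L + z • 1) a x with hR
  have hpen : scalarMatrix B m (L + z • 1) - freeSum a x = z • 1 - T := by
    rw [scalarMatrix_add_smul_one, hT]
    abel
  have hRs : R = z⁻¹ • ∑' k, (z⁻¹ • T) ^ k := by
    rw [hR, freeResolvent, hpen, ringInverse_smul_one_sub hz]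
  have hz0 : z ≠ 0 := norm_pos_iff.1 ((norm_nonneg _).trans_lt hz)
  have h1 : ‖z⁻¹ • T‖ < 1 := by
    rw [norm_smul, norm_inv, inv_mul_lt_iff₀ (norm_pos_iff.2 hz0), mul_one]
    exact hz
  have hsum : Summable fun k => (z⁻¹ • T) ^ k := summable_geometric_of_norm_lt_one h1
  have hnsum : Summable fun k => ‖(z⁻¹ • T) ^ k‖ := summable_norm_geometric_of_norm_lt_one h1
  have hEn : Summable fun k => ‖E ((z⁻¹ • T) ^ k)‖ :=
    Summable.of_nonneg_of_le (fun _ => norm_nonneg _) (fun k => hτ.norm_matrixState_le _)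
      (hnsum.mul_left _)
  have hER : E R = z⁻¹ • ∑' k, E ((z⁻¹ • T) ^ k) := by
    rw [hRs, map_smul, ContinuousLinearMap.map_tsum _ hsum]
  have hp : ∀ p, E (diagonalTensor m (x p) * R) = E R * a p * E R := by
    intro p
    have e1 : E (diagonalTensor m (x p) * R) =
        z⁻¹ • ∑' k, E (diagonalTensor m (x p) * (z⁻¹ • T) ^ k) := by
      rw [hRs, mul_smul_comm, map_smul, ← hsum.tsum_mul_left,
        ContinuousLinearMap.map_tsum _ (hsum.mul_left _)]
    have e2 : ∀ k, E (diagonalTensor m (x p) * (z⁻¹ • T) ^ k) = ∑ i ∈ Finset.range k,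
        z⁻¹ • (E ((z⁻¹ • T) ^ i) * a p * E ((z⁻¹ • T) ^ (k - 1 - i))) := by
      intro k
      rw [smul_pow, mul_smul_comm, map_smul, hτ.matrixState_diagonalTensor_mul_pow hx,
        Finset.smul_sum]
      refine Finset.sum_congr rfl fun i hi => ?_
      have hi' := Finset.mem_range.1 hi
      rw [smul_pow, smul_pow, map_smul, map_smul, smul_mul_assoc, smul_mul_smul_comm, smul_smul]
      congr 1
      rw [← pow_add, ← pow_succ']
      congr 1
      omega
    have e3 : Summable fun k => E (diagonalTensor m (x p) * (z⁻¹ • T) ^ k) :=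
      ((hsum.mul_left _).map E E.continuous)
    have e4 : Summable fun k => ‖E ((z⁻¹ • T) ^ k) * a p‖ :=
      Summable.of_nonneg_of_le (fun _ => norm_nonneg _) (fun k => norm_mul_le _ _)
        (hEn.mul_right _)
    have e5 := tsum_mul_tsum_eq_tsum_sum_antidiagonal_of_summable_norm e4 hEn
    -- The term `k = 0` is an empty sum. Dropping it shifts the index, so the truncated subtraction
    -- `k - 1` becomes exact and the inner sums run over antidiagonals.
    rw [e1, e3.tsum_eq_zero_add, hER]
    simp only [e2, Finset.range_zero, Finset.sum_empty, zero_add, Nat.add_sub_cancel]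
    simp only [Finset.Nat.sum_antidiagonal_eq_sum_range_succ_mk] at e5
    rw [smul_mul_assoc, smul_mul_smul_comm, ← hEn.of_norm.tsum_mul_right, e5, ← smul_smul]
    congr 1
    simp only [← Finset.smul_sum]
    rw [tsum_const_smul'']
  have hinv : (scalarMatrix B m (L + z • 1) - freeSum a x) * R = 1 :=
    Ring.mul_inverse_cancel _ hu
  have hE : ∀ l M, E (scalarMatrix B m l * M) = l * E M := hτ.matrixState_scalarMatrix_mul
  have h2 := congrArg E hinv
  rw [hτ.matrixState_one, sub_mul, map_sub, hE, freeSum, Finset.sum_mul, map_sum] at h2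
  refine Eq.trans ?_ h2
  rw [sub_mul, covarianceMap_apply, Finset.sum_mul]
  congr 1
  refine Finset.sum_congr rfl fun p _ => ?_
  rw [mul_assoc (scalarMatrix B m (a p)), hE, hp]
  simp only [mul_assoc]

lemma imaginaryPart_add_smul_one (hL : algebraMap ℝ _ c ≤ (ℑ L : Matrix (Fin m) (Fin m) ℂ))
    (z : ℂ) : algebraMap ℝ _ (c + z.im) ≤
      (ℑ (L + z • (1 : Matrix (Fin m) (Fin m) ℂ)) : Matrix (Fin m) (Fin m) ℂ) := by
  have h1 : (ℑ (z • (1 : Matrix (Fin m) (Fin m) ℂ)) : Matrix (Fin m) (Fin m) ℂ) =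
      algebraMap ℝ _ z.im := by
    apply imaginaryPart_eq_of_sub_star
    rw [star_smul, star_one, ← sub_smul, Algebra.algebraMap_eq_smul_one, ← Complex.coe_smul,
      smul_smul, Complex.star_def, Complex.sub_conj]
    congr 1
    push_cast
    ring
  rw [map_add, map_add, AddMemClass.coe_add, h1]
  gcongr

/-- The Dyson equation for the operator-valued Cauchy transform of a semicircular system. -/
theorem IsFaithfulState.dyson (hτ : IsFaithfulState τ) (hx : IsSemicircularSystem τ x)
    (ha : ∀ p, (a p).IsHermitian) (hc : 0 < c)
    (hL : algebraMap ℝ _ c ≤ (ℑ L : Matrix (Fin m) (Fin m) ℂ)) :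
    (L - covarianceMap a (hτ.matrixState m (freeResolvent L a x))) *
      hτ.matrixState m (freeResolvent L a x) = 1 := by
  -- On this half-plane `L + z` keeps a positive imaginary part, so the Cauchy transform is analytic
  -- there. It contains both 0 and points `it` where the Neumann series converges.
  set U : Set ℂ := {z | -c < z.im} with hU
  have hUo : IsOpen U := isOpen_lt continuous_const Complex.continuous_im
  have hUc : IsPreconnected U := (convex_halfSpace_im_gt (-c)).isPreconnected
  have hu : ∀ z ∈ U, IsUnit (scalarMatrix B m (L + z • 1) - freeSum a x) := fun z hz =>
    isUnit_scalarMatrix_sub_freeSum ha hx.isSelfAdjoint (by have : -c < z.im := hz; linarith)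
      (imaginaryPart_add_smul_one hL z)
  have hlin : ∀ z : ℂ, scalarMatrix B m (L + z • 1) - freeSum a x =
      z • 1 + (scalarMatrix B m L - freeSum a x) := by
    intro z
    rw [scalarMatrix_add_smul_one]
    abel
  have hg : DifferentiableOn ℂ
      (fun z : ℂ => hτ.matrixState m (freeResolvent (L + z • 1) a x)) U := by
    intro z hz
    refine DifferentiableAt.differentiableWithinAt ?_
    have h1 : DifferentiableAt ℂ (fun z : ℂ => scalarMatrix B m (L + z • 1) - freeSum a x) z := by
      simp only [hlin]
      fun_prop
    have h2 : DifferentiableAt ℂ Ring.inverse (scalarMatrix B m (L + z • 1) - freeSum a x) :=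
      differentiableAt_inverse (hu z hz)
    exact (hτ.matrixState m).differentiableAt.comp z (h2.comp z h1)
  set g := fun z : ℂ => hτ.matrixState m (freeResolvent (L + z • 1) a x)
  have hF : DifferentiableOn ℂ (fun z : ℂ => (L + z • 1 - covarianceMap a (g z)) * g z) U := by
    simp only [covarianceMap_apply]
    fun_prop
  set t := ‖freeSum a x - scalarMatrix B m L‖ + 1
  have ht : 0 < t := by positivity
  have hz₀ : (t * Complex.I : ℂ) ∈ U := by
    simp only [hU, Set.mem_ofPred_eq, Complex.mul_im, Complex.ofReal_re, Complex.I_im,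
      Complex.ofReal_im, Complex.I_re]
    linarith
  have hlt : ‖freeSum a x - scalarMatrix B m L‖ < ‖(t * Complex.I : ℂ)‖ := by
    rw [norm_mul, Complex.norm_I, mul_one, Complex.norm_real, Real.norm_of_nonneg ht.le]
    exact lt_add_one _
  have hev : (fun z : ℂ => (L + z • 1 - covarianceMap a (g z)) * g z)
      =ᶠ[nhds (t * Complex.I : ℂ)] fun _ => 1 := by
    filter_upwards [hUo.mem_nhds hz₀, (isOpen_lt continuous_const continuous_norm).mem_nhds hlt]
      with z hz hz'
    exact hτ.dyson_of_norm_lt hx hz' (hu z hz)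
  have h0 : (0 : ℂ) ∈ U := by simpa [hU] using hc
  have key := (hF.analyticOnNhd hUo).eqOn_of_preconnected_of_eventuallyEq
    analyticOnNhd_const hUc hz₀ hev h0
  simpa [g] using key

end FreeDyson

/-! ### Stability of the Dyson equation -/

section Comparison

open scoped MatrixOrder

variable {m n r : ℕ} {L : Matrix (Fin m) (Fin m) ℂ} {a : Fin r → Matrix (Fin m) (Fin m) ℂ}
  {c q D : ℝ} {b : Matrix (Fin m) (Fin m) ℂ}

lemma imaginaryPart_le_algebraMap_norm {A : Type*} [CStarAlgebra A] [PartialOrder A]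
    [StarOrderedRing A] (w : A) : (ℑ w : A) ≤ algebraMap ℝ A ‖w‖ :=
  (IsSelfAdjoint.le_algebraMap_norm_self (ℑ w).2).trans
    (algebraMap_mono A (imaginaryPart.norm_le w))

lemma posDef_of_algebraMap_le {k : Matrix (Fin m) (Fin m) ℂ} (hc : 0 < c)
    (hk : algebraMap ℝ _ c ≤ k) : k.PosDef := by
  have h1 : (algebraMap ℝ (Matrix (Fin m) (Fin m) ℂ) c).PosDef := by
    rw [Algebra.algebraMap_eq_smul_one]
    exact Matrix.PosDef.one.smul hc
  have h2 := h1.add_posSemidef (Matrix.le_iff.1 hk)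
  rwa [add_sub_cancel] at h2

lemma norm_average_sub_le (hn : 1 ≤ n) {H : Fin n → Matrix (Fin m) (Fin m) ℂ}
    {g : Matrix (Fin m) (Fin m) ℂ} {δ : ℝ} (h : ∀ k, ‖H k - g‖ ≤ δ) :
    ‖(n : ℝ)⁻¹ • ∑ k, H k - g‖ ≤ δ := by
  have hn0 : (0 : ℝ) < n := by exact_mod_cast hn
  have h1 : (n : ℝ)⁻¹ • ∑ k, H k - g = (n : ℝ)⁻¹ • ∑ k, (H k - g) := by
    rw [Finset.sum_sub_distrib, smul_sub, Finset.sum_const, Finset.card_univ, Fintype.card_fin,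
      ← Nat.cast_smul_eq_nsmul ℝ, inv_smul_smul₀ hn0.ne']
  rw [h1, norm_smul, Real.norm_of_nonneg (by positivity), inv_mul_le_iff₀ hn0]
  refine (norm_sum_le _ _).trans ((Finset.sum_le_sum fun k _ => h k).trans (le_of_eq ?_))
  simp

lemma norm_conj_sub_conj_le {g h : Matrix (Fin m) (Fin m) ℂ} {M δ : ℝ} (hM : 0 ≤ M)
    (hg : ‖g‖ ≤ M) (hh : ‖h‖ ≤ M) (hgh : ‖g - h‖ ≤ δ) :
    ‖g * b * g - h * b * h‖ ≤ 2 * M * ‖b‖ * δ := by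
  have h1 : g * b * g - h * b * h = (g - h) * b * g + h * b * (g - h) := by noncomm_ring
  rw [h1]
  calc _ ≤ ‖g - h‖ * ‖b‖ * ‖g‖ + ‖h‖ * ‖b‖ * ‖g - h‖ :=
        (norm_add_le _ _).trans (add_le_add norm_mul₃_le norm_mul₃_le)
    _ ≤ δ * ‖b‖ * M + M * ‖b‖ * δ := by
        have := (norm_nonneg _).trans hgh
        gcongr
    _ = _ := by ring

/-- The properties of the operator-valued Cauchy transform used in the comparison. -/
structure IsDysonSolution (a : Fin r → Matrix (Fin m) (Fin m) ℂ) (q : ℝ)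
    (G : Matrix (Fin m) (Fin m) ℂ → Matrix (Fin m) (Fin m) ℂ) : Prop where
  dyson : ∀ L (c : ℝ), 0 < c → algebraMap ℝ _ c ≤ (ℑ L : Matrix (Fin m) (Fin m) ℂ) →
    (L - covarianceMap a (G L)) * G L = 1
  imaginaryPart_nonpos : ∀ L (c : ℝ), 0 < c →
    algebraMap ℝ _ c ≤ (ℑ L : Matrix (Fin m) (Fin m) ℂ) →
    (ℑ (G L) : Matrix (Fin m) (Fin m) ℂ) ≤ 0
  norm_le : ∀ L (c : ℝ), 0 < c → algebraMap ℝ _ c ≤ (ℑ L : Matrix (Fin m) (Fin m) ℂ) →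
    ‖G L‖ ≤ q * c⁻¹
  norm_sub_le : ∀ L (c : ℝ), 0 < c → algebraMap ℝ _ c ≤ (ℑ L : Matrix (Fin m) (Fin m) ℂ) →
    ∀ L' (c' : ℝ), 0 < c' → algebraMap ℝ _ c' ≤ (ℑ L' : Matrix (Fin m) (Fin m) ℂ) →
    ‖G L - G L'‖ ≤ q * (c'⁻¹ * ‖L' - L‖ * c⁻¹)

/-- The inverse `H'` of `W = L - η(Hm)` is close to every `H k`, hence to their mean `Hm`. It
satisfies the exact equation at the shifted point `L' = L - η(Hm - H')`, since `L' - η(H') = W`.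
Uniqueness identifies it with `G L'`, and the Lipschitz bound for `G` compares `G L'` with `G L`. -/
lemma IsDysonSolution.norm_sub_le_of_approx {G : Matrix (Fin m) (Fin m) ℂ → Matrix (Fin m) (Fin m) ℂ}
    (hG : IsDysonSolution a q G) (ha : ∀ p, (a p).IsHermitian) (hn : 1 ≤ n) (hc : 0 < c)
    (hL : algebraMap ℝ _ c ≤ (ℑ L : Matrix (Fin m) (Fin m) ℂ))
    {H : Fin n → Matrix (Fin m) (Fin m) ℂ} {δ : ℝ}
    (hH : (ℑ ((n : ℝ)⁻¹ • ∑ k, H k) : Matrix (Fin m) (Fin m) ℂ) ≤ 0)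
    (happ : ∀ k, ‖(L - covarianceMap a ((n : ℝ)⁻¹ • ∑ j, H j)) * H k - 1‖ ≤ δ)
    (hsmall : (∑ p, ‖a p‖ ^ 2) * (c⁻¹ * δ) ≤ c / 2) (hq : 0 ≤ q) (k : Fin n) :
    ‖H k - G L‖ ≤ c⁻¹ * δ + q * (2 * c⁻¹ ^ 2 * ((∑ p, ‖a p‖ ^ 2) * (c⁻¹ * δ))) := by
  set Hm := (n : ℝ)⁻¹ • ∑ j, H j with hHm
  set W := L - covarianceMap a Hm with hW
  have hWi : algebraMap ℝ _ c ≤ (ℑ W : Matrix (Fin m) (Fin m) ℂ) := by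
    rw [hW, map_sub, AddSubgroupClass.coe_sub, imaginaryPart_covarianceMap ha]
    refine hL.trans ?_
    rw [le_sub_self_iff, ← neg_nonneg, ← map_neg]
    exact covarianceMap_nonneg ha (neg_nonneg.2 hH)
  have hWu : IsUnit W := isUnit_of_le_imaginaryPart hc hWi
  set H' := Ring.inverse W with hH'
  have hH'n : ‖H'‖ ≤ c⁻¹ := norm_ringInverse_le hc hWi
  have hH'i : (ℑ H' : Matrix (Fin m) (Fin m) ℂ) ≤ 0 :=
    imaginaryPart_ringInverse_nonpos hWu ((algebraMap_nonneg _ hc.le).trans hWi)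
  have hd : ∀ k, ‖H k - H'‖ ≤ c⁻¹ * δ := by
    intro k
    have h1 : H k - H' = H' * (W * H k - 1) := by
      rw [mul_sub, ← mul_assoc, Ring.inverse_mul_cancel _ hWu, one_mul, mul_one]
    rw [h1]
    exact (norm_mul_le _ _).trans (mul_le_mul hH'n (happ k) (norm_nonneg _) (by positivity))
  have hdm : ‖Hm - H'‖ ≤ c⁻¹ * δ := norm_average_sub_le hn hd
  set L' := L - covarianceMap a (Hm - H') with hL'
  have hLL : ‖L' - L‖ ≤ (∑ p, ‖a p‖ ^ 2) * (c⁻¹ * δ) := by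
    rw [hL', sub_sub_cancel_left, norm_neg]
    exact (norm_covarianceMap_le a _).trans (by gcongr)
  -- The smallness hypothesis ensures that the shift consumes at most half of the imaginary part.
  have hL'i : algebraMap ℝ _ (c / 2) ≤ (ℑ L' : Matrix (Fin m) (Fin m) ℂ) := by
    have h1 : (ℑ (covarianceMap a (Hm - H')) : Matrix (Fin m) (Fin m) ℂ) ≤
        algebraMap ℝ _ (c / 2) := by
      refine (imaginaryPart_le_algebraMap_norm _).trans (algebraMap_mono _ (le_trans ?_ hsmall))
      exact (norm_covarianceMap_le a _).trans (by gcongr)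
    rw [hL', map_sub, AddSubgroupClass.coe_sub]
    calc algebraMap ℝ (Matrix (Fin m) (Fin m) ℂ) (c / 2) =
        algebraMap ℝ _ c - algebraMap ℝ _ (c / 2) := by rw [← map_sub]; congr 1; ring
      _ ≤ _ := sub_le_sub hL h1
  have hc2 : 0 < c / 2 := by positivity
  have hdy : (L' - covarianceMap a H') * H' = 1 := by
    have h1 : L' - covarianceMap a H' = W := by
      rw [hL', hW, map_sub]
      abel
    rw [h1, Ring.mul_inverse_cancel _ hWu]
  have hGL' : H' = G L' := dyson_unique ha (posDef_of_algebraMap_le hc2 hL'i) hdy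
    (hG.dyson L' _ hc2 hL'i) hH'i (hG.imaginaryPart_nonpos L' _ hc2 hL'i)
  have h3 := hG.norm_sub_le L' _ hc2 hL'i L _ hc hL
  rw [← hGL', norm_sub_rev L L'] at h3
  calc ‖H k - G L‖ ≤ ‖H k - H'‖ + ‖H' - G L‖ := norm_sub_le_norm_sub_add_norm_sub _ _ _
    _ ≤ c⁻¹ * δ + q * (c⁻¹ * ((∑ p, ‖a p‖ ^ 2) * (c⁻¹ * δ)) * (c / 2)⁻¹) := by
        refine add_le_add (hd k) (h3.trans ?_)
        gcongr
    _ = _ := by rw [inv_div]; field_simp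

/-- If the defect is small, the stability estimate applies. Otherwise `1 ≤ 2 κ D c⁻⁶ / n`, with `κ =
∑ ‖a p‖²`, and multiplying the trivial bound `2 q² ‖b‖ c⁻²` by this quantity gives the term in
`c⁻⁸`. No threshold on `n` is thus imposed. -/
lemma IsDysonSolution.norm_conj_sub_le {G : Matrix (Fin m) (Fin m) ℂ → Matrix (Fin m) (Fin m) ℂ}
    (hG : IsDysonSolution a q G) (ha : ∀ p, (a p).IsHermitian) (hn : 1 ≤ n) (hc : 0 < c)
    (hL : algebraMap ℝ _ c ≤ (ℑ L : Matrix (Fin m) (Fin m) ℂ))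
    {H : Fin n → Matrix (Fin m) (Fin m) ℂ}
    (hH : (ℑ ((n : ℝ)⁻¹ • ∑ k, H k) : Matrix (Fin m) (Fin m) ℂ) ≤ 0)
    (hHn : ∀ k, ‖H k‖ ≤ q * c⁻¹) (hD : 0 ≤ D)
    (happ : ∀ k, ‖(L - covarianceMap a ((n : ℝ)⁻¹ • ∑ j, H j)) * H k - 1‖ ≤ D * c⁻¹ ^ 4 / n)
    (hq : 0 ≤ q) (k : Fin n) :
    ‖H k * b * H k - G L * b * G L‖ ≤
      (2 * q * ‖b‖ * D * c⁻¹ ^ 6 + 4 * q ^ 2 * ‖b‖ * (∑ p, ‖a p‖ ^ 2) * D * c⁻¹ ^ 8) / n := by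
  have hn0 : (0 : ℝ) < n := by exact_mod_cast hn
  set κ := ∑ p, ‖a p‖ ^ 2 with hκ
  have hκ0 : 0 ≤ κ := by positivity
  set y := c⁻¹ with hy
  have hy0 : 0 < y := inv_pos.2 hc
  have hGn := hG.norm_le L c hc hL
  have hqy : 0 ≤ q * y := by positivity
  by_cases hsmall : κ * (y * (D * y ^ 4 / n)) ≤ c / 2
  · have h1 := norm_conj_sub_conj_le (b := b) hqy (hHn k) hGn
      (hG.norm_sub_le_of_approx ha hn hc hL hH happ hsmall hq k)
    refine h1.trans (le_of_eq ?_)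
    rw [← hκ, ← hy]
    ring
  · push Not at hsmall
    have h2 : (1 : ℝ) ≤ 2 * κ * D * y ^ 6 / n := by
      have h3 : c * y = 1 := mul_inv_cancel₀ hc.ne'
      have h4 := (mul_lt_mul_of_pos_right hsmall hy0).le
      have h5 : κ * (y * (D * y ^ 4 / n)) * y = κ * D * y ^ 6 / n := by field_simp
      have h6 : c / 2 * y = 1 / 2 := by rw [div_mul_eq_mul_div, h3]
      have h7 : 2 * κ * D * y ^ 6 / n = 2 * (κ * D * y ^ 6 / n) := by ring
      rw [h7]
      linarith
    have h8 : ∀ g : Matrix (Fin m) (Fin m) ℂ, ‖g‖ ≤ q * y →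
        ‖g * b * g‖ ≤ q * y * ‖b‖ * (q * y) := by
      intro g hg
      refine norm_mul₃_le.trans ?_
      gcongr
    calc ‖H k * b * H k - G L * b * G L‖
        ≤ q * y * ‖b‖ * (q * y) + q * y * ‖b‖ * (q * y) :=
          (_root_.norm_sub_le _ _).trans (add_le_add (h8 _ (hHn k)) (h8 _ hGn))
      _ = 2 * q ^ 2 * ‖b‖ * y ^ 2 * 1 := by ring
      _ ≤ 2 * q ^ 2 * ‖b‖ * y ^ 2 * (2 * κ * D * y ^ 6 / n) := by gcongr
      _ = (4 * q ^ 2 * ‖b‖ * κ * D * y ^ 8) / n := by ring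
      _ ≤ _ := by
          gcongr
          have : 0 ≤ 2 * q * ‖b‖ * D * y ^ 6 := by positivity
          linarith

lemma IsFaithfulState.isDysonSolution {B : Type*} [CStarAlgebra B] [PartialOrder B]
    [StarOrderedRing B] {τ : B →ₗ[ℂ] ℂ} {x : Fin r → B} (hτ : IsFaithfulState τ)
    (hx : IsSemicircularSystem τ x) (ha : ∀ p, (a p).IsHermitian) :
    IsDysonSolution a (2 * (m : ℝ) ^ 2) (fun L => hτ.matrixState m (freeResolvent L a x)) where
  dyson L c hc hL := hτ.dyson hx ha hc hL
  imaginaryPart_nonpos L c hc hL :=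
    hτ.imaginaryPart_matrixState_freeResolvent ha hx.isSelfAdjoint hc hL
  norm_le L c hc hL := (hτ.norm_matrixState_le _).trans
    (mul_le_mul_of_nonneg_left (norm_freeResolvent_le ha hx.isSelfAdjoint hc hL) (by positivity))
  norm_sub_le L c hc hL L' c' hc' hL' := by
    rw [← map_sub]
    exact (hτ.norm_matrixState_le _).trans (mul_le_mul_of_nonneg_left
      (norm_freeResolvent_sub_le ha hx.isSelfAdjoint hc hL hc' hL') (by positivity))

end Comparison

/-! ### From Wigner matrices to product measures -/

section Transfer

open scoped MatrixOrder

variable {Ω : Type*} [MeasurableSpace Ω] {ρ : Measure Ω} {μ : Measure ℝ} {n r m : ℕ}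
  {X : Fin r → Ω → Matrix (Fin n) (Fin n) ℂ}

/-- The standardized coordinates of a Wigner family. -/
def wignerCoord (X : Fin r → Ω → Matrix (Fin n) (Fin n) ℂ) (ω : Ω)
    (i : Fin r × (Fin n × Fin n)) : ℝ :=
  √(n : ℝ) * hermitianCoord (X i.1 ω) i.2

lemma measurable_hermitianCoord (q : Fin n × Fin n) :
    Measurable fun M : Fin n → Fin n → ℂ => hermitianCoord (Matrix.of M) q := by
  unfold hermitianCoord
  simp only [Matrix.of_apply]
  split_ifs <;> fun_prop

lemma IsWignerFamily.measurable_coord (hX : IsWignerFamily ρ μ X) (i : Fin r × (Fin n × Fin n)) :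
    Measurable fun ω => hermitianCoord (X i.1 ω) i.2 :=
  (measurable_hermitianCoord i.2).comp (f := fun ω j k => X i.1 ω j k)
    (measurable_pi_lambda _ fun j => measurable_pi_lambda _ fun k => (hX.wigner i.1).measurable j k)

/-- Independence across the family and within each matrix combine into joint independence of all
coordinates, and the factor `√n` cancels the normalization of their law. -/
lemma IsWignerFamily.map_wignerCoord [IsProbabilityMeasure ρ] (hX : IsWignerFamily ρ μ X)
    (hn : 1 ≤ n) : ρ.map (wignerCoord X) = Measure.pi fun _ => μ := by
  have hn0 : √(n : ℝ) ≠ 0 := by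
    have : (0 : ℝ) < n := by exact_mod_cast hn
    positivity
  have h1 : iIndepFun (fun (p : Fin r) ω (q : Fin n × Fin n) => hermitianCoord (X p ω) q) ρ :=
    hX.indep.comp (fun _ M q => hermitianCoord (Matrix.of M) q)
      fun _ => measurable_pi_lambda _ fun q => measurable_hermitianCoord q
  have h2 := iIndepFun_uncurry' (fun p q => hX.measurable_coord (p, q)) h1
    (fun p => (hX.wigner p).indep)
  have h3 : iIndepFun (fun (i : Fin r × (Fin n × Fin n)) ω => wignerCoord X ω i) ρ :=
    h2.comp (fun _ t => √(n : ℝ) * t) fun _ => by fun_prop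
  have h4 := h3.map_fun_eq_pi_map fun i => ((hX.measurable_coord i).const_mul _).aemeasurable
  refine h4.trans (congrArg _ (funext fun i => ?_))
  have h5 : (fun ω => √(n : ℝ) * hermitianCoord (X i.1 ω) i.2) =
      (fun t => √(n : ℝ) * t) ∘ fun ω => hermitianCoord (X i.1 ω) i.2 := rfl
  rw [h5, ← Measure.map_map (by fun_prop) (hX.measurable_coord i), (hX.wigner i.1).law i.2,
    Measure.map_map (by fun_prop) (by fun_prop)]
  convert Measure.map_id using 2
  ext t
  simp only [Function.comp_apply, id]
  field_simp

lemma IsWignerFamily.measurable_wignerCoord (hX : IsWignerFamily ρ μ X) :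
    Measurable (wignerCoord X) :=
  measurable_pi_lambda _ fun i => (hX.measurable_coord i).const_mul _

/-- `(1/n) ∑ k, G_{kk} b G_{kk}` as a function of the standardized coordinates. -/
def diagMean (n : ℕ) (L : Matrix (Fin m) (Fin m) ℂ) (a : Fin r → Matrix (Fin m) (Fin m) ℂ)
    (b : Matrix (Fin m) (Fin m) ℂ) (z : Fin r × (Fin n × Fin n) → ℝ) :
    Matrix (Fin m) (Fin m) ℂ :=
  (n : ℝ)⁻¹ • ∑ k, resolventBlock n L a k z * b * resolventBlock n L a k z

lemma IsWignerFamily.matrixPencil_eq (hX : IsWignerFamily ρ μ X) (hn : 1 ≤ n)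
    (a₀ : Matrix (Fin m) (Fin m) ℂ) (a : Fin r → Matrix (Fin m) (Fin m) ℂ)
    (l : Matrix (Fin m) (Fin m) ℂ) (ω : Ω) :
    matrixPencil a₀ a (fun p => X p ω) l = (l - a₀) ⊗ₖ (1 : Matrix (Fin n) (Fin n) ℂ) -
      ∑ i, wignerCoord X ω i • wignerCoeff n a i :=
  _root_.matrixPencil_eq a₀ a (fun p => (hX.wigner p).isHermitian ω) l hn

lemma IsWignerFamily.diagResolventMean_eq (hX : IsWignerFamily ρ μ X) (hn : 1 ≤ n)
    (a₀ : Matrix (Fin m) (Fin m) ℂ) (a : Fin r → Matrix (Fin m) (Fin m) ℂ)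
    (b l : Matrix (Fin m) (Fin m) ℂ) (ω : Ω) :
    diagResolventMean a₀ a (fun p => X p ω) b l = diagMean n (l - a₀) a b (wignerCoord X ω) := by
  have h1 : (matrixPencil a₀ a (fun p => X p ω) l)⁻¹ =
      wignerResolvent n (l - a₀) a (wignerCoord X ω) := by
    rw [Matrix.nonsing_inv_eq_ringInverse, hX.matrixPencil_eq hn]
    rfl
  rw [diagResolventMean, h1, diagMean, ← Complex.coe_smul]
  simp [resolventBlock]

variable [IsProbabilityMeasure μ] {L : Matrix (Fin m) (Fin m) ℂ}
  {a : Fin r → Matrix (Fin m) (Fin m) ℂ} {c C : ℝ}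

lemma continuous_conj_resolventBlock (ha : ∀ p, (a p).IsHermitian) (hc : 0 < c)
    (hL : algebraMap ℝ _ c ≤ (ℑ L : Matrix (Fin m) (Fin m) ℂ)) (b : Matrix (Fin m) (Fin m) ℂ)
    (k : Fin n) :
    Continuous fun z => resolventBlock n L a k z * b * resolventBlock n L a k z :=
  have h := continuous_resolventBlock ha hc hL k
  (h.mul continuous_const).mul h

lemma integrable_conj_resolventBlock (ha : ∀ p, (a p).IsHermitian) (hc : 0 < c)
    (hL : algebraMap ℝ _ c ≤ (ℑ L : Matrix (Fin m) (Fin m) ℂ)) (b : Matrix (Fin m) (Fin m) ℂ)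
    (k : Fin n) :
    Integrable (fun z => resolventBlock n L a k z * b * resolventBlock n L a k z)
      (Measure.pi fun _ => μ) := by
  refine integrable_of_bounded (continuous_conj_resolventBlock ha hc hL b k).stronglyMeasurable
    (c := (m : ℝ) ^ 2 * c⁻¹ * ‖b‖ * ((m : ℝ) ^ 2 * c⁻¹)) fun z => norm_mul₃_le.trans ?_
  have := norm_resolventBlock_le (n := n) ha hc hL k z
  gcongr

lemma integrable_diagMean (ha : ∀ p, (a p).IsHermitian) (hc : 0 < c)
    (hL : algebraMap ℝ _ c ≤ (ℑ L : Matrix (Fin m) (Fin m) ℂ)) (b : Matrix (Fin m) (Fin m) ℂ) :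
    Integrable (diagMean n L a b) (Measure.pi fun _ => μ) := by
  have h := integrable_finsetSum (μ := Measure.pi fun _ : Fin r × (Fin n × Fin n) => μ)
    Finset.univ fun k _ => integrable_conj_resolventBlock ha hc hL b k
  exact h.smul ((n : ℝ)⁻¹)

lemma integral_diagMean (ha : ∀ p, (a p).IsHermitian) (hc : 0 < c)
    (hL : algebraMap ℝ _ c ≤ (ℑ L : Matrix (Fin m) (Fin m) ℂ)) (b : Matrix (Fin m) (Fin m) ℂ) :
    ∫ z, diagMean n L a b z ∂(Measure.pi fun _ => μ) = (n : ℝ)⁻¹ • ∑ k,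
      ∫ z, resolventBlock n L a k z * b * resolventBlock n L a k z ∂(Measure.pi fun _ => μ) := by
  simp only [diagMean]
  rw [integral_smul, integral_finsetSum _ fun k _ => integrable_conj_resolventBlock ha hc hL b k]

/-- For each `k`, the variance bound replaces `E[R_kk b R_kk]` by `E[R_kk] b E[R_kk]`, and stability
replaces `E[R_kk]` by `G L`. The estimate is uniform in `k`, hence survives averaging. -/
lemma IsDysonSolution.norm_integral_diagMean_sub_le {q : ℝ}
    {G : Matrix (Fin m) (Fin m) ℂ → Matrix (Fin m) (Fin m) ℂ} (hG : IsDysonSolution a q G)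
    (hq : (m : ℝ) ^ 2 ≤ q) (hμ : IsPoincareLaw μ C) (hn : 1 ≤ n) (ha : ∀ p, (a p).IsHermitian)
    (hc : 0 < c) (hL : algebraMap ℝ _ c ≤ (ℑ L : Matrix (Fin m) (Fin m) ℂ))
    (b : Matrix (Fin m) (Fin m) ℂ) :
    ‖∫ z, diagMean n L a b z ∂(Measure.pi fun _ => μ) - G L * b * G L‖ ≤
      (2 * ‖b‖ * varConst C a * c⁻¹ ^ 4 + 2 * q * ‖b‖ * dysonConst μ C a * c⁻¹ ^ 6 +
        4 * q ^ 2 * ‖b‖ * (∑ p, ‖a p‖ ^ 2) * dysonConst μ C a * c⁻¹ ^ 8) / n := by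
  rw [integral_diagMean ha hc hL]
  refine norm_average_sub_le hn fun k => ?_
  have hq0 : 0 ≤ q := le_trans (by positivity) hq
  have h1 := norm_integral_diag_sub_le (n := n) hμ ha hc hL b k
  have h2 := hG.norm_conj_sub_le (b := b) ha hn hc hL (H := meanBlock μ n L a)
    (imaginaryPart_meanTrace_nonpos ha hc hL)
    (fun k => (norm_meanBlock_le ha hc hL k).trans (by gcongr))
    (dysonConst_nonneg hμ.pos.le a) (norm_dyson_sub_one_le hn hμ ha hc hL) hq0 k
  refine (norm_sub_le_norm_sub_add_norm_sub _ _ _).trans ((add_le_add h1 h2).trans (le_of_eq ?_))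
  ring

lemma IsWignerFamily.integrable_diagResolventMean_apply [IsProbabilityMeasure ρ]
    (hX : IsWignerFamily ρ μ X) (hn : 1 ≤ n) (a₀ : Matrix (Fin m) (Fin m) ℂ)
    (ha : ∀ p, (a p).IsHermitian) (hc : 0 < c) (b l : Matrix (Fin m) (Fin m) ℂ)
    (hL : algebraMap ℝ _ c ≤ (ℑ (l - a₀) : Matrix (Fin m) (Fin m) ℂ)) (i j : Fin m) :
    Integrable (fun ω => diagResolventMean a₀ a (fun p => X p ω) b l i j) ρ := by
  simp only [hX.diagResolventMean_eq hn]
  have h1 : Integrable (diagMean n (l - a₀) a b) (ρ.map (wignerCoord X)) := by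
    rw [hX.map_wignerCoord hn]
    exact integrable_diagMean ha hc hL b
  exact (entryL i j).integrable_comp (h1.comp_measurable hX.measurable_wignerCoord)

lemma IsWignerFamily.expMatrix_diagResolventMean [IsProbabilityMeasure ρ]
    (hX : IsWignerFamily ρ μ X) (hn : 1 ≤ n) (a₀ : Matrix (Fin m) (Fin m) ℂ)
    (ha : ∀ p, (a p).IsHermitian) (hc : 0 < c) (b l : Matrix (Fin m) (Fin m) ℂ)
    (hL : algebraMap ℝ _ c ≤ (ℑ (l - a₀) : Matrix (Fin m) (Fin m) ℂ)) :
    expMatrix ρ (fun ω => diagResolventMean a₀ a (fun p => X p ω) b l) =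
      ∫ z, diagMean n (l - a₀) a b z ∂(Measure.pi fun _ => μ) := by
  have hint := integrable_diagMean (μ := μ) (n := n) ha hc hL b
  ext i j
  simp only [expMatrix, Matrix.of_apply, hX.diagResolventMean_eq hn]
  rw [← entryL_apply i j (∫ z, _ ∂_), ← (entryL i j).integral_comp_comm hint,
    ← hX.map_wignerCoord hn, integral_map hX.measurable_wignerCoord.aemeasurable]
  · rfl
  · rw [hX.map_wignerCoord hn]
    exact ((entryL i j).integrable_comp hint).aestronglyMeasurable

end Transfer

/-! ### A dominating polynomial of degree 10 -/

section Bound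

open Polynomial in
/-- The polynomial `t ∑ i ≤ 10, Xⁱ`. -/
def geomPolynomial (t : ℝ) : ℝ[X] := ∑ i ∈ Finset.range 11, Polynomial.monomial i t

lemma coeff_geomPolynomial (t : ℝ) (i : ℕ) :
    (geomPolynomial t).coeff i = if i ≤ 10 then t else 0 := by
  simp [geomPolynomial, Polynomial.finsetSum_coeff, Polynomial.coeff_monomial, Nat.lt_succ_iff]

lemma natDegree_geomPolynomial {t : ℝ} (ht : 0 < t) : (geomPolynomial t).natDegree = 10 := by
  refine le_antisymm (Polynomial.natDegree_le_iff_coeff_eq_zero.2 fun i hi => ?_)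
    (Polynomial.le_natDegree_of_ne_zero ?_)
  · rw [coeff_geomPolynomial, if_neg (by omega)]
  · rw [coeff_geomPolynomial, if_pos le_rfl]
    exact ht.ne'

lemma eval_geomPolynomial (t y : ℝ) :
    (geomPolynomial t).eval y = ∑ i ∈ Finset.range 11, t * y ^ i := by
  simp [geomPolynomial, Polynomial.eval_finsetSum]

/-- The common coefficient dominates each of the three constants, and the extra 1 keeps it positive
even if all of them vanish, as when `b = 0`. -/
lemma le_eval_geomPolynomial {c₄ c₆ c₈ y : ℝ} (h₄ : 0 ≤ c₄) (h₆ : 0 ≤ c₆) (h₈ : 0 ≤ c₈)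
    (hy : 0 ≤ y) :
    c₄ * y ^ 4 + c₆ * y ^ 6 + c₈ * y ^ 8 ≤ (geomPolynomial (c₄ + c₆ + c₈ + 1)).eval y := by
  rw [eval_geomPolynomial]
  have h : ∀ s ⊆ Finset.range 11, ∑ i ∈ s, (c₄ + c₆ + c₈ + 1) * y ^ i ≤
      ∑ i ∈ Finset.range 11, (c₄ + c₆ + c₈ + 1) * y ^ i := fun s hs =>
    Finset.sum_le_sum_of_subset_of_nonneg hs fun i _ _ => by positivity
  refine le_trans ?_ (h {4, 6, 8} (by decide))
  rw [Finset.sum_insert (by decide), Finset.sum_insert (by decide), Finset.sum_singleton,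
    ← add_assoc]
  gcongr <;> linarith

end Bound

end

/-! ### Choice of constants and conclusion -/

theorem mainTheorem7
    (μ : Measure ℝ) [IsProbabilityMeasure μ]
    (hsymm : IsSymmetricLaw μ) (hvar : variance id μ = 1) (hpoin : SatisfiesPoincare μ)
    (m r : ℕ) (a₀ : Matrix (Fin m) (Fin m) ℂ) (a : Fin r → Matrix (Fin m) (Fin m) ℂ)
    (ha₀ : a₀.IsHermitian) (ha : ∀ p, (a p).IsHermitian)
    (b : Matrix (Fin m) (Fin m) ℂ) :
    ∃ (K : ℝ) (P : Polynomial ℝ), 0 < K ∧ P.natDegree = 10 ∧ (∀ i ≤ 10, 0 < P.coeff i) ∧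
      ∀ (n : ℕ), 1 ≤ n →
      ∀ (Ω : Type u) [MeasurableSpace Ω] (ρ : Measure Ω) [IsProbabilityMeasure ρ]
        (X : Fin r → Ω → Matrix (Fin n) (Fin n) ℂ), IsWignerFamily ρ μ X →
      ∀ (B : Type v) [CStarAlgebra B] (τ : B →ₗ[ℂ] ℂ) (x : Fin r → B),
        IsFaithfulState τ → IsSemicircularSystem τ x →
      ∀ l ∈ upperHalfMatrices m,
        (∀ ω, IsUnit (matrixPencil a₀ a (fun p => X p ω) l)) ∧
        IsUnit (freePencil a₀ a x l) ∧
        (∀ i j, Integrable (fun ω => diagResolventMean a₀ a (fun p => X p ω) b l i j) ρ) ∧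
        ‖expMatrix ρ (fun ω => diagResolventMean a₀ a (fun p => X p ω) b l) -
            freeStieltjes τ a₀ a x l * b * freeStieltjes τ a₀ a x l‖ ≤
          (‖l‖ + K) * P.eval (invImNorm l) / n := by
  obtain ⟨C, hμ⟩ := exists_isPoincareLaw hsymm hvar hpoin
  have hD := dysonConst_nonneg (μ := μ) hμ.pos.le a
  have hV := varConst_nonneg hμ.pos.le a
  -- This constant bounds `id ⊗ τ`, and also dominates the factor `m²` in the bound on the blocks of
  -- `R`.
  set q : ℝ := 2 * (m : ℝ) ^ 2 with hq
  set c₄ := 2 * ‖b‖ * varConst C a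
  set c₆ := 2 * q * ‖b‖ * dysonConst μ C a
  set c₈ := 4 * q ^ 2 * ‖b‖ * (∑ p, ‖a p‖ ^ 2) * dysonConst μ C a
  have h₄ : 0 ≤ c₄ := by positivity
  have h₆ : 0 ≤ c₆ := by positivity
  have h₈ : 0 ≤ c₈ := by positivity
  have ht : 0 < c₄ + c₆ + c₈ + 1 := by positivity
  -- Any positive `K ≥ 1` works: the estimate holds without the factor `‖l‖ + K`, which is only used
  -- to be at least 1.
  refine ⟨1, geomPolynomial (c₄ + c₆ + c₈ + 1), one_pos, natDegree_geomPolynomial ht,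
    fun i hi => by rwa [coeff_geomPolynomial, if_pos hi], ?_⟩
  intro n hn Ω _ ρ _ X hX B _ τ x hτ hx l hl
  -- The order on `B` is not part of the data; the spectral order makes the positivity arguments
  -- available.
  let := CStarAlgebra.spectralOrder B
  have := CStarAlgebra.spectralOrderedRing B
  open scoped MatrixOrder in
  have him : (ℑ (l - a₀) : Matrix (Fin m) (Fin m) ℂ) = ℑ l := by
    rw [map_sub, AddSubgroupClass.coe_sub, IsSelfAdjoint.imaginaryPart ha₀]
    simp
  have hl' : (ℑ l : Matrix (Fin m) (Fin m) ℂ).PosDef := hl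
  open scoped MatrixOrder in
  have key : ∀ c : ℝ, 0 < c → algebraMap ℝ _ c ≤ (ℑ l : Matrix (Fin m) (Fin m) ℂ) →
      (∀ ω, IsUnit (matrixPencil a₀ a (fun p => X p ω) l)) ∧
        IsUnit (freePencil a₀ a x l) ∧
        (∀ i j, Integrable (fun ω => diagResolventMean a₀ a (fun p => X p ω) b l i j) ρ) ∧
        ‖expMatrix ρ (fun ω => diagResolventMean a₀ a (fun p => X p ω) b l) -
            freeStieltjes τ a₀ a x l * b * freeStieltjes τ a₀ a x l‖ ≤
          (c₄ * c⁻¹ ^ 4 + c₆ * c⁻¹ ^ 6 + c₈ * c⁻¹ ^ 8) / n := by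
    intro c hc hcl
    rw [← him] at hcl
    refine ⟨fun ω => ?_, ?_, fun i j => ?_, ?_⟩
    · rw [hX.matrixPencil_eq hn]
      exact isUnit_affine (isSelfAdjoint_wignerCoeff ha) hc
        (le_imaginaryPart_kronecker_one hcl) _
    · have h := isUnit_scalarMatrix_sub_freeSum (x := x) ha hx.isSelfAdjoint hc hcl
      rw [← ofMatrix_freePencil] at h
      exact h
    · exact hX.integrable_diagResolventMean_apply hn a₀ ha hc b l hcl i j
    · have hG : freeStieltjes τ a₀ a x l = hτ.matrixState m (freeResolvent (l - a₀) a x) := by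
        rw [freeResolvent, ← ofMatrix_freePencil]
        rfl
      rw [hX.expMatrix_diagResolventMean hn a₀ ha hc b l hcl, hG]
      exact (hτ.isDysonSolution hx ha).norm_integral_diagMean_sub_le
        (by rw [two_mul]; exact le_add_of_nonneg_left (by positivity)) hμ hn ha hc hcl b
  have hev : 0 ≤ (geomPolynomial (c₄ + c₆ + c₈ + 1)).eval (invImNorm l) := by
    rw [eval_geomPolynomial]
    exact Finset.sum_nonneg fun i _ => mul_nonneg ht.le (pow_nonneg (norm_nonneg _) i)
  rcases subsingleton_or_nontrivial (Matrix (Fin m) (Fin m) ℂ) with hm | hm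
  -- For `m = 0` the inverse has norm 0 and gives no admissible `c`; any `c` works and the norm to
  -- be bounded is 0.
  · obtain ⟨h1, h2, h3, -⟩ := key 1 one_pos (Subsingleton.elim _ _).le
    refine ⟨h1, h2, h3, ?_⟩
    rw [Subsingleton.elim (expMatrix ρ _ - _) (0 : Matrix (Fin m) (Fin m) ℂ), norm_zero]
    positivity
  · have hk := Matrix.isStrictlyPositive_iff_posDef.2 hl'
    have hpos : 0 < ‖Ring.inverse (ℑ l : Matrix (Fin m) (Fin m) ℂ)‖ :=
      norm_pos_iff.2 hk.isUnit.ringInverse.ne_zero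
    -- The choice `c = 1/‖Im(l)⁻¹‖` makes `c⁻¹` equal to `invImNorm l`.
    obtain ⟨h1, h2, h3, h4⟩ := key _ (inv_pos.2 hpos) (algebraMap_inv_norm_le hk hpos)
    refine ⟨h1, h2, h3, h4.trans ?_⟩
    rw [inv_inv, ← Matrix.nonsing_inv_eq_ringInverse]
    change (c₄ * invImNorm l ^ 4 + c₆ * invImNorm l ^ 6 + c₈ * invImNorm l ^ 8) / n ≤ _
    gcongr
    refine (le_eval_geomPolynomial h₄ h₆ h₈ (norm_nonneg _)).trans ?_
    exact le_mul_of_one_le_left hev (le_add_of_nonneg_left (norm_nonneg _))
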